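/- Let $G$ be a finite graph. Start with weight $1$ on every vertex. A unit acquisition move transfers one unit of weight from a vertex $u$ of positive weight to a neighbor $v$ whose weight before the move is at least that of $u$. The unit acquisition number $a_u(G)$ is the minimum number of vertices of positive weight in a distribution that can be reached by a finite sequence of unit acquisition moves. A caterpillar is a tree in which all non-leaf vertices lie on one path. Then the unit acquisition number of a caterpillar can be computed in linear time. That is, there are a random access machine program $P$ and a constant $C$ such that, for every caterpillar $T$ with vertex set $\{0,\dots,n-1\}$, given by $n$, its number of edges and a list of its edges (in any order, each edge listed once as a pair of endpoints in either order), the program $P$ halts after at most $C\,n = C\,|V(T)|$ steps with output $a_u(T)$. Here the machine has unit-cost instructions: setting a register to a constant, addition, truncated subtraction, indirect load and store, and a conditional jump comparing two registers. Moreover, all numbers held in registers or memory cells (hence all addresses used) during the computation are at most $C\,n$, so that words of $O(\log(n+1))$ bits suffice. -/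

import Mathlib

/-! ### Unit acquisition -/

namespace UnitAcquisition

/-- `UnitMove G w w'`: the weight distribution `w'` arises from `w` by transferring one unit of
weight from a vertex `u` (which has some weight) to a neighbour `v` that has, before the move,
at least as much weight as `u`. -/
def UnitMove {V : Type*} [DecidableEq V] (G : SimpleGraph V) (w w' : V → ℕ) : Prop :=
  ∃ u v : V, G.Adj u v ∧ 0 < w u ∧ w u ≤ w v ∧
    w' = Function.update (Function.update w u (w u - 1)) v (w v + 1)

/-- `w` can be reached by finitely many unit acquisition moves from the distribution
in which every vertex has weight `1`. -/
def Reachable {V : Type*} [DecidableEq V] (G : SimpleGraph V) (w : V → ℕ) : Prop :=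
  Relation.ReflTransGen (UnitMove G) (fun _ => 1) w

/-- The unit acquisition number `a_u(G)` of a finite graph: the minimum number of vertices of
positive weight in a reachable distribution. (The set is nonempty: the initial distribution is
reachable.) -/
noncomputable def unitAcquisitionNumber {V : Type*} [Fintype V] [DecidableEq V]
    (G : SimpleGraph V) : ℕ :=
  sInf {k : ℕ | ∃ w : V → ℕ, Reachable G w ∧ (Finset.univ.filter (fun v => 0 < w v)).card = k}

/-- A leaf is a vertex with exactly one neighbour. -/
def IsLeaf {V : Type*} (G : SimpleGraph V) (v : V) : Prop :=
  ∃! u : V, G.Adj v u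

/-- A caterpillar is a tree in which all non-leaf vertices lie on one path. -/
def IsCaterpillar {V : Type*} (G : SimpleGraph V) : Prop :=
  G.IsTree ∧ ∃ (a b : V) (p : G.Walk a b), p.IsPath ∧ ∀ v : V, ¬ IsLeaf G v → v ∈ p.support

/-- `es` lists every edge of `G` exactly once, in arbitrary order, each edge being given by its
two endpoints in arbitrary order. -/
def IsEdgeList {V : Type*} (G : SimpleGraph V) (es : List (V × V)) : Prop :=
  (es.map (fun e => s(e.1, e.2))).Nodup ∧
    ∀ e : Sym2 V, e ∈ es.map (fun e => s(e.1, e.2)) ↔ e ∈ G.edgeSet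

/-- The input word of a graph with vertices `0, …, n - 1`: the number of vertices, the number of
edges, and then the two endpoints of each edge. -/
def encodeGraph {n : ℕ} (es : List (Fin n × Fin n)) : List ℕ :=
  n :: es.length :: es.flatMap (fun e => [(e.1 : ℕ), (e.2 : ℕ)])

end UnitAcquisition

/-! ### Random access machines with unit-cost instructions -/

namespace RAM

/-- Instructions. Registers are named by fixed numbers; memory is addressed through the
content of a register. -/
inductive Instr where
  /-- `reg r := k` -/
  | const (r k : ℕ) : Instr
  /-- `reg r := reg a + reg b` -/
  | add (r a b : ℕ) : Instr
  /-- `reg r := reg a - reg b` (truncated at `0`) -/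
  | sub (r a b : ℕ) : Instr
  /-- `reg r := mem (reg a)` -/
  | load (r a : ℕ) : Instr
  /-- `mem (reg a) := reg r` -/
  | store (a r : ℕ) : Instr
  /-- if `reg a ≤ reg b`, continue at position `l` of the program -/
  | jumpLE (a b l : ℕ) : Instr

/-- A program is a finite list of instructions. -/
abbrev Program := List Instr

/-- A configuration: program counter, registers, memory. -/
structure Config where
  pc : ℕ
  reg : ℕ → ℕ
  mem : ℕ → ℕ

/-- The effect of one instruction. -/
def Instr.exec (c : Config) : Instr → Config
  | .const r k => { c with pc := c.pc + 1, reg := Function.update c.reg r k }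
  | .add r a b => { c with pc := c.pc + 1, reg := Function.update c.reg r (c.reg a + c.reg b) }
  | .sub r a b => { c with pc := c.pc + 1, reg := Function.update c.reg r (c.reg a - c.reg b) }
  | .load r a => { c with pc := c.pc + 1, reg := Function.update c.reg r (c.mem (c.reg a)) }
  | .store a r => { c with pc := c.pc + 1, mem := Function.update c.mem (c.reg a) (c.reg r) }
  | .jumpLE a b l => { c with pc := if c.reg a ≤ c.reg b then l else c.pc + 1 }

/-- The machine has halted when the program counter is outside the program. -/
def Halted (P : Program) (c : Config) : Prop :=
  P.length ≤ c.pc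

/-- One step: execute the current instruction; a halted configuration does not change. -/
def step (P : Program) (c : Config) : Config :=
  match P[c.pc]? with
  | none => c
  | some i => i.exec c

/-- The initial configuration: the input word is stored in the memory cells `0, 1, 2, …`;
all other cells and all registers contain `0`. -/
def init (input : List ℕ) : Config where
  pc := 0
  reg := fun _ => 0
  mem := fun i => input.getD i 0

/-- The configuration after `t` steps. -/
def run (P : Program) (input : List ℕ) (t : ℕ) : Config :=
  (step P)^[t] (init input)

/-- On the given input, `P` halts after at most `time` unit-cost steps with `output` in
register `0`, and no number exceeding `word` is ever held in a register (in particular, used as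
an address) or in a memory cell. -/
def ComputesWithin (P : Program) (input : List ℕ) (output time word : ℕ) : Prop :=
  ∃ t ≤ time, Halted P (run P input t) ∧ (run P input t).reg 0 = output ∧
    ∀ t' ≤ t, (∀ i, (run P input t').reg i ≤ word) ∧ (∀ i, (run P input t').mem i ≤ word)

end RAM

namespace UnitAcquisition

/-! ### Caterpillars as rows of spine vertices with leaf counts -/

/-! If some vertex has two neighbours, the vertices with at least two neighbours form a path, the
spine, and all other vertices are leaves attached to it, so only the numbers of leaves along the
spine matter. A leaf can give its unit to its spine vertex. A spine vertex of weight one can also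
give its unit to a leaf, but it is then dead, because nothing can be moved to a vertex of weight
zero. So the game is played on pairs (spine weights, remaining leaves) with the steps `SpineStep`.

Starting from weights one, the heights 2, 3, …, 3, 2 over a window of length k cost `tentSum k`
extra units. Call a window short if it has fewer leaves than that. The greedy partition scans a part
for the first position where a short window ends; windows keep clear of the start of the part, by
one more position if there is no leaf at the start. The next part starts behind that window. The
unit acquisition number is the number of parts.

Lower bound. Each part gets a token at its start: a leaf if there is one, otherwise the spine
vertex. Between consecutive tokens lies a short window, so the weight missing below its tent exceeds
its supply of leaves. Tents have slope at most one and units only move towards vertices that are at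
least as heavy, hence no step repairs this deficit (`deficient_shift`, `deficient_absorb`,
`deficient_kill`). The tokens follow the weight and never meet, so there are at least as many
survivors as tokens (`card_positive_of_tokens`, `Greedy.le_survivors`).

Upper bound. Inside a part no window is short, and this condition of Hall type suffices for carrying
leaf units uphill until the tent is complete (`exists_raise`). Superfluous leaves are dropped until
the whole window is tight. Demand is supermodular and supply is modular, so unions and intersections
of overlapping tight windows are tight (`Tight.union_inter`), and an induction over tight windows
yields an order of carrying (`raises_cap`). On the finished tent the weights rise towards the peak,
and the part can be drained into it (`exists_collapse_segment`, `Greedy.exists_reach`).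

Running time. Passes over the edges give the degrees, the leaf counts and, for each vertex, the sum
of its spine neighbours; with that sum the spine is walked by subtraction. Testing all windows takes
time quadratic in the length k of a part, but windows that passed the test contain at least about
k²/4 leaves. So the leaves pay for the tests (`GreedyState`), and the same estimate keeps the
numbers linear. The machine program is compiled from a structured one, which is verified with a
calculus of time budgets (`wp`). -/

/-- Two positions on the spine are consecutive. -/
def Consec (u v : ℕ) : Prop := v = u + 1 ∨ u = v + 1

/-- Moves on a state `(h, L)`, where `h` gives the weights of the spine vertices and `L` counts
the remaining leaves at each of them: a spine vertex takes the unit of one of its leaves, or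
a unit is transferred between consecutive spine vertices. -/
inductive SpineMove : (ℕ → ℕ) × (ℕ → ℕ) → (ℕ → ℕ) × (ℕ → ℕ) → Prop
  | absorb (h L : ℕ → ℕ) (i : ℕ) (hi : 0 < h i) (hL : 0 < L i) :
      SpineMove (h, L) (Function.update h i (h i + 1), Function.update L i (L i - 1))
  | shift (h L : ℕ → ℕ) (u v : ℕ) (huv : Consec u v) (hu : 0 < h u) (hle : h u ≤ h v) :
      SpineMove (h, L) (Function.update (Function.update h u (h u - 1)) v (h v + 1), L)

/-- A `SpineMove`, or a spine vertex of weight one gives its unit to one of its leaves. -/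
inductive SpineStep : (ℕ → ℕ) × (ℕ → ℕ) → (ℕ → ℕ) × (ℕ → ℕ) → Prop
  | move {s s' : (ℕ → ℕ) × (ℕ → ℕ)} (hs : SpineMove s s') : SpineStep s s'
  | kill (h L : ℕ → ℕ) (i : ℕ) (hi : h i = 1) (hL : 0 < L i) :
      SpineStep (h, L) (Function.update h i 0, L)

/-! ### Lower bound: tokens separated by deficient windows -/

/-- The heights that the window `[i, j]` needs, cut off at `0`. -/
def tent (i j z : ℕ) : ℕ := min (z + 2 - i) (j + 2 - z)

/-- First position of the interval to the right of a token; a token is a spine position (`false`)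
or a leaf at a spine position (`true`). -/
def tokenRight (t : ℕ × Bool) : ℕ := if t.2 then t.1 else t.1 + 1

/-- One more than the last position of the interval to the left of a token. -/
def tokenLeft (t : ℕ × Bool) : ℕ := if t.2 then t.1 + 1 else t.1

/-- The token has more weight than the tent over `[i, j]` allows. -/
def TokenValid (i j : ℕ) (t : ℕ × Bool) (s : (ℕ → ℕ) × (ℕ → ℕ)) : Prop :=
  if t.2 then tent i j t.1 ≤ 1 ∧ 0 < s.2 t.1
  else tent i j t.1 < s.1 t.1 ∧ (2 ≤ s.1 t.1 ∨ s.2 t.1 = 0)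

/-- Between the two tokens there is not enough weight to fill the tent over `[i, j]`. -/
def Deficient (i j : ℕ) (t t' : ℕ × Bool) (s : (ℕ → ℕ) × (ℕ → ℕ)) : Prop :=
  t.1 < t'.1 ∧
    ∑ z ∈ Finset.Icc i j, s.2 z < ∑ z ∈ Finset.Ico (tokenRight t) (tokenLeft t'), (tent i j z - s.1 z)

/-! ### Steps preserve tokens and deficits. -/

theorem sum_Ico_eq_sum_range_ite (f : ℕ → ℕ) {a b M : ℕ} (hM : b ≤ M) :
    ∑ z ∈ Finset.Ico a b, f z = ∑ z ∈ Finset.range M, if a ≤ z ∧ z < b then f z else 0 := by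
  rw [← Finset.sum_filter]
  congr 1
  ext z
  simp only [Finset.mem_Ico, Finset.mem_filter, Finset.mem_range]
  omega

theorem sum_range_le_of_two_points {M u v : ℕ} (g g' : ℕ → ℕ) (huv : u ≠ v) (hu : u < M)
    (hv : v < M) (h : ∀ z, z ≠ u → z ≠ v → g z ≤ g' z) (h2 : g u + g v ≤ g' u + g' v) :
    ∑ z ∈ Finset.range M, g z ≤ ∑ z ∈ Finset.range M, g' z := by
  have key : ∀ f : ℕ → ℕ, ∑ z ∈ Finset.range M, f z
      = (f u + f v) + ∑ z ∈ ((Finset.range M).erase u).erase v, f z := by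
    intro f
    rw [← Finset.add_sum_erase _ f (Finset.mem_range.2 hu),
      ← Finset.add_sum_erase _ f (a := v)
        (Finset.mem_erase.2 ⟨huv.symm, Finset.mem_range.2 hv⟩), add_assoc]
  rw [key g, key g']
  refine add_le_add h2 (Finset.sum_le_sum fun z hz => ?_)
  simp only [Finset.mem_erase] at hz
  exact h z hz.2.1 hz.1

/-- Comparison of two interval sums whose terms differ at two positions only. -/
theorem sum_Ico_le_of_two_points {a b a' b' u v : ℕ} (f f' : ℕ → ℕ) (huv : u ≠ v)
    (h : ∀ z, z ≠ u → z ≠ v → ((a ≤ z ∧ z < b) → (a' ≤ z ∧ z < b')) ∧ f z ≤ f' z)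
    (h2 : (if a ≤ u ∧ u < b then f u else 0) + (if a ≤ v ∧ v < b then f v else 0)
      ≤ (if a' ≤ u ∧ u < b' then f' u else 0) + (if a' ≤ v ∧ v < b' then f' v else 0)) :
    ∑ z ∈ Finset.Ico a b, f z ≤ ∑ z ∈ Finset.Ico a' b', f' z := by
  rw [sum_Ico_eq_sum_range_ite f (M := b + b' + u + v + 1) (by omega),
    sum_Ico_eq_sum_range_ite f' (M := b + b' + u + v + 1) (by omega)]
  refine sum_range_le_of_two_points _ _ huv (by omega) (by omega) (fun z hzu hzv => ?_) h2
  obtain ⟨h1, h3⟩ := h z hzu hzv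
  by_cases hz : a ≤ z ∧ z < b
  · simp only [hz, h1 hz, and_self, if_true]; exact h3
  · simp [hz]

/-- The token after a transfer from `u` to `v`. -/
def tokenShift (u v : ℕ) (t : ℕ × Bool) : ℕ × Bool := if t = (u, false) then (v, false) else t

/-- The token after a leaf at `i` has been absorbed. -/
def tokenAbsorb (i : ℕ) (t : ℕ × Bool) : ℕ × Bool := if t = (i, true) then (i, false) else t

/-- A spine token at `u` follows the unit to `v`. Since the tent has slope at most one, `h v + 1 ≥ h
u + 1` exceeds the tent at `v` if `h u` exceeds it at `u`. -/
theorem tokenValid_shift {h L : ℕ → ℕ} {u v : ℕ} (huv : Consec u v) (hu : 0 < h u)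
    (hle : h u ≤ h v) {i j : ℕ} {t : ℕ × Bool} (ht : TokenValid i j t (h, L)) :
    TokenValid i j (tokenShift u v t)
      (Function.update (Function.update h u (h u - 1)) v (h v + 1), L) := by
  obtain ⟨y, β⟩ := t
  unfold Consec at huv
  cases β
  · by_cases hy : y = u
    · subst hy
      simp only [TokenValid, tokenShift, if_true, Function.update_self, Bool.false_eq_true,
        if_false, tent] at ht ⊢
      omega
    · simp only [TokenValid, tokenShift, Prod.mk.injEq, hy, false_and, if_false,
        Bool.false_eq_true] at ht ⊢
      by_cases hyv : y = v
      · subst hyv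
        simp only [Function.update_self]
        omega
      · rw [Function.update_of_ne hyv, Function.update_of_ne hy]
        exact ht
  · simpa [TokenValid, tokenShift] using ht

/-- If `v` is still below the tent, then `h u ≤ h v < tent v ≤ tent u + 1`, so `u` is at most at the
tent and loses what `v` gains. If a token moves from `u` to `v`, then `h v ≥ h u > tent u` shows
that `v` had no deficit, so nothing is lost when `v` leaves the interval. -/
theorem deficient_shift {h L : ℕ → ℕ} {u v : ℕ} (huv : Consec u v) (hu : 0 < h u)
    (hle : h u ≤ h v) {i j : ℕ} {t t' : ℕ × Bool} (ht : TokenValid i j t (h, L))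
    (ht' : TokenValid i j t' (h, L)) (hd : Deficient i j t t' (h, L)) :
    Deficient i j (tokenShift u v t) (tokenShift u v t')
      (Function.update (Function.update h u (h u - 1)) v (h v + 1), L) := by
  obtain ⟨hlt, hd⟩ := hd
  unfold Consec at huv
  have hne : u ≠ v := by omega
  have key : ∑ z ∈ Finset.Ico (tokenRight t) (tokenLeft t'), (tent i j z - h z) ≤
      ∑ z ∈ Finset.Ico (tokenRight (tokenShift u v t)) (tokenLeft (tokenShift u v t')),
        (tent i j z - Function.update (Function.update h u (h u - 1)) v (h v + 1) z) := by
    have hT : tent i j u ≤ tent i j v + 1 ∧ tent i j v ≤ tent i j u + 1 := by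
      unfold tent; omega
    refine sum_Ico_le_of_two_points _ _ hne (fun z hzu hzv => ⟨?_, ?_⟩) ?_
    · clear hd ht ht'
      obtain ⟨y, β⟩ := t
      obtain ⟨y', β'⟩ := t'
      by_cases h1 : y = u <;> by_cases h2 : y' = u <;> cases β <;> cases β' <;>
        simp [tokenRight, tokenLeft, tokenShift, h1, h2] <;> omega
    · rw [Function.update_of_ne hzv, Function.update_of_ne hzu]
    · rw [Function.update_self, Function.update_of_ne hne, Function.update_self]
      clear hd
      obtain ⟨y, β⟩ := t
      obtain ⟨y', β'⟩ := t'
      have h1 : β = true → y = v → tent i j v ≤ 1 := by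
        rintro rfl rfl; exact ht.1
      have h2 : β' = true → y' = v → tent i j v ≤ 1 := by
        rintro rfl rfl; exact ht'.1
      have h3 : β = false → y = u → tent i j u < h u := by
        rintro rfl rfl; exact ht.1
      have h4 : β' = false → y' = u → tent i j u < h u := by
        rintro rfl rfl; exact ht'.1
      clear ht ht'
      generalize tent i j u = Tu at *
      generalize tent i j v = Tv at *
      generalize h u = hu' at *
      generalize h v = hv' at *
      by_cases h5 : y = u <;> by_cases h6 : y' = u <;> cases β <;> cases β' <;>
        simp [tokenRight, tokenLeft, tokenShift, h5, h6] at h1 h2 h3 h4 hlt ⊢ <;>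
        split_ifs <;> omega
  refine ⟨?_, lt_of_lt_of_le hd key⟩
  -- A positive deficit needs a non-empty interval, and this keeps the two tokens apart and in
  -- order.
  have hpos : 0 < ∑ z ∈ Finset.Ico (tokenRight (tokenShift u v t)) (tokenLeft (tokenShift u v t')),
        (tent i j z - Function.update (Function.update h u (h u - 1)) v (h v + 1) z) :=
    lt_of_le_of_lt (Nat.zero_le _) (lt_of_lt_of_le hd key)
  have hne' : (tokenRight (tokenShift u v t)) < (tokenLeft (tokenShift u v t')) := by
    by_contra hcon
    rw [Finset.Ico_eq_empty hcon] at hpos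
    simp at hpos
  obtain ⟨y, β⟩ := t
  obtain ⟨y', β'⟩ := t'
  cases β <;> cases β' <;>
    simp only [tokenRight, tokenLeft, tokenShift, Prod.mk.injEq, and_true, and_false,
      if_false, if_true, Bool.true_eq_false] at hne' hlt ⊢ <;>
    first
      | exact hlt
      | (split_ifs at hne' ⊢ <;> simp_all <;> omega)

theorem tokenValid_absorb {h L : ℕ → ℕ} {k : ℕ} (hk : 0 < h k) (hL : 0 < L k)
    {i j : ℕ} {t : ℕ × Bool} (ht : TokenValid i j t (h, L)) :
    TokenValid i j (tokenAbsorb k t)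
      (Function.update h k (h k + 1), Function.update L k (L k - 1)) := by
  obtain ⟨y, β⟩ := t
  by_cases hy : y = k
  · subst hy
    cases β <;> simp [TokenValid, tokenAbsorb] at ht ⊢ <;> omega
  · cases β <;>
      simpa [TokenValid, tokenAbsorb, hy] using ht

/-- Inside the window, supply and deficit drop by one and by at most one. Outside the window, and at
a leaf token, the tent is at most `1 ≤ h k`, so position `k` contributes no deficit that could be
lost. -/
theorem deficient_absorb {h L : ℕ → ℕ} {k : ℕ} (hk : 0 < h k) (hL : 0 < L k)
    {i j : ℕ} {t t' : ℕ × Bool} (ht : TokenValid i j t (h, L))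
    (ht' : TokenValid i j t' (h, L)) (hd : Deficient i j t t' (h, L)) :
    Deficient i j (tokenAbsorb k t) (tokenAbsorb k t')
      (Function.update h k (h k + 1), Function.update L k (L k - 1)) := by
  obtain ⟨hlt, hd⟩ := hd
  have hle : ∑ z ∈ Finset.Icc i j, Function.update L k (L k - 1) z +
      (if i ≤ k ∧ k ≤ j then 1 else 0) = ∑ z ∈ Finset.Icc i j, L z := by
    by_cases hkm : k ∈ Finset.Icc i j
    · rw [Finset.sum_update_of_mem hkm, ← Finset.add_sum_erase _ L hkm]
      rw [Finset.mem_Icc] at hkm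
      rw [if_pos hkm, ← Finset.erase_eq]
      omega
    · have h1 : ∑ z ∈ Finset.Icc i j, Function.update L k (L k - 1) z
          = ∑ z ∈ Finset.Icc i j, L z := Finset.sum_congr rfl fun z hz => by
        rw [Function.update_of_ne]; rintro rfl; exact hkm hz
      rw [Finset.mem_Icc] at hkm
      rw [if_neg hkm, h1, add_zero]
  have key : ∑ z ∈ Finset.Ico (tokenRight t) (tokenLeft t'), (tent i j z - h z) ≤
      ∑ z ∈ Finset.Ico (tokenRight (tokenAbsorb k t)) (tokenLeft (tokenAbsorb k t')),
        ((tent i j z - Function.update h k (h k + 1) z) +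
          if z = k ∧ i ≤ k ∧ k ≤ j then 1 else 0) := by
    have hT : ¬ (i ≤ k ∧ k ≤ j) → tent i j k ≤ 1 := by
      unfold tent; omega
    -- Only position `k` changes; `k + 1` is a dummy second point.
    refine sum_Ico_le_of_two_points (u := k) (v := k + 1) _ _ (by omega)
      (fun z hzu hzv => ⟨?_, ?_⟩) ?_
    · clear hd ht ht'
      obtain ⟨y, β⟩ := t
      obtain ⟨y', β'⟩ := t'
      by_cases h1 : y = k <;> by_cases h2 : y' = k <;> cases β <;> cases β' <;>
        simp [tokenRight, tokenLeft, tokenAbsorb, h1, h2] <;> omega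
    · rw [Function.update_of_ne hzu]; omega
    · rw [Function.update_self, Function.update_of_ne (by omega)]
      clear hd hle
      obtain ⟨y, β⟩ := t
      obtain ⟨y', β'⟩ := t'
      have h1 : β = true → y = k → tent i j k ≤ 1 := by
        rintro rfl rfl; exact ht.1
      have h2 : β' = true → y' = k → tent i j k ≤ 1 := by
        rintro rfl rfl; exact ht'.1
      clear ht ht'
      generalize tent i j k = Tu at *
      generalize tent i j (k + 1) = Tv at *
      generalize h k = hu' at *
      generalize h (k + 1) = hv' at *
      by_cases h8 : i ≤ k ∧ k ≤ j <;>
      by_cases h5 : y = k <;> by_cases h6 : y' = k <;> cases β <;> cases β' <;>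
        simp [tokenRight, tokenLeft, tokenAbsorb, h5, h6, h8] at h1 h2 hT hlt ⊢ <;>
        first | omega | (split_ifs <;> omega)
  have key2 : ∑ z ∈ Finset.Ico (tokenRight (tokenAbsorb k t)) (tokenLeft (tokenAbsorb k t')),
        (if z = k ∧ i ≤ k ∧ k ≤ j then 1 else 0) ≤ if i ≤ k ∧ k ≤ j then 1 else 0 := by
    by_cases hkm : i ≤ k ∧ k ≤ j
    · simp only [hkm, and_self, and_true, if_true]
      rw [Finset.sum_ite_eq']
      split_ifs <;> omega
    · simp [hkm]
  rw [Finset.sum_add_distrib] at key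
  have hd' : ∑ z ∈ Finset.Icc i j, Function.update L k (L k - 1) z <
      ∑ z ∈ Finset.Ico (tokenRight (tokenAbsorb k t)) (tokenLeft (tokenAbsorb k t')),
        (tent i j z - Function.update h k (h k + 1) z) := by
    simp only at hd
    omega
  refine ⟨?_, hd'⟩
  have h1 : ∀ t : ℕ × Bool, (tokenAbsorb k t).1 = t.1 := by
    intro t
    unfold tokenAbsorb
    split_ifs with h
    · rw [h]
    · rfl
  rw [h1, h1]
  exact hlt

theorem deficient_kill {h L : ℕ → ℕ} {k : ℕ} {i j : ℕ} {t t' : ℕ × Bool}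
    (hd : Deficient i j t t' (h, L)) : Deficient i j t t' (Function.update h k 0, L) := by
  refine ⟨hd.1, lt_of_lt_of_le hd.2 (Finset.sum_le_sum fun z _ => ?_)⟩
  by_cases hz : z = k
  · subst hz; simp
  · simp [Function.update_of_ne hz]

/-- This is what the second clause for spine tokens is for: a spine token of weight one has no leaf
left, while a spine vertex can only be killed next to a leaf. -/
theorem tokenValid_kill {h L : ℕ → ℕ} {k : ℕ} (hk : h k = 1) (hL : 0 < L k)
    {i j : ℕ} {t : ℕ × Bool} (ht : TokenValid i j t (h, L)) :
    TokenValid i j t (Function.update h k 0, L) := by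
  obtain ⟨y, β⟩ := t
  cases β
  · simp only [TokenValid, Bool.false_eq_true, if_false] at ht ⊢
    by_cases hy : y = k
    · subst hy; omega
    · rw [Function.update_of_ne hy]; exact ht
  · exact ht

/-- After every step there are again tokens for all the windows at once. -/
theorem exists_token_map {s s' : (ℕ → ℕ) × (ℕ → ℕ)} (hs : SpineStep s s') :
    ∃ f : ℕ × Bool → ℕ × Bool, (∀ i j t, TokenValid i j t s → TokenValid i j (f t) s') ∧
      ∀ i j t t', TokenValid i j t s → TokenValid i j t' s → Deficient i j t t' s →
        Deficient i j (f t) (f t') s' := by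
  cases hs with
  | move hs =>
    cases hs with
    | absorb h L i hi hL =>
      exact ⟨tokenAbsorb i, fun _ _ _ => tokenValid_absorb hi hL,
        fun _ _ _ _ => deficient_absorb hi hL⟩
    | shift h L u v huv hu hle =>
      exact ⟨tokenShift u v, fun _ _ _ => tokenValid_shift huv hu hle,
        fun _ _ _ _ => deficient_shift huv hu hle⟩
  | kill h L i hi hL =>
    exact ⟨id, fun _ _ _ => tokenValid_kill hi hL, fun _ _ _ _ _ _ => deficient_kill⟩

/-- If `m` deficient windows separate `m + 1` tokens in a state, then at least `m + 1` vertices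
have positive weight in every state that can be reached from it. -/
theorem card_positive_of_tokens {s s' : (ℕ → ℕ) × (ℕ → ℕ)}
    (hs : Relation.ReflTransGen SpineStep s s') (m : ℕ) (i j : ℕ → ℕ) (t : ℕ → ℕ × Bool)
    (hl : ∀ k < m, TokenValid (i k) (j k) (t k) s)
    (hr : ∀ k < m, TokenValid (i k) (j k) (t (k + 1)) s)
    (hd : ∀ k < m, Deficient (i k) (j k) (t k) (t (k + 1)) s) :
    ∃ y : ℕ → ℕ, (∀ k < m, y k < y (k + 1)) ∧
      (0 < m → ∀ k ≤ m, 0 < s'.1 (y k) ∨ 0 < s'.2 (y k)) := by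
  induction hs using Relation.ReflTransGen.head_induction_on generalizing t with
  | refl =>
    refine ⟨fun k => (t k).1, fun k hk => (hd k hk).1, fun hm k hk => ?_⟩
    have hv : ∃ a b, TokenValid a b (t k) s' := by
      rcases Nat.lt_or_ge k m with h | h
      · exact ⟨_, _, hl k h⟩
      · obtain rfl : k = m := le_antisymm hk h
        obtain ⟨k, rfl⟩ : ∃ k', k = k' + 1 := ⟨k - 1, by omega⟩
        exact ⟨_, _, hr k (by omega)⟩
    obtain ⟨a, b, hv⟩ := hv
    unfold TokenValid at hv
    split_ifs at hv
    · exact Or.inr hv.2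
    · exact Or.inl (by dsimp only; omega)
  | head hstep _ ih =>
    obtain ⟨f, hf, hf'⟩ := exists_token_map hstep
    exact ih (fun k => f (t k)) (fun k hk => hf _ _ _ (hl k hk)) (fun k hk => hf _ _ _ (hr k hk))
      (fun k hk => hf' _ _ _ _ (hl k hk) (hr k hk) (hd k hk))

/-! ### The greedy partition of the spine -/

/-- `tentSum L = ⌊(L + 1)² / 4⌋` is the number of leaves that a window of length `L` needs. -/
def tentSum : ℕ → ℕ
  | 0 => 0
  | 1 => 1
  | L + 2 => tentSum L + L + 2

/-- `x`, or `x + 1` if there is no leaf at `x`. -/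
def skipBare (l : ℕ → ℕ) (x : ℕ) : ℕ := x + if l x = 0 then 1 else 0

/-- All windows `[a, b]` with `lo ≤ a` contain enough leaves. -/
def WindowsOK (l : ℕ → ℕ) (lo b : ℕ) : Prop :=
  ∀ a, lo ≤ a → a ≤ b → tentSum (b + 1 - a) ≤ ∑ z ∈ Finset.Icc a b, l z

/-- `Greedy l N s k`: the greedy partition of the spine positions `s, …, N - 1` has `k` parts. -/
inductive Greedy (l : ℕ → ℕ) (N : ℕ) : ℕ → ℕ → Prop
  | last (s : ℕ) (hs : s < N)
      (h : ∀ b, skipBare l s + 1 ≤ b → b + 1 < N → WindowsOK l (skipBare l s + 1) b) :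
      Greedy l N s 1
  | step (s b k : ℕ) (hb : skipBare l s + 1 ≤ b) (hbN : b + 1 < N)
      (hfirst : ∀ b', skipBare l s + 1 ≤ b' → b' < b → WindowsOK l (skipBare l s + 1) b')
      (hfail : ¬ WindowsOK l (skipBare l s + 1) b) (h : Greedy l N (skipBare l (b + 1)) k) :
      Greedy l N s (k + 1)

/-- The number of vertices of positive weight. -/
def survivors (N : ℕ) (s : (ℕ → ℕ) × (ℕ → ℕ)) : ℕ :=
  ∑ z ∈ Finset.range N, ((if 0 < s.1 z then 1 else 0) + s.2 z)

/-- Cutting off both ends of a tent and lowering the rest by one gives the tent that is two shorter,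
hence the recursion in steps of two. -/
theorem sum_tent_sub_one (L : ℕ) :
    ∑ z ∈ Finset.range L, (min (z + 2) (L + 1 - z) - 1) = tentSum L := by
  induction L using tentSum.induct with
  | case1 => rfl
  | case2 => rfl
  | case3 L ih =>
    rw [Finset.sum_range_succ, Finset.sum_range_succ', tentSum, ← ih]
    have : ∀ z ∈ Finset.range L, min (z + 1 + 2) (L + 2 + 1 - (z + 1)) - 1
        = (min (z + 2) (L + 1 - z) - 1) + 1 := by
      intro z hz
      rw [Finset.mem_range] at hz
      omega
    rw [Finset.sum_congr rfl this, Finset.sum_add_distrib]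
    simp

theorem sum_Icc_tent_sub_one (i j : ℕ) :
    ∑ z ∈ Finset.Icc i j, (tent i j z - 1) = tentSum (j + 1 - i) := by
  rw [← Finset.Ico_add_one_right_eq_Icc, Finset.sum_Ico_eq_sum_range, ← sum_tent_sub_one]
  refine Finset.sum_congr rfl fun z hz => ?_
  rw [Finset.mem_range] at hz
  unfold tent
  omega

/-- Each part but the last is closed by one short window. The lower bound uses only these windows
and the starts of the parts, not that the windows are the first to fail. -/
theorem Greedy.exists_windows {l : ℕ → ℕ} {N s k : ℕ} (h : Greedy l N s k) :
    ∃ (m : ℕ) (y i j : ℕ → ℕ), k = m + 1 ∧ y 0 = s ∧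
      ∀ r < m, skipBare l (y r) + 1 ≤ i r ∧ i r ≤ j r ∧ j r + 1 < N ∧
        y (r + 1) = skipBare l (j r + 1) ∧
        ∑ z ∈ Finset.Icc (i r) (j r), l z < tentSum (j r + 1 - i r) := by
  induction h with
  | last s hs h => exact ⟨0, fun _ => s, fun _ => 0, fun _ => 0, rfl, rfl, by simp⟩
  | step s b k hb hbN hfirst hfail h ih =>
    obtain ⟨m, y, i, j, rfl, hy, hw⟩ := ih
    unfold WindowsOK at hfail
    push Not at hfail
    obtain ⟨a, ha, hab, hlt⟩ := hfail
    refine ⟨m + 1, fun r => Nat.casesOn r s y, fun r => Nat.casesOn r a i,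
      fun r => Nat.casesOn r b j, rfl, rfl, fun r hr => ?_⟩
    cases r with
    | zero => exact ⟨ha, hab, hbN, hy, hlt⟩
    | succ r => exact hw r (by omega)

theorem SpineStep.eq_zero {s s' : (ℕ → ℕ) × (ℕ → ℕ)} (hs : SpineStep s s') (z : ℕ) :
    (s.1 z = 0 → s'.1 z = 0) ∧ (s.2 z = 0 → s'.2 z = 0) := by
  cases hs with
  | move hs =>
    cases hs with
    | absorb h L i hi hL =>
      by_cases hz : z = i
      · subst hz; simp; omega
      · simp [Function.update_of_ne hz]
    | shift h L u v huv hu hle =>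
      by_cases hz : z = v
      · subst hz; simp; omega
      · by_cases hz' : z = u
        · subst hz'; simp [Function.update_of_ne hz]; omega
        · simp [Function.update_of_ne hz, Function.update_of_ne hz']
  | kill h L i hi hL =>
    by_cases hz : z = i
    · subst hz; simp
    · simp [Function.update_of_ne hz]

theorem SpineStep.exists_pos {s s' : (ℕ → ℕ) × (ℕ → ℕ)} (hs : SpineStep s s') :
    ∃ z, 0 < s'.1 z ∨ 0 < s'.2 z := by
  cases hs with
  | move hs =>
    cases hs with
    | absorb h L i hi hL => exact ⟨i, by simp⟩
    | shift h L u v huv hu hle => exact ⟨v, by simp⟩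
  | kill h L i hi hL => exact ⟨i, Or.inr hL⟩

/-- No sequence of steps leaves fewer vertices than the greedy partition has parts. -/
theorem Greedy.le_survivors {l : ℕ → ℕ} {N k : ℕ} (hk : Greedy l N 0 k)
    (hl : ∀ z, N ≤ z → l z = 0) {s : (ℕ → ℕ) × (ℕ → ℕ)} (hN : 0 < N)
    (hlast : 0 < l (N - 1))
    (hs : Relation.ReflTransGen SpineStep (fun z => if z < N then 1 else 0, l) s) :
    k ≤ survivors N s := by
  obtain ⟨m, y, i, j, rfl, hy0, hw⟩ := hk.exists_windows
  have hzero : ∀ z, N ≤ z → s.1 z = 0 ∧ s.2 z = 0 := by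
    intro z hz
    induction hs with
    | refl => exact ⟨if_neg (by omega), hl z hz⟩
    | tail _ hstep ih => exact ⟨(hstep.eq_zero z).1 ih.1, (hstep.eq_zero z).2 ih.2⟩
  have hpos : ∃ z, 0 < s.1 z ∨ 0 < s.2 z := by
    cases hs with
    | refl => exact ⟨0, by simp [hN]⟩
    | tail _ hstep => exact hstep.exists_pos
  have hsurv : ∀ A : Finset ℕ, (∀ z ∈ A, 0 < s.1 z ∨ 0 < s.2 z) → A.card ≤ survivors N s := by
    intro A hA
    have hsub : A ⊆ Finset.range N := by
      intro z hz
      by_contra hcon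
      rw [Finset.mem_range, not_lt] at hcon
      have := hA z hz
      rw [(hzero z hcon).1, (hzero z hcon).2] at this
      omega
    calc A.card = ∑ z ∈ A, 1 := by simp
      _ ≤ ∑ z ∈ A, ((if 0 < s.1 z then 1 else 0) + s.2 z) := Finset.sum_le_sum fun z hz => by
          have := hA z hz
          split_ifs <;> omega
      _ ≤ _ := Finset.sum_le_sum_of_subset hsub
  rcases Nat.eq_zero_or_pos m with rfl | hm
  · obtain ⟨z, hz⟩ := hpos
    simpa using hsurv {z} (by simpa using hz)
  have hyN : ∀ r ≤ m, y r < N := by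
    intro r hr
    cases r with
    | zero => omega
    | succ r =>
      obtain ⟨-, -, h3, h4, -⟩ := hw r (by omega)
      rw [h4]
      unfold skipBare
      split_ifs with h0
      · by_contra hcon
        rw [show j r + 1 = N - 1 by omega] at h0
        omega
      · omega
  set h0 : ℕ → ℕ := fun z => if z < N then 1 else 0 with hh0
  have hone : ∀ r ≤ m, h0 (y r) = 1 := fun r hr => if_pos (hyN r hr)
  set t : ℕ → ℕ × Bool := fun r => (y r, decide (0 < l (y r))) with ht
  -- Here the form of `skipBare` matters. Next to a window the tent is one, which a leaf token
  -- tolerates but a spine vertex of weight one does not; one position further away the tent is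
  -- zero.
  have hvalid : ∀ a b r, r ≤ m → (skipBare l (y r) + 1 ≤ a ∨ (skipBare l (b + 1) = y r)) →
      TokenValid a b (t r) (h0, l) := by
    intro a b r hr hab
    have h1 := hone r hr
    simp only [TokenValid, ht, decide_eq_true_eq, tent]
    unfold skipBare at hab
    by_cases h2 : 0 < l (y r)
    · rw [if_pos h2]
      refine ⟨?_, h2⟩
      rw [if_neg (by omega : ¬ l (y r) = 0)] at hab
      split_ifs at hab <;> omega
    · rw [if_neg h2, h1]
      rw [if_pos (by omega : l (y r) = 0)] at hab
      refine ⟨?_, Or.inr (by omega)⟩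
      rcases hab with hab | hab
      · omega
      · split_ifs at hab with h3
        · omega
        · rw [← hab] at h2
          simp only [add_zero] at h2
          omega
  have hlow : ∀ r, tokenRight (t r) ≤ y r + 1 ∧ y r ≤ tokenLeft (t r) := by
    intro r
    simp only [ht, tokenRight, tokenLeft]
    split_ifs <;> omega
  have hleft : ∀ r < m, j r < tokenLeft (t (r + 1)) := by
    intro r hr
    obtain ⟨h1, h2, h3, h4, h5⟩ := hw r hr
    have := (hlow (r + 1)).2
    have h6 : j r + 1 ≤ y (r + 1) := by rw [h4]; exact Nat.le_add_right _ _
    omega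
  have hskip : ∀ x, x ≤ skipBare l x := fun x => Nat.le_add_right _ _
  obtain ⟨y', hy', hp⟩ := card_positive_of_tokens hs m i j t
    (fun r hr => hvalid _ _ _ hr.le (Or.inl (hw r hr).1))
    (fun r hr => hvalid _ _ _ hr (Or.inr (hw r hr).2.2.2.1.symm))
    (fun r hr => by
      obtain ⟨h1, h2, h3, h4, h5⟩ := hw r hr
      have h6 := hskip (y r)
      have h7 := hskip (j r + 1)
      refine ⟨by simp only [ht]; omega, ?_⟩
      rw [← sum_Icc_tent_sub_one] at h5
      refine lt_of_lt_of_le h5 ?_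
      calc ∑ z ∈ Finset.Icc (i r) (j r), (tent (i r) (j r) z - 1)
          ≤ ∑ z ∈ Finset.Icc (i r) (j r), (tent (i r) (j r) z - h0 z) :=
            Finset.sum_le_sum fun z _ => by
              have : h0 z ≤ 1 := by simp only [hh0]; split_ifs <;> omega
              omega
        _ ≤ _ := Finset.sum_le_sum_of_subset fun z hz => by
            have h8 := (hlow r).1
            have h9 := hleft r hr
            rw [Finset.mem_Icc] at hz
            rw [Finset.mem_Ico]
            omega)
  have hinj : ∀ r ≤ m, ∀ q < r, y' q < y' r := by
    intro r hr
    induction r with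
    | zero => intro q hq; omega
    | succ r ih =>
      intro q hq
      rcases Nat.lt_succ_iff_lt_or_eq.1 hq with h | rfl
      · exact (ih (by omega) q h).trans (hy' r (by omega))
      · exact hy' q (by omega)
  have hcard := hsurv ((Finset.range (m + 1)).image y') (by
    intro z hz
    obtain ⟨r, hr, rfl⟩ := Finset.mem_image.1 hz
    exact hp hm r (by rw [Finset.mem_range] at hr; omega))
  rw [Finset.card_image_of_injOn, Finset.card_range] at hcard
  · exact hcard
  · intro a ha b hb hab
    rw [Finset.coe_range, Set.mem_Iio] at ha hb
    rcases lt_trichotomy a b with h | h | h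
    · exact absurd hab (hinj b (by omega) a h).ne
    · exact h
    · exact absurd hab (hinj a (by omega) b h).ne'

end UnitAcquisition

namespace UnitAcquisition

/-! ### Upper bound: raising the spine to a prescribed height -/

/-- In the configuration `h`, a leaf unit at `s` can be carried to `y`: on the way from `s` to `y`
the weights increase strictly, except perhaps in the last step. -/
def Uphill (h : ℕ → ℕ) (s y : ℕ) : Prop :=
  (s = y ∧ 1 ≤ h y) ∨
  (s < y ∧ 2 ≤ h s ∧ (∀ z, s ≤ z → z + 1 < y → h z < h (z + 1)) ∧ h (y - 1) ≤ h y) ∨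
  (y < s ∧ 2 ≤ h s ∧ (∀ z, y + 1 ≤ z → z + 1 ≤ s → h (z + 1) < h z) ∧ h (y + 1) ≤ h y)

/-- `Raises h g u`: carrying leaf units uphill one after the other, `u z` of them from `z`,
turns the weights `h` of the spine vertices into `g`. -/
inductive Raises (h : ℕ → ℕ) : (ℕ → ℕ) → (ℕ → ℕ) → Prop
  | nil : Raises h h (fun _ => 0)
  | snoc {g u : ℕ → ℕ} {s y : ℕ} (hr : Raises h g u) (hs : Uphill g s y) :
      Raises h (Function.update g y (g y + 1)) (Function.update u s (u s + 1))

theorem Raises.trans {h g k u v : ℕ → ℕ} (h1 : Raises h g u) (h2 : Raises g k v) :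
    Raises h k (fun z => u z + v z) := by
  induction h2 with
  | nil => simpa using h1
  | @snoc g' v s y _ hs ih =>
    have := ih.snoc hs
    convert this using 1
    funext z
    by_cases hz : z = s
    · subst hz; simp; omega
    · simp [Function.update_of_ne hz]

theorem Raises.le {h g u : ℕ → ℕ} (h1 : Raises h g u) (z : ℕ) : h z ≤ g z := by
  induction h1 with
  | nil => exact le_rfl
  | @snoc g u s y _ _ ih =>
    by_cases hz : z = y
    · subst hz; simp; omega
    · rwa [Function.update_of_ne hz]

/-- Raising does not depend on the weights away from the paths that are used. -/
theorem Raises.add {h g u : ℕ → ℕ} (h1 : Raises h g u) (e : ℕ → ℕ)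
    (he : ∀ s y, 0 < u s → h y < g y → ∀ z, (s ≤ z ∧ z ≤ y ∨ y ≤ z ∧ z ≤ s) → e z = 0) :
    Raises (fun z => h z + e z) (fun z => g z + e z) u := by
  induction h1 with
  | nil => exact Raises.nil
  | @snoc g u s y hr hs ih =>
    have hle := hr.le
    have ih' := ih (fun s' y' hs' hy' => he s' y'
      (by
        by_cases hss : s' = s
        · subst hss; simp
        · rwa [Function.update_of_ne hss])
      (by
        by_cases hyy : y' = y
        · subst hyy; simp; omega
        · rwa [Function.update_of_ne hyy]))
    have hz : ∀ z, (s ≤ z ∧ z ≤ y ∨ y ≤ z ∧ z ≤ s) → e z = 0 :=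
      he s y (by simp) (by have := hle y; simp; omega)
    have hstep : Uphill (fun z => g z + e z) s y := by
      rcases hs with ⟨h1, h2⟩ | ⟨h1, h2, h3, h4⟩ | ⟨h1, h2, h3, h4⟩
      · exact Or.inl ⟨h1, by simp only; omega⟩
      · refine Or.inr (Or.inl ⟨h1, by simp only; omega, fun z hz1 hz2 => ?_, ?_⟩)
        · have := h3 z hz1 hz2
          simp only [hz z (by omega), hz (z + 1) (by omega), add_zero]
          exact this
        · simp only [hz (y - 1) (by omega), hz y (by omega), add_zero]
          exact h4
      · refine Or.inr (Or.inr ⟨h1, by simp only; omega, fun z hz1 hz2 => ?_, ?_⟩)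
        · have := h3 z hz1 hz2
          simp only [hz z (by omega), hz (z + 1) (by omega), add_zero]
          exact this
        · simp only [hz (y + 1) (by omega), hz y (by omega), add_zero]
          exact h4
    convert ih'.snoc hstep using 1
    funext z
    by_cases hzy : z = y
    · subst hzy; simp; omega
    · simp [Function.update_of_ne hzy]

/-- The part of the target `U` that can be reached inside the window `[a, b)`. -/
def cap (U : ℕ → ℕ) (a b z : ℕ) : ℕ := max 1 (min (U z) (min (z + 2 - a) (b + 1 - z)))

/-- The number of leaves needed to raise the window `[a, b)` to `cap U a b`. -/
def capSum (U : ℕ → ℕ) (a b : ℕ) : ℕ := ∑ z ∈ Finset.Ico a b, (cap U a b z - 1)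

theorem one_le_cap (U : ℕ → ℕ) (a b z : ℕ) : 1 ≤ cap U a b z := le_max_left _ _

theorem cap_outside {U : ℕ → ℕ} {a b z : ℕ} (hz : ¬ (a ≤ z ∧ z < b)) : cap U a b z = 1 := by
  unfold cap
  omega

theorem capSum_eq_sum {U : ℕ → ℕ} {p a b q : ℕ} (hp : p ≤ a) (hq : b ≤ q) :
    capSum U a b = ∑ z ∈ Finset.Ico p q, (cap U a b z - 1) := by
  refine Finset.sum_subset (Finset.Ico_subset_Ico hp hq) fun z _ hz => ?_
  rw [Finset.mem_Ico] at hz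
  simp [cap_outside hz]

/-- At a fixed position, `cap` is a clipped minimum of a term given by the left end and a term given
by the right end, and the minimum is supermodular. So the demand `capSum` is supermodular, which
allows crossing windows to be uncrossed. -/
theorem cap_add_cap_le (U : ℕ → ℕ) {a b c d : ℕ} (hac : a ≤ c) (hbd : b ≤ d) (z : ℕ) :
    cap U a b z + cap U c d z ≤ cap U a d z + cap U c b z := by
  unfold cap
  have h1 : z + 2 - c ≤ z + 2 - a := by omega
  have h2 : b + 1 - z ≤ d + 1 - z := by omega
  generalize z + 2 - c = x at *
  generalize z + 2 - a = x' at *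
  generalize b + 1 - z = w at *
  generalize d + 1 - z = w' at *
  generalize U z = u
  rcases le_total u x with h | h <;> rcases le_total u w with h' | h' <;> omega

theorem sum_Ico_union_inter (f : ℕ → ℕ) {a b c d : ℕ} (hac : a ≤ c) (hcb : c ≤ b) (hbd : b ≤ d) :
    ∑ z ∈ Finset.Ico a d, f z + ∑ z ∈ Finset.Ico c b, f z =
      ∑ z ∈ Finset.Ico a b, f z + ∑ z ∈ Finset.Ico c d, f z := by
  rw [← Finset.sum_Ico_consecutive f (hac.trans hcb) hbd, ← Finset.sum_Ico_consecutive f hcb hbd]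
  omega

/-- Every window inside `[p, q)` contains as many leaves as it needs. -/
def EnoughLeaves (U l : ℕ → ℕ) (p q : ℕ) : Prop :=
  ∀ x y, p ≤ x → x ≤ y → y ≤ q → capSum U x y ≤ ∑ z ∈ Finset.Ico x y, l z

/-- The window contains exactly as many leaves as it needs. -/
def Tight (U l : ℕ → ℕ) (a b : ℕ) : Prop := capSum U a b = ∑ z ∈ Finset.Ico a b, l z

/-- The union and the intersection of two overlapping tight windows are tight. -/
theorem Tight.union_inter {U l : ℕ → ℕ} {p q a b c d : ℕ} (hg : EnoughLeaves U l p q)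
    (hpa : p ≤ a) (hac : a ≤ c) (hcb : c ≤ b) (hbd : b ≤ d) (hdq : d ≤ q)
    (h1 : Tight U l a b) (h2 : Tight U l c d) :
    Tight U l a d ∧ Tight U l c b ∧
      ∀ z, cap U a b z + cap U c d z = cap U a d z + cap U c b z := by
  unfold Tight at *
  have h3 := hg a d hpa (by omega) hdq
  have h4 := hg c b (by omega) hcb (by omega)
  have h5 := sum_Ico_union_inter l hac hcb hbd
  have e1 := capSum_eq_sum (U := U) (p := a) (q := d) (le_refl a) hbd
  have e2 := capSum_eq_sum (U := U) (p := a) (q := d) hac (le_refl d)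
  have e3 := capSum_eq_sum (U := U) (p := a) (q := d) (le_refl a) (le_refl d)
  have e4 := capSum_eq_sum (U := U) (p := a) (q := d) hac hbd
  have hterm : ∀ z ∈ Finset.Ico a d, (cap U a b z - 1) + (cap U c d z - 1) ≤
      (cap U a d z - 1) + (cap U c b z - 1) := by
    intro z _
    have := cap_add_cap_le U hac hbd z
    have := one_le_cap U a b z
    have := one_le_cap U c d z
    have := one_le_cap U a d z
    have := one_le_cap U c b z
    omega
  have hsum := Finset.sum_le_sum hterm
  rw [Finset.sum_add_distrib, Finset.sum_add_distrib, ← e1, ← e2, ← e3, ← e4] at hsum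
  refine ⟨by omega, by omega, fun z => ?_⟩
  -- The totals agree, so the termwise inequality is an equality at each position.
  by_cases hz : z ∈ Finset.Ico a d
  · have heq : ∑ z ∈ Finset.Ico a d, ((cap U a b z - 1) + (cap U c d z - 1)) =
        ∑ z ∈ Finset.Ico a d, ((cap U a d z - 1) + (cap U c b z - 1)) := by
      rw [Finset.sum_add_distrib, Finset.sum_add_distrib, ← e1, ← e2, ← e3, ← e4]
      omega
    have := (Finset.sum_eq_sum_iff_of_le hterm).1 heq z hz
    have := one_le_cap U a b z
    have := one_le_cap U c d z
    have := one_le_cap U a d z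
    have := one_le_cap U c b z
    omega
  · rw [Finset.mem_Ico] at hz
    rw [cap_outside (a := a) (b := b) (by omega), cap_outside (a := c) (b := d) (by omega),
      cap_outside (a := a) (b := d) (by omega), cap_outside (a := c) (b := b) (by omega)]

/-- From every position one can walk uphill to a local maximum. -/
theorem exists_uphill (f : ℕ → ℕ) {s q : ℕ} (hs : 2 ≤ f s) (hq : ∀ z, q ≤ z → f z = 1) :
    ∃ y, Uphill (Function.update f y (f y - 1)) s y ∧ f (y + 1) ≤ f y ∧ f (y - 1) ≤ f y ∧
      f s + (y - s) + (s - y) ≤ f y := by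
  -- Climb to the right while the values increase; since `f` is one from `q` on, this stops. If it
  -- stops at once, climb to the left instead. As `y` itself is lowered by one, the last step of the
  -- path is only weakly increasing.
  have hright : ∃ y, s ≤ y ∧ (∀ z, s ≤ z → z < y → f z < f (z + 1)) ∧ f (y + 1) ≤ f y := by
    have hex : ∃ y, s ≤ y ∧ f (y + 1) ≤ f y := by
      by_contra hcon
      push Not at hcon
      have : ∀ k, f s + k ≤ f (s + k) := by
        intro k
        induction k with
        | zero => simp
        | succ k ih =>
          have := hcon (s + k) (by omega)
          rw [← add_assoc s k 1]
          omega
      have h1 := this q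
      rw [hq (s + q) (by omega)] at h1
      omega
    classical
    refine ⟨Nat.find hex, (Nat.find_spec hex).1, fun z hz1 hz2 => ?_, (Nat.find_spec hex).2⟩
    have := Nat.find_min hex hz2
    push Not at this
    exact this hz1
  obtain ⟨y, hsy, hinc, hmax⟩ := hright
  rcases hsy.eq_or_lt with rfl | hlt
  · have hleft : ∀ s, ∃ y, y ≤ s ∧ (∀ z, y ≤ z → z < s → f (z + 1) < f z) ∧ f (y - 1) ≤ f y := by
      intro s
      induction s with
      | zero => exact ⟨0, le_rfl, by omega, le_rfl⟩
      | succ s ih =>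
        by_cases h : f s ≤ f (s + 1)
        · exact ⟨s + 1, le_rfl, by omega, h⟩
        · obtain ⟨y, h1, h2, h3⟩ := ih
          refine ⟨y, by omega, fun z hz1 hz2 => ?_, h3⟩
          rcases Nat.lt_succ_iff_lt_or_eq.1 hz2 with h4 | rfl
          · exact h2 z hz1 h4
          · omega
    obtain ⟨y, hys, hdec, hmax'⟩ := hleft s
    rcases hys.eq_or_lt with rfl | hlt
    · exact ⟨y, Or.inl ⟨rfl, by simp; omega⟩, hmax, hmax', by omega⟩
    · have hslope : ∀ k, k ≤ s - y → f s + k ≤ f (s - k) := by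
        intro k
        induction k with
        | zero => simp
        | succ k ih =>
          intro hk
          have h1 := ih (by omega)
          have h2 := hdec (s - (k + 1)) (by omega) (by omega)
          rw [show s - (k + 1) + 1 = s - k by omega] at h2
          omega
      have h1 := hslope (s - y) le_rfl
      rw [show s - (s - y) = y by omega] at h1
      have h2 := hdec y le_rfl hlt
      refine ⟨y, Or.inr (Or.inr ⟨hlt, ?_, fun z hz1 hz2 => ?_, ?_⟩), h2.le, hmax', by omega⟩
      · rwa [Function.update_of_ne (by omega)]
      · rw [Function.update_of_ne (by omega), Function.update_of_ne (by omega)]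
        exact hdec z (by omega) (by omega)
      · rw [Function.update_of_ne (by omega), Function.update_self]
        omega
  · have hslope : ∀ k, k ≤ y - s → f s + k ≤ f (s + k) := by
      intro k
      induction k with
      | zero => simp
      | succ k ih =>
        intro hk
        have h1 := ih (by omega)
        have h2 := hinc (s + k) (by omega) (by omega)
        rw [← add_assoc s k 1]
        omega
    have h1 := hslope (y - s) le_rfl
    rw [show s + (y - s) = y by omega] at h1
    have h2 := hinc (y - 1) (by omega) (by omega)
    rw [show y - 1 + 1 = y by omega] at h2
    refine ⟨y, Or.inr (Or.inl ⟨hlt, ?_, fun z hz1 hz2 => ?_, ?_⟩), hmax, h2.le, by omega⟩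
    · rwa [Function.update_of_ne (by omega)]
    · rw [Function.update_of_ne (by omega), Function.update_of_ne (by omega)]
      exact hinc z (by omega) (by omega)
    · rw [Function.update_of_ne (by omega), Function.update_self]
      omega

/-- Neighbouring values of `U` differ by at most one. -/
def SlopeLeOne (U : ℕ → ℕ) : Prop := ∀ z, U z ≤ U (z + 1) + 1 ∧ U (z + 1) ≤ U z + 1

theorem SlopeLeOne.cap {U : ℕ → ℕ} (hU : SlopeLeOne U) (a b : ℕ) : SlopeLeOne (cap U a b) := by
  intro z
  have := hU z
  unfold UnitAcquisition.cap
  omega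

/-- The neighbours of a local maximum are level with it or one below, so lowering it by one is
harmless. -/
theorem SlopeLeOne.update {f : ℕ → ℕ} (hf : SlopeLeOne f) {y : ℕ} (h1 : f (y + 1) ≤ f y)
    (h2 : f (y - 1) ≤ f y) : SlopeLeOne (Function.update f y (f y - 1)) := by
  intro z
  have h3 := hf z
  by_cases hz : z = y
  · subst hz
    rw [Function.update_self, Function.update_of_ne (by omega)]
    omega
  · by_cases hz' : z + 1 = y
    · subst hz'
      rw [Function.update_self, Function.update_of_ne (by omega)]
      simp only [Nat.add_sub_cancel] at h2
      omega
    · rw [Function.update_of_ne hz, Function.update_of_ne hz']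
      exact h3

/-- No subwindow of `[p, q)` can reach more than `cap U p q`. So the target may be replaced by this
cap, and lowered at `y`, without changing what subwindows reach elsewhere. -/
theorem cap_update_of_ne {U : ℕ → ℕ} {p q y v x x' z : ℕ} (hx : p ≤ x) (hx' : x' ≤ q)
    (hz : z ≠ y) : cap (Function.update (cap U p q) y v) x x' z = cap U x x' z := by
  rw [cap, Function.update_of_ne hz]
  unfold cap
  omega

theorem cap_update_self {U : ℕ → ℕ} {p q y x x' : ℕ} (_ : p ≤ x) (_ : x' ≤ q)
    (hy : 2 ≤ cap U p q y) :
    cap (Function.update (cap U p q) y (cap U p q y - 1)) x x' y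
      = min (cap U x x' y) (cap U p q y - 1) := by
  rw [cap, Function.update_self]
  unfold cap at *
  omega

theorem capSum_update_le {U : ℕ → ℕ} {p q y x x' : ℕ} (hx : p ≤ x) (hx' : x' ≤ q)
    (hy : 2 ≤ cap U p q y) :
    capSum (Function.update (cap U p q) y (cap U p q y - 1)) x x' ≤ capSum U x x' := by
  refine Finset.sum_le_sum fun z _ => ?_
  by_cases hz : z = y
  · subst hz; rw [cap_update_self hx hx' hy]; omega
  · rw [cap_update_of_ne hx hx' hz]

theorem sum_Ico_update_pred (l : ℕ → ℕ) {s : ℕ} (hs : 1 ≤ l s) {x x' : ℕ} :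
    ∑ z ∈ Finset.Ico x x', Function.update l s (l s - 1) z + (if x ≤ s ∧ s < x' then 1 else 0) =
      ∑ z ∈ Finset.Ico x x', l z := by
  by_cases hm : s ∈ Finset.Ico x x'
  · rw [Finset.sum_update_of_mem hm, ← Finset.add_sum_erase _ l hm, ← Finset.erase_eq]
    rw [Finset.mem_Ico] at hm
    rw [if_pos hm]
    omega
  · have h1 : ∑ z ∈ Finset.Ico x x', Function.update l s (l s - 1) z = ∑ z ∈ Finset.Ico x x', l z :=
      Finset.sum_congr rfl fun z hz => by
        rw [Function.update_of_ne]; rintro rfl; exact hm hz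
    rw [Finset.mem_Ico] at hm
    rw [if_neg hm, h1, add_zero]

/-- In a tight window, a position with target at most one is a tight window by itself. -/
theorem tight_of_le_one {U l : ℕ → ℕ} {p q s : ℕ} (hU : SlopeLeOne U) (hg : EnoughLeaves U l p q)
    (ht : Tight U l p q) (hps : p ≤ s) (hsq : s < q) (hs : U s ≤ 1) :
    Tight U l s (s + 1) ∧ l s = 0 := by
  have h1 := hg p s le_rfl hps hsq.le
  have h2 := hg (s + 1) q (by omega) hsq le_rfl
  have hUl : ∀ k, U (s - k) ≤ k + 1 := by
    intro k
    induction k with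
    | zero => simpa using hs
    | succ k ih =>
      by_cases hk : k + 1 ≤ s
      · have := hU (s - (k + 1))
        rw [show s - (k + 1) + 1 = s - k by omega] at this
        omega
      · rw [show s - (k + 1) = s - k by omega]
        omega
  have hUr : ∀ k, U (s + k) ≤ k + 1 := by
    intro k
    induction k with
    | zero => simpa using hs
    | succ k ih =>
      have := hU (s + k)
      rw [← add_assoc s k 1]
      omega
  -- As `U s ≤ 1` and `U` has slope at most one, `U` already lies below the slope that the right end
  -- of `[p, s)` imposes. Hence the two sides of `s` account for the full demand of `[p, q)`, and no
  -- leaf remains for `s`.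
  have e1 : capSum U p s = ∑ z ∈ Finset.Ico p s, (cap U p q z - 1) := by
    refine Finset.sum_congr rfl fun z hz => ?_
    rw [Finset.mem_Ico] at hz
    have := hUl (s - z)
    rw [show s - (s - z) = z by omega] at this
    unfold cap
    omega
  have e2 : capSum U (s + 1) q = ∑ z ∈ Finset.Ico (s + 1) q, (cap U p q z - 1) := by
    refine Finset.sum_congr rfl fun z hz => ?_
    rw [Finset.mem_Ico] at hz
    have := hUr (z - s)
    rw [show s + (z - s) = z by omega] at this
    unfold cap
    omega
  have split : ∀ f : ℕ → ℕ, ∑ z ∈ Finset.Ico p q, f z =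
      ∑ z ∈ Finset.Ico p s, f z + f s + ∑ z ∈ Finset.Ico (s + 1) q, f z := by
    intro f
    rw [← Finset.sum_Ico_consecutive f hps hsq.le, Finset.sum_eq_sum_Ico_succ_bot hsq, add_assoc]
  have h3 : cap U p q s = 1 := by unfold cap; omega
  have h4 : cap U s (s + 1) s = 1 := by unfold cap; omega
  unfold Tight at *
  rw [capSum, split, ← e1, ← e2, split, h3] at ht
  have h5 : l s = 0 := by omega
  refine ⟨?_, h5⟩
  simp [capSum, h4, h5]

/-- From the height that a tight window can reach, one can go on to the height that a larger
tight window can reach, using just the additional leaves. -/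
theorem raises_cap (m : ℕ) : ∀ (U l : ℕ → ℕ) (p a b q : ℕ), p ≤ a → a ≤ b → b ≤ q →
    SlopeLeOne U → EnoughLeaves U l p q → Tight U l p q → Tight U l a b →
    ∑ z ∈ Finset.Ico p q, l z + 2 * (q - p) < m + (b - a) →
    Raises (cap U a b) (cap U p q) (fun z => if p ≤ z ∧ z < q ∧ ¬ (a ≤ z ∧ z < b) then l z else 0) := by
  -- The outer width counts twice and the inner width is subtracted once. So the measure drops if
  -- the outer window shrinks, if the inner one grows, or if both lose the same positions at one
  -- end, as happens for crossing windows below.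
  induction m with
  | zero => intro U l p a b q h1 h2 h3 _ _ _ _ h; omega
  | succ m ih =>
    intro U l p a b q hpa hab hbq hU hg hZ hC hm
    by_cases hall : p = a ∧ b = q
    · obtain ⟨rfl, rfl⟩ := hall
      convert Raises.nil using 1
      funext z
      rw [if_neg (by omega)]
    -- A tight window strictly between the two splits the task in two.
    have hcompose : ∀ c d, p ≤ c → c ≤ a → b ≤ d → d ≤ q → Tight U l c d → (c < a ∨ b < d) →
        (p < c ∨ d < q) → Raises (cap U a b) (cap U p q)
          (fun z => if p ≤ z ∧ z < q ∧ ¬ (a ≤ z ∧ z < b) then l z else 0) := by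
      intro c d hpc hca hbd hdq ht hne hne'
      have hsub : ∑ z ∈ Finset.Ico c d, l z ≤ ∑ z ∈ Finset.Ico p q, l z :=
        Finset.sum_le_sum_of_subset (Finset.Ico_subset_Ico hpc hdq)
      have r1 := ih U l c a b d hca hab hbd hU
        (fun x y hx hxy hy => hg x y (by omega) hxy (by omega)) ht hC (by omega)
      have r2 := ih U l p c d q hpc (by omega) hdq hU hg hZ ht (by omega)
      convert r1.trans r2 using 1
      funext z
      by_cases h1 : a ≤ z ∧ z < b <;> by_cases h2 : c ≤ z ∧ z < d <;>
        by_cases h3 : p ≤ z ∧ z < q <;> (try omega) <;> simp only [h1, h2, ← and_assoc, h3] <;> simp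
    -- First case: some `s` outside the inner window lies in no tight window other than the whole.
    -- One leaf at `s` is set aside and the target is lowered at a local maximum `y` uphill from
    -- `s`; after the recursive raising, that leaf is carried to `y`.
    by_cases hfree : ∃ s, p ≤ s ∧ s < q ∧ ¬ (a ≤ s ∧ s < b) ∧
        ∀ c d, p ≤ c → c ≤ s → s < d → d ≤ q → Tight U l c d → c = p ∧ d = q
    · obtain ⟨s, hps, hsq, hsC, hfree⟩ := hfree
      by_cases hUs : U s ≤ 1
      · obtain ⟨h1, h2⟩ := tight_of_le_one hU hg hZ hps hsq hUs
        obtain ⟨rfl, rfl⟩ := hfree s (s + 1) hps le_rfl (by omega) (by omega) h1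
        convert Raises.nil using 1
        · funext z
          unfold cap
          by_cases hz : z = s
          · subst hz; omega
          · omega
        · funext z
          by_cases hz : z = s
          · subst hz; simp [h2]
          · rw [if_neg (by omega)]
      have hcs : 2 ≤ cap U p q s := by unfold cap; omega
      have hls : 1 ≤ l s := by
        have h1 := hg s (s + 1) hps (by omega) hsq
        have h2 : cap U s (s + 1) s = 2 := by unfold cap; omega
        simpa [capSum, h2] using h1
      obtain ⟨y, hup, hy1, hy2, hslope⟩ := exists_uphill (cap U p q) (q := q) hcs
        (fun z hz => cap_outside (by omega))
      have hy : 2 ≤ cap U p q y := by omega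
      have hyZ : p ≤ y ∧ y < q := by
        by_contra hcon
        rw [cap_outside hcon] at hy
        omega
      -- The climb gains at least one unit per step from height two at `s`, and `s` is outside `[a,
      -- b)`, so `cap U a b` stays strictly lower at `y`.
      have hyC : cap U a b y ≤ cap U p q y - 1 := by
        have h1 : cap U a b y ≤ max 1 (min (y + 2 - a) (b + 1 - y)) := by unfold cap; omega
        omega
      set U' := Function.update (cap U p q) y (cap U p q y - 1) with hU'
      set l' := Function.update l s (l s - 1) with hl'
      have hsum : ∀ x x', ∑ z ∈ Finset.Ico x x', l' z + (if x ≤ s ∧ s < x' then 1 else 0) =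
          ∑ z ∈ Finset.Ico x x', l z := fun x x' => sum_Ico_update_pred l hls
      have hZ' : capSum U' p q + 1 = capSum U p q := by
        have hmem : y ∈ Finset.Ico p q := Finset.mem_Ico.2 hyZ
        rw [capSum, capSum, ← Finset.add_sum_erase _ _ hmem,
          ← Finset.add_sum_erase (a := y) _ (fun z => cap U p q z - 1) hmem,
          cap_update_self le_rfl le_rfl hy,
          Finset.sum_congr rfl fun z hz => by
            rw [cap_update_of_ne le_rfl le_rfl (Finset.ne_of_mem_erase hz)]]
        omega
      have hcapC : cap U' a b = cap U a b := by
        funext z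
        by_cases hz : z = y
        · subst hz; rw [cap_update_self hpa hbq hy]; omega
        · exact cap_update_of_ne hpa hbq hz
      have hcapZ : cap U' p q = Function.update (cap U p q) y (cap U p q y - 1) := by
        funext z
        by_cases hz : z = y
        · subst hz; rw [cap_update_self le_rfl le_rfl hy, Function.update_self]; omega
        · rw [cap_update_of_ne le_rfl le_rfl hz, Function.update_of_ne hz]
      -- A proper window containing `s` is not tight and can spare a leaf; the whole window loses
      -- one leaf, but its demand drops by one too.
      have hg' : EnoughLeaves U' l' p q := by
        intro x x' hx hxx hx'
        have h1 := hg x x' hx hxx hx'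
        have h2 : capSum U' x x' ≤ capSum U x x' := capSum_update_le hx hx' hy
        have h3 := hsum x x'
        by_cases hs' : x ≤ s ∧ s < x'
        · rw [if_pos hs'] at h3
          by_cases ht : Tight U l x x'
          · obtain ⟨rfl, rfl⟩ := hfree x x' hx hs'.1 hs'.2 hx' ht
            omega
          · unfold Tight at ht
            omega
        · rw [if_neg hs'] at h3
          omega
      have hZt : Tight U' l' p q := by
        have h3 := hsum p q
        rw [if_pos ⟨hps, hsq⟩] at h3
        unfold Tight at *
        omega
      have hCt : Tight U' l' a b := by
        have h3 := hsum a b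
        rw [if_neg hsC] at h3
        unfold Tight at *
        rw [capSum, hcapC, ← capSum]
        omega
      have hms := hsum p q
      rw [if_pos ⟨hps, hsq⟩] at hms
      have hrec := ih U' l' p a b q hpa hab hbq ((hU.cap p q).update hy1 hy2) hg' hZt hCt (by omega)
      rw [hcapC, hcapZ] at hrec
      convert hrec.snoc hup using 1
      · funext z
        by_cases hz : z = y
        · subst hz; simp only [Function.update_self]; omega
        · rw [Function.update_of_ne hz, Function.update_of_ne hz]
      · funext z
        by_cases hz : z = s
        · subst hz
          rw [Function.update_self, if_pos ⟨hps, hsq, hsC⟩, if_pos ⟨hps, hsq, hsC⟩, hl',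
            Function.update_self]
          omega
        · rw [Function.update_of_ne hz, hl', Function.update_of_ne hz]
    -- Second case: each position outside the inner window lies in a tight window smaller than the
    -- whole. Such a window is taken at a position next to the inner window, first on its right.
    · push Not at hfree
      rcases Nat.lt_or_ge b q with hbq' | hbq'
      · obtain ⟨c, d, hpc, hcs, hsd, hdq, ht, hne⟩ := hfree b (by omega) hbq' (by omega)
        rcases Nat.lt_or_ge a c with hac | hca
        · obtain ⟨hun, hint, heq⟩ := Tight.union_inter hg hpa hac.le hcs hsd.le hdq hC ht
          by_cases hun' : a = p ∧ d = q
          · obtain ⟨rfl, rfl⟩ := hun'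
            have hsub : ∑ z ∈ Finset.Ico c d, l z ≤ ∑ z ∈ Finset.Ico a d, l z :=
              Finset.sum_le_sum_of_subset (Finset.Ico_subset_Ico hac.le le_rfl)
            have hrec := ih U l c c b d le_rfl hcs hsd.le hU
              (fun x y hx hxy hy => hg x y (by omega) hxy (by omega)) ht hint (by omega)
            -- The windows cross and their union is everything. The raising from the intersection to
            -- `[c, d)` is performed on top of `cap U a b`. A raised position is limited by the
            -- right end `b`, and there and further right the left end does not matter; so the added
            -- heights vanish on the paths used. Equality in `Tight.union_inter` gives the right
            -- final heights.
            have hadd := hrec.add (fun z => cap U a b z - cap U c b z) (by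
              intro s y hs hy z hz
              have hs' : b ≤ s := by
                by_contra hcon
                rw [if_neg (by omega)] at hs
                omega
              unfold cap at hy ⊢
              omega)
            convert hadd using 1
            · funext z
              have : cap U c b z ≤ cap U a b z := by unfold cap; omega
              omega
            · funext z
              have := heq z
              have : cap U c b z ≤ cap U a b z := by unfold cap; omega
              omega
            · funext z
              by_cases h1 : b ≤ z ∧ z < d
              · rw [if_pos (by omega), if_pos (by omega)]
              · rw [if_neg (by omega), if_neg (by omega)]
          · exact hcompose a d hpa le_rfl hsd.le hdq hun (Or.inr hsd) (by omega)
        · exact hcompose c d hpc hca hsd.le hdq ht (Or.inr hsd)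
            (by by_contra hcon; exact hne (by omega) (by omega))
      -- The inner window reaches the right end, so the mirror image of the argument is applied at
      -- `a - 1`.
      · have hpa' : p < a := by omega
        obtain ⟨c, d, hpc, hcs, hsd, hdq, ht, hne⟩ := hfree (a - 1) (by omega) (by omega) (by omega)
        rcases Nat.lt_or_ge d b with hdb | hbd
        · obtain ⟨hun, hint, heq⟩ := Tight.union_inter hg hpc (by omega) (by omega) hdb.le hbq ht hC
          by_cases hun' : c = p ∧ b = q
          · obtain ⟨rfl, rfl⟩ := hun'
            have hsub : ∑ z ∈ Finset.Ico c d, l z ≤ ∑ z ∈ Finset.Ico c b, l z :=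
              Finset.sum_le_sum_of_subset (Finset.Ico_subset_Ico le_rfl hdb.le)
            have hrec := ih U l c a d d (by omega) (by omega) le_rfl hU
              (fun x y hx hxy hy => hg x y (by omega) hxy (by omega)) ht hint (by omega)
            have hadd := hrec.add (fun z => cap U a b z - cap U a d z) (by
              intro s y hs hy z hz
              have hs' : s < a := by
                by_contra hcon
                rw [if_neg (by omega)] at hs
                omega
              unfold cap at hy ⊢
              omega)
            convert hadd using 1
            · funext z
              have : cap U a d z ≤ cap U a b z := by unfold cap; omega
              omega
            · funext z
              have := heq z
              have : cap U a d z ≤ cap U a b z := by unfold cap; omega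
              omega
            · funext z
              by_cases h1 : c ≤ z ∧ z < a
              · rw [if_pos (by omega), if_pos (by omega)]
              · rw [if_neg (by omega), if_neg (by omega)]
          · exact hcompose c b hpc (by omega) le_rfl hbq hun (Or.inl (by omega)) (by omega)
        · exact hcompose c d hpc (by omega) hbd hdq ht (Or.inl (by omega))
            (by by_contra hcon; exact hne (by omega) (by omega))

/-- Superfluous leaves can be dropped so that the whole window becomes tight. -/
theorem exists_tight_le {U : ℕ → ℕ} {p q : ℕ} (hpq : p ≤ q) (m : ℕ) :
    ∀ l : ℕ → ℕ, ∑ z ∈ Finset.Ico p q, l z = m → EnoughLeaves U l p q →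
      ∃ l', (∀ z, l' z ≤ l z) ∧ EnoughLeaves U l' p q ∧ Tight U l' p q := by
  induction m with
  | zero =>
    intro l hl hg
    refine ⟨l, fun _ => le_rfl, hg, ?_⟩
    have := hg p q le_rfl hpq le_rfl
    unfold Tight
    omega
  | succ m ih =>
    intro l hl hg
    -- A position in no tight window has a leaf to spare. If all positions are covered by tight
    -- windows, uniting them from left to right shows that the whole is tight.
    by_cases hfree : ∃ s, p ≤ s ∧ s < q ∧ ∀ c d, p ≤ c → c ≤ s → s < d → d ≤ q → ¬ Tight U l c d
    · obtain ⟨s, hps, hsq, hs⟩ := hfree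
      have hls : 1 ≤ l s := by
        by_contra hcon
        refine hs s (s + 1) hps le_rfl (by omega) hsq ?_
        have := hg s (s + 1) hps (by omega) hsq
        have h0 : ∑ z ∈ Finset.Ico s (s + 1), l z = 0 := by simp; omega
        unfold Tight
        omega
      have hsum : ∀ x x', ∑ z ∈ Finset.Ico x x', Function.update l s (l s - 1) z +
          (if x ≤ s ∧ s < x' then 1 else 0) = ∑ z ∈ Finset.Ico x x', l z :=
        fun x x' => sum_Ico_update_pred l hls
      obtain ⟨l', h1, h2, h3⟩ := ih (Function.update l s (l s - 1))
        (by have := hsum p q; rw [if_pos ⟨hps, hsq⟩] at this; omega)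
        (by
          intro x x' hx hxx hx'
          have h1 := hg x x' hx hxx hx'
          have h2 := hsum x x'
          by_cases hm : x ≤ s ∧ s < x'
          · have := hs x x' hx hm.1 hm.2 hx'
            rw [if_pos hm] at h2
            unfold Tight at this
            omega
          · rw [if_neg hm] at h2
            omega)
      refine ⟨l', fun z => (h1 z).trans ?_, h2, h3⟩
      by_cases hz : z = s
      · subst hz; simp
      · rw [Function.update_of_ne hz]
    · push Not at hfree
      have hpre : ∀ k, p + k ≤ q → ∃ x, p + k ≤ x ∧ x ≤ q ∧ Tight U l p x := by
        intro k
        induction k with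
        | zero => exact fun _ => ⟨p, le_rfl, hpq, by simp [Tight, capSum]⟩
        | succ k ihk =>
          intro hk
          obtain ⟨x, h1, h2, h3⟩ := ihk (by omega)
          rcases h1.eq_or_lt with h4 | h4
          · obtain ⟨c, d, hc1, hc2, hd1, hd2, ht⟩ := hfree x (by omega) (by omega)
            exact ⟨d, by omega, hd2,
              (Tight.union_inter hg le_rfl hc1 hc2 hd1.le hd2 h3 ht).1⟩
          · exact ⟨x, by omega, h2, h3⟩
      obtain ⟨x, h1, h2, h3⟩ := hpre (q - p) (by omega)
      obtain rfl : x = q := by omega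
      exact ⟨l, fun _ => le_rfl, hg, h3⟩

end UnitAcquisition

namespace UnitAcquisition

/-! ### Upper bound: collapsing a part of the spine -/

open Relation (ReflTransGen)

/-- Carrying a unit along a path on which the weights increase strictly except in the last step. -/
theorem carry_of_weak_last (L : ℕ → ℕ) (d : ℕ) : ∀ (h : ℕ → ℕ) (c : ℕ → ℕ),
    (∀ k ≤ d, Consec (c k) (c (k + 1))) → (∀ i ≤ d + 1, ∀ j ≤ d + 1, c i = c j → i = j) →
    1 ≤ h (c 0) → (∀ k < d, h (c k) < h (c (k + 1))) → h (c d) ≤ h (c (d + 1)) →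
    ReflTransGen SpineMove (h, L)
      (Function.update (Function.update h (c 0) (h (c 0) - 1)) (c (d + 1)) (h (c (d + 1)) + 1), L) := by
  induction d with
  | zero =>
    intro h c hc _ h0 _ hl
    exact ReflTransGen.single (SpineMove.shift h L _ _ (hc 0 le_rfl) h0 hl)
  | succ d ih =>
    intro h c hc hinj h0 hinc hl
    have hpos : 1 ≤ h (c (d + 1)) := by
      have := hinc d (by omega)
      omega
    -- The last edge is used first. Its tail then weighs one less, which moves the weak inequality
    -- one edge back.
    refine ReflTransGen.head (SpineMove.shift h L _ _ (hc (d + 1) le_rfl) hpos hl) ?_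
    have hne : ∀ i j, i ≤ d + 2 → j ≤ d + 2 → i ≠ j → c i ≠ c j :=
      fun i j hi hj hij h => hij (hinj i hi j hj h)
    have e : ∀ k ≤ d, Function.update (Function.update h (c (d + 1)) (h (c (d + 1)) - 1)) (c (d + 1 + 1))
        (h (c (d + 1 + 1)) + 1) (c k) = h (c k) := by
      intro k hk
      rw [Function.update_of_ne (hne _ _ (by omega) (by omega) (by omega)),
        Function.update_of_ne (hne _ _ (by omega) (by omega) (by omega))]
    have e' : Function.update (Function.update h (c (d + 1)) (h (c (d + 1)) - 1)) (c (d + 1 + 1))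
        (h (c (d + 1 + 1)) + 1) (c (d + 1)) = h (c (d + 1)) - 1 := by
      rw [Function.update_of_ne (hne _ _ (by omega) (by omega) (by omega)), Function.update_self]
    have := ih (Function.update (Function.update h (c (d + 1)) (h (c (d + 1)) - 1)) (c (d + 1 + 1))
      (h (c (d + 1 + 1)) + 1)) c (fun k hk => hc k (by omega)) (fun i hi j hj => hinj i (by omega) j (by omega))
      (by rw [e 0 (by omega)]; exact h0)
      (fun k hk => by rw [e k (by omega), e (k + 1) (by omega)]; exact hinc k (by omega))
      (by rw [e d le_rfl, e']; have := hinc d (by omega); omega)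
    rw [e 0 (by omega), e'] at this
    convert this using 2
    funext z
    by_cases h1 : z = c (d + 1 + 1)
    · subst h1
      rw [Function.update_self, Function.update_of_ne (hne _ _ (by omega) (by omega) (by omega)),
        Function.update_of_ne (hne _ _ (by omega) (by omega) (by omega)), Function.update_self]
    · rw [Function.update_of_ne h1]
      by_cases h2 : z = c (d + 1)
      · subst h2
        rw [Function.update_self, Function.update_of_ne (hne _ _ (by omega) (by omega) (by omega))]
        omega
      · by_cases h3 : z = c 0
        · subst h3
          rw [Function.update_self, Function.update_of_ne h2, Function.update_self]
        · rw [Function.update_of_ne h3, Function.update_of_ne h2, Function.update_of_ne h3,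
            Function.update_of_ne h1, Function.update_of_ne h2]

/-- Carrying a unit along a path on which the weights increase strictly except in the first step. -/
theorem carry_of_weak_first (L : ℕ → ℕ) (d : ℕ) : ∀ (h : ℕ → ℕ) (c : ℕ → ℕ),
    (∀ k ≤ d, Consec (c k) (c (k + 1))) → (∀ i ≤ d + 1, ∀ j ≤ d + 1, c i = c j → i = j) →
    1 ≤ h (c 0) → h (c 0) ≤ h (c 1) → (∀ k, 1 ≤ k → k ≤ d → h (c k) < h (c (k + 1))) →
    ReflTransGen SpineMove (h, L)
      (Function.update (Function.update h (c 0) (h (c 0) - 1)) (c (d + 1)) (h (c (d + 1)) + 1), L) := by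
  induction d with
  | zero =>
    intro h c hc _ h0 hl _
    exact ReflTransGen.single (SpineMove.shift h L _ _ (hc 0 le_rfl) h0 hl)
  | succ d ih =>
    intro h c hc hinj h0 hl hinc
    -- The first edge is used first. Its head grows by one, which moves the weak inequality one edge
    -- ahead.
    refine ReflTransGen.head (SpineMove.shift h L _ _ (hc 0 (by omega)) h0 hl) ?_
    have hne : ∀ i j, i ≤ d + 2 → j ≤ d + 2 → i ≠ j → c i ≠ c j :=
      fun i j hi hj hij h => hij (hinj i hi j hj h)
    have e : ∀ k, 2 ≤ k → k ≤ d + 2 →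
        Function.update (Function.update h (c 0) (h (c 0) - 1)) (c (0 + 1)) (h (c (0 + 1)) + 1) (c k)
          = h (c k) := by
      intro k hk hk'
      rw [Function.update_of_ne (hne _ _ (by omega) (by omega) (by omega)),
        Function.update_of_ne (hne _ _ (by omega) (by omega) (by omega))]
    have := ih (Function.update (Function.update h (c 0) (h (c 0) - 1)) (c (0 + 1)) (h (c (0 + 1)) + 1))
      (fun k => c (k + 1)) (fun k hk => hc (k + 1) (by omega))
      (fun i hi j hj hij => by have := hinj (i + 1) (by omega) (j + 1) (by omega) hij; omega)
      (by simp)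
      (by
        have h1 := hinc 1 le_rfl (by omega)
        simp only [Nat.reduceAdd, zero_add] at h1 ⊢
        rw [Function.update_self]
        have h2 := e 2 le_rfl (by omega)
        simp only [zero_add] at h2
        rw [h2]
        exact h1)
      (fun k hk hk' => by
        rw [e (k + 1) (by omega) (by omega), e (k + 1 + 1) (by omega) (by omega)]
        exact hinc (k + 1) (by omega) (by omega))
    simp only [e (d + 1 + 1) (by omega) le_rfl] at this
    convert this using 2
    funext z
    by_cases h1 : z = c (d + 1 + 1)
    · subst h1
      rw [Function.update_self, Function.update_self]
    · rw [Function.update_of_ne h1, Function.update_of_ne h1]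
      by_cases h2 : z = c (0 + 1)
      · subst h2
        rw [Function.update_self, Function.update_self,
          Function.update_of_ne (hne _ _ (by omega) (by omega) (by omega))]
        omega
      · rw [Function.update_of_ne h2, Function.update_of_ne h2]

theorem consec_add (s k : ℕ) : Consec (s + k) (s + (k + 1)) := Or.inl rfl

theorem consec_sub {s k : ℕ} (h : k + 1 ≤ s) : Consec (s - k) (s - (k + 1)) :=
  Or.inr (by omega)

/-- An uphill path allows a leaf unit to be carried along it. -/
theorem Uphill.reach {h L : ℕ → ℕ} {s y : ℕ} (hu : Uphill h s y) (hL : 0 < L s) :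
    ReflTransGen SpineMove (h, L)
      (Function.update h y (h y + 1), Function.update L s (L s - 1)) := by
  -- The vertex at `s` sends one of its own units to `y` and then replaces it by the leaf unit;
  -- weight two ensures that it is still alive to do so.
  have finish : ∀ (hne : s ≠ y) (hs : 2 ≤ h s), ReflTransGen SpineMove (h, L)
      (Function.update (Function.update h s (h s - 1)) y (h y + 1), L) →
      ReflTransGen SpineMove (h, L)
        (Function.update h y (h y + 1), Function.update L s (L s - 1)) := by
    intro hne hs hr
    have e : Function.update (Function.update h s (h s - 1)) y (h y + 1) s = h s - 1 := by
      rw [Function.update_of_ne hne, Function.update_self]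
    refine hr.tail ?_
    convert SpineMove.absorb (Function.update (Function.update h s (h s - 1)) y (h y + 1)) L s
      (by rw [e]; omega) hL using 2
    funext z
    rw [e]
    by_cases h1 : z = s
    · subst h1
      rw [Function.update_self, Function.update_of_ne hne]
      omega
    · rw [Function.update_of_ne h1]
      by_cases h2 : z = y
      · subst h2; rw [Function.update_self, Function.update_self]
      · rw [Function.update_of_ne h2, Function.update_of_ne h2, Function.update_of_ne h1]
  rcases hu with ⟨rfl, h1⟩ | ⟨h1, h2, h3, h4⟩ | ⟨h1, h2, h3, h4⟩
  · exact ReflTransGen.single (SpineMove.absorb h L s h1 hL)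
  · refine finish (by omega) h2 ?_
    have := carry_of_weak_last L (y - s - 1) h (fun k => s + k) (fun k _ => consec_add s k)
      (fun i _ j _ hij => by simpa using hij) (by simp; omega)
      (fun k hk => h3 (s + k) (by omega) (by omega))
      (by
        rw [show s + (y - s - 1) = y - 1 by omega, show s + (y - s - 1 + 1) = y by omega]
        exact h4)
    simpa only [add_zero, show s + (y - s - 1 + 1) = y by omega] using this
  · refine finish (by omega) h2 ?_
    have := carry_of_weak_last L (s - y - 1) h (fun k => s - k) (fun k _ => consec_sub (by omega))
      (fun i _ j _ hij => by have h5 : s - i = s - j := hij; omega) (by simp; omega)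
      (fun k hk => by
        have := h3 (s - (k + 1)) (by omega) (by omega)
        rwa [show s - (k + 1) + 1 = s - k by omega] at this)
      (by
        rw [show s - (s - y - 1) = y + 1 by omega, show s - (s - y - 1 + 1) = y by omega]
        exact h4)
    simpa only [tsub_zero, show s - (s - y - 1 + 1) = y by omega] using this

/-- The abstract raising becomes a sequence of moves. All its paths start and end inside `[p, q)`,
so the weights outside are arbitrary and stay as they are. -/
theorem Raises.reach {h g u : ℕ → ℕ} (hr : Raises h g u) (p q : ℕ) (H L : ℕ → ℕ)
    (hH : ∀ z, p ≤ z → z < q → H z = h z) (hu : ∀ s, 0 < u s → p ≤ s ∧ s < q)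
    (hg : ∀ y, h y < g y → p ≤ y ∧ y < q) (hL : ∀ z, u z ≤ L z) :
    ReflTransGen SpineMove (H, L)
      (fun z => if p ≤ z ∧ z < q then g z else H z, fun z => L z - u z) := by
  induction hr with
  | nil =>
    convert ReflTransGen.refl using 2
    · funext z
      split_ifs with hz
      · exact (hH z hz.1 hz.2).symm
      · rfl
    · rfl
  | @snoc g u s y hr hs ih =>
    have hsw := hu s (by simp)
    have hyw := hg y (by have := hr.le y; simp; omega)
    have ih' := ih
      (fun s' hs' => hu s' (by
        by_cases hss : s' = s
        · subst hss; simp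
        · rwa [Function.update_of_ne hss]))
      (fun y' hy' => hg y' (by
        by_cases hyy : y' = y
        · subst hyy; simp; omega
        · rwa [Function.update_of_ne hyy]))
      (fun z => by
        have := hL z
        by_cases hz : z = s
        · subst hz; simp at this; omega
        · rwa [Function.update_of_ne hz] at this)
    have hLs := hL s
    rw [Function.update_self] at hLs
    have hup : Uphill (fun z => if p ≤ z ∧ z < q then g z else H z) s y := by
      rcases hs with ⟨h1, h2⟩ | ⟨h1, h2, h3, h4⟩ | ⟨h1, h2, h3, h4⟩
      · exact Or.inl ⟨h1, by simpa [hyw] using h2⟩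
      · refine Or.inr (Or.inl ⟨h1, by simpa [hsw] using h2, fun z hz1 hz2 => ?_, ?_⟩)
        · simp only
          rw [if_pos (by omega), if_pos (by omega)]
          exact h3 z hz1 hz2
        · simp only
          rw [if_pos (by omega), if_pos (by omega)]
          exact h4
      · refine Or.inr (Or.inr ⟨h1, by simpa [hsw] using h2, fun z hz1 hz2 => ?_, ?_⟩)
        · simp only
          rw [if_pos (by omega), if_pos (by omega)]
          exact h3 z hz1 hz2
        · simp only
          rw [if_pos (by omega), if_pos (by omega)]
          exact h4
    convert ih'.trans (hup.reach (L := fun z => L z - u z) (by show 0 < L s - u s; omega)) using 2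
    · funext z
      by_cases hz : z = y
      · subst hz; simp [hyw]
      · simp [Function.update_of_ne hz]
    · funext z
      by_cases hz : z = s
      · subst hz; simp; omega
      · simp [Function.update_of_ne hz]

/-- The end vertex of a path with increasing weights can pass on all its weight and all its
leaves to the other end. -/
theorem exists_drain (m : ℕ) : ∀ (d : ℕ) (H L : ℕ → ℕ) (c : ℕ → ℕ), H (c 0) + 2 * L (c 0) ≤ m →
    (∀ k ≤ d, Consec (c k) (c (k + 1))) → (∀ i ≤ d + 1, ∀ j ≤ d + 1, c i = c j → i = j) →
    1 ≤ H (c 0) → H (c 0) ≤ H (c 1) → (L (c 0) = 0 ∨ H (c 0) < H (c 1)) →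
    (∀ k, 1 ≤ k → k ≤ d → H (c k) < H (c (k + 1))) →
    ∃ H', ReflTransGen SpineMove (H, L) (H', Function.update L (c 0) 0) ∧ H' (c 0) = 0 ∧
      H (c (d + 1)) < H' (c (d + 1)) ∧ ∀ z, z ≠ c 0 → z ≠ c (d + 1) → H' z = H z := by
  -- Leaves are used up first: absorbing one and carrying one unit away restores the weight of `c
  -- 0`. Strictness at the first edge allows for the temporary extra unit. In the measure an
  -- absorption trades two for one, and a carry costs one.
  induction m with
  | zero => intro d H L c h1 _ _ h2; omega
  | succ m ih =>
    intro d H L c hm hc hinj h0 h1 hs hinc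
    have hne : ∀ i j, i ≤ d + 1 → j ≤ d + 1 → i ≠ j → c i ≠ c j :=
      fun i j hi hj hij h => hij (hinj i hi j hj h)
    have hn0 : c 0 ≠ c (d + 1) := hne _ _ (by omega) le_rfl (by omega)
    by_cases hL : L (c 0) = 0
    · have hcar := carry_of_weak_first L d H c hc hinj h0 h1 hinc
      set H1 := Function.update (Function.update H (c 0) (H (c 0) - 1)) (c (d + 1)) (H (c (d + 1)) + 1)
        with hH1
      have e0 : H1 (c 0) = H (c 0) - 1 := by
        rw [hH1, Function.update_of_ne hn0, Function.update_self]
      have ed : H1 (c (d + 1)) = H (c (d + 1)) + 1 := by rw [hH1, Function.update_self]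
      have ez : ∀ z, z ≠ c 0 → z ≠ c (d + 1) → H1 z = H z := fun z h2 h3 => by
        rw [hH1, Function.update_of_ne h3, Function.update_of_ne h2]
      have hge : ∀ z, z ≠ c 0 → H z ≤ H1 z := by
        intro z hz
        by_cases h2 : z = c (d + 1)
        · subst h2; omega
        · rw [ez z hz h2]
      have hLu : Function.update L (c 0) 0 = L := by
        funext z
        by_cases hz : z = c 0
        · subst hz; simp [hL]
        · rw [Function.update_of_ne hz]
      by_cases hone : H (c 0) = 1
      · exact ⟨H1, by rw [hLu]; exact hcar, by omega, by omega, ez⟩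
      · have hg1 := hge (c 1) (hne _ _ (by omega) (by omega) (by omega))
        obtain ⟨H', r1, r2, r3, r4⟩ := ih d H1 L c (by omega) hc hinj (by omega)
          (by omega) (Or.inl hL) (fun k hk hkd => by
            have h3 := hinc k hk hkd
            have h4 := hge (c (k + 1)) (hne _ _ (by omega) (by omega) (by omega))
            rw [ez (c k) (hne _ _ (by omega) (by omega) (by omega))
              (hne _ _ (by omega) (by omega) (by omega))]
            omega)
        exact ⟨H', hcar.trans r1, r2, by omega, fun z h2 h3 => by rw [r4 z h2 h3, ez z h2 h3]⟩
    · have hlt : H (c 0) < H (c 1) := by omega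
      have habs := SpineMove.absorb H L (c 0) h0 (by omega)
      set H0 := Function.update H (c 0) (H (c 0) + 1) with hH0
      set L0 := Function.update L (c 0) (L (c 0) - 1) with hL0
      have f0 : H0 (c 0) = H (c 0) + 1 := by rw [hH0, Function.update_self]
      have fz : ∀ z, z ≠ c 0 → H0 z = H z := fun z hz => by rw [hH0, Function.update_of_ne hz]
      have fk : ∀ k, 1 ≤ k → k ≤ d + 1 → H0 (c k) = H (c k) :=
        fun k hk hk' => fz _ (hne _ _ hk' (by omega) (by omega))
      have hcar := carry_of_weak_first L0 d H0 c hc hinj (by omega)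
        (by rw [f0, fk 1 le_rfl (by omega)]; omega)
        (fun k hk hkd => by rw [fk k hk (by omega), fk (k + 1) (by omega) (by omega)]; exact hinc k hk hkd)
      rw [fk (d + 1) (by omega) le_rfl, f0] at hcar
      set H1 := Function.update (Function.update H0 (c 0) (H (c 0) + 1 - 1)) (c (d + 1))
        (H (c (d + 1)) + 1) with hH1
      have e0 : H1 (c 0) = H (c 0) := by
        rw [hH1, Function.update_of_ne hn0, Function.update_self]
        omega
      have ed : H1 (c (d + 1)) = H (c (d + 1)) + 1 := by rw [hH1, Function.update_self]
      have ez : ∀ z, z ≠ c 0 → z ≠ c (d + 1) → H1 z = H z := fun z h2 h3 => by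
        rw [hH1, Function.update_of_ne h3, Function.update_of_ne h2, fz z h2]
      have hge : ∀ z, z ≠ c 0 → H z ≤ H1 z := by
        intro z hz
        by_cases h2 : z = c (d + 1)
        · subst h2; omega
        · rw [ez z hz h2]
      have hg1 := hge (c 1) (hne _ _ (by omega) (by omega) (by omega))
      have g0 : L0 (c 0) = L (c 0) - 1 := by rw [hL0, Function.update_self]
      obtain ⟨H', r1, r2, r3, r4⟩ := ih d H1 L0 c (by omega) hc hinj (by omega)
        (by omega) (Or.inr (by omega)) (fun k hk hkd => by
          have h3 := hinc k hk hkd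
          have h4 := hge (c (k + 1)) (hne _ _ (by omega) (by omega) (by omega))
          rw [ez (c k) (hne _ _ (by omega) (by omega) (by omega))
            (hne _ _ (by omega) (by omega) (by omega))]
          omega)
      refine ⟨H', ?_, r2, by omega, fun z h2 h3 => by rw [r4 z h2 h3, ez z h2 h3]⟩
      rw [hL0, Function.update_idem] at r1
      exact (ReflTransGen.head habs hcar).trans r1

/-- All vertices of a path with increasing weights can be collapsed into its last vertex. -/
theorem exists_collapse (d : ℕ) : ∀ (H L : ℕ → ℕ) (c : ℕ → ℕ),
    (∀ k < d, Consec (c k) (c (k + 1))) → (∀ i ≤ d, ∀ j ≤ d, c i = c j → i = j) →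
    1 ≤ H (c 0) → (0 < d → H (c 0) ≤ H (c 1) ∧ (L (c 0) = 0 ∨ H (c 0) < H (c 1))) →
    (∀ k, 1 ≤ k → k < d → H (c k) < H (c (k + 1))) →
    ∃ H' L', ReflTransGen SpineMove (H, L) (H', L') ∧ (∀ k < d, H' (c k) = 0 ∧ L' (c k) = 0) ∧
      (0 < d → H (c d) < H' (c d)) ∧ H (c d) ≤ H' (c d) ∧ L' (c d) = L (c d) ∧
      ∀ z, (∀ k ≤ d, z ≠ c k) → H' z = H z ∧ L' z = L z := by
  induction d with
  | zero =>
    intro H L c _ _ _ _ _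
    exact ⟨H, L, ReflTransGen.refl, by simp, by simp, le_rfl, rfl, fun _ _ => ⟨rfl, rfl⟩⟩
  | succ d ih =>
    intro H L c hc hinj h0 h1 hinc
    have hne : ∀ i j, i ≤ d + 1 → j ≤ d + 1 → i ≠ j → c i ≠ c j :=
      fun i j hi hj hij h => hij (hinj i hi j hj h)
    -- Everything goes straight to the far end, so the weights in between do not change and the
    -- remaining path is again increasing.
    obtain ⟨H1, r1, r2, r3, r4⟩ := exists_drain (H (c 0) + 2 * L (c 0)) d H L c le_rfl
      (fun k hk => hc k (by omega)) hinj h0 (h1 (by omega)).1 (h1 (by omega)).2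
      (fun k hk hk' => hinc k hk (by omega))
    have hge : ∀ z, z ≠ c 0 → H z ≤ H1 z := by
      intro z hz
      by_cases h2 : z = c (d + 1)
      · subst h2; omega
      · rw [r4 z hz h2]
    have hstrict : ∀ k, 1 ≤ k → k < d + 1 → H1 (c k) < H1 (c (k + 1)) := by
      intro k hk hkd
      have h3 := hinc k hk hkd
      have h4 := hge (c (k + 1)) (hne _ _ (by omega) (by omega) (by omega))
      rw [r4 (c k) (hne _ _ (by omega) (by omega) (by omega))
        (hne _ _ (by omega) (by omega) (by omega))]
      omega
    have hc1 := hge (c 1) (hne _ _ (by omega) (by omega) (by omega))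
    have hc1' := (h1 (by omega)).1
    obtain ⟨H', L', q1, q2, -, q4, q5, q6⟩ := ih H1 (Function.update L (c 0) 0) (fun k => c (k + 1))
      (fun k hk => hc (k + 1) (by omega))
      (fun i hi j hj hij => by have := hinj (i + 1) (by omega) (j + 1) (by omega) hij; omega)
      (by simp only [zero_add]; omega)
      (fun hd => by
        have := hstrict 1 le_rfl (by omega)
        exact ⟨this.le, Or.inr this⟩)
      (fun k hk hkd => hstrict (k + 1) (by omega) (by omega))
    have h0z := q6 (c 0) (fun k hk => hne _ _ (by omega) (by omega) (by omega))
    refine ⟨H', L', r1.trans q1, fun k hk => ?_, fun _ => by omega, by omega, ?_, fun z hz => ?_⟩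
    · cases k with
      | zero => exact ⟨by rw [h0z.1, r2], by rw [h0z.2, Function.update_self]⟩
      | succ k => exact q2 k (by omega)
    · rw [q5, Function.update_of_ne (hne _ _ (by omega) (by omega) (by omega))]
    · have h3 := q6 z (fun k hk => hz (k + 1) (by omega))
      rw [h3.1, h3.2, Function.update_of_ne (hz 0 (by omega)),
        r4 z (hz 0 (by omega)) (hz (d + 1) le_rfl)]
      exact ⟨rfl, rfl⟩

theorem exists_absorb_all (m : ℕ) : ∀ (H L : ℕ → ℕ) (r : ℕ), L r = m → 1 ≤ H r →
    ReflTransGen SpineMove (H, L) (Function.update H r (H r + m), Function.update L r 0) := by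
  induction m with
  | zero =>
    intro H L r hL _
    rw [add_zero, Function.update_eq_self, ← hL, Function.update_eq_self]
  | succ m ih =>
    intro H L r hL hr
    refine ReflTransGen.head (SpineMove.absorb H L r hr (by omega)) ?_
    have := ih (Function.update H r (H r + 1)) (Function.update L r (L r - 1)) r (by simp [hL])
      (by simp)
    simpa [Function.update_idem, add_assoc, add_comm 1 m] using this

end UnitAcquisition

/-! ### Upper bound: collapsing all parts of the greedy partition. -/

namespace UnitAcquisition

open Relation (ReflTransGen)

/-- The target `q + 3` is above every tent inside the window and so never binds. -/
theorem capSum_const {q x y : ℕ} (hyq : y ≤ q) : capSum (fun _ => q + 3) x y = tentSum (y - x) := by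
  rw [capSum, Finset.sum_Ico_eq_sum_range, ← sum_tent_sub_one]
  refine Finset.sum_congr rfl fun z hz => ?_
  rw [Finset.mem_range] at hz
  simp only [cap]
  omega

/-- If all windows inside `[p, q)` have enough leaves, the spine can be raised there to a tent. -/
theorem exists_raise (l H : ℕ → ℕ) (p q : ℕ) (hH : ∀ z, p ≤ z → z < q → H z = 1)
    (hw : ∀ b, p ≤ b → b < q → WindowsOK l p b) :
    ∃ L', (∀ z, L' z ≤ l z) ∧ (∀ z, ¬ (p ≤ z ∧ z < q) → L' z = l z) ∧ ReflTransGen SpineMove (H, l)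
      (fun z => if p ≤ z ∧ z < q then max 1 (min (z + 2 - p) (q + 1 - z)) else H z, L') := by
  by_cases hpq : p ≤ q
  · have hE : EnoughLeaves (fun _ => q + 3) l p q := by
      intro x y hx hxy hy
      rw [capSum_const hy]
      rcases hxy.eq_or_lt with rfl | hlt
      · simp [tentSum]
      · have := hw (y - 1) (by omega) (by omega) x hx (by omega)
        rw [← Finset.Ico_add_one_right_eq_Icc] at this
        rwa [show y - 1 + 1 = y by omega] at this
    obtain ⟨l', h1, h2, h3⟩ := exists_tight_le hpq _ l rfl hE
    -- The raising starts from the empty window `[p, p)`, which is tight and whose cap is constantly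
    -- one.
    have hr := raises_cap (∑ z ∈ Finset.Ico p q, l' z + 2 * (q - p) + 1) (fun _ => q + 3) l' p p p q
      le_rfl le_rfl hpq (fun z => ⟨Nat.le_succ _, Nat.le_succ _⟩) h2 h3 (by simp [Tight, capSum]) (by omega)
    have hc : ∀ z, cap (fun _ => q + 3) p p z = 1 := fun z => cap_outside (by omega)
    have := hr.reach p q H l (fun z hz hz' => by rw [hc, hH z hz hz'])
      (fun z hz => by
        by_contra hcon
        rw [if_neg (by omega)] at hz
        omega)
      (fun z hz => by
        by_contra hcon
        rw [hc, cap_outside hcon] at hz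
        omega)
      (fun z => by split_ifs <;> simp [h1])
    refine ⟨fun z => l z - if p ≤ z ∧ z < q ∧ ¬ (p ≤ z ∧ z < p) then l' z else 0,
      fun z => Nat.sub_le _ _, fun z hz => ?_, ?_⟩
    rotate_left
    · convert this using 3 with z
      split_ifs with hz
      · simp only [cap]
        omega
      · rfl
    · simp only
      rw [if_neg (by omega), Nat.sub_zero]
  · refine ⟨l, fun _ => le_rfl, fun _ _ => rfl, ?_⟩
    convert ReflTransGen.refl using 2
    · funext z
      rw [if_neg (by omega)]

set_option maxHeartbeats 1000000 in
/-- A part of the spine all of whose inner windows have enough leaves can be collapsed, with its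
leaves, into a single vertex. -/
theorem exists_collapse_segment (H L : ℕ → ℕ) (s t : ℕ) (hst : s ≤ t)
    (hH : ∀ z, s ≤ z → z ≤ t → H z = 1)
    (hw : ∀ b, skipBare L s + 1 ≤ b → (b + 1 + if L t = 0 then 1 else 0) ≤ t →
      WindowsOK L (skipBare L s + 1) b) :
    ∃ H' L', ReflTransGen SpineMove (H, L) (H', L') ∧
      (∃ r, s ≤ r ∧ r ≤ t ∧ 0 < H' r ∧ ∀ z, s ≤ z → z ≤ t → z ≠ r → H' z = 0) ∧
      (∀ z, s ≤ z → z ≤ t → L' z = 0) ∧ ∀ z, ¬ (s ≤ z ∧ z ≤ t) → H' z = H z ∧ L' z = L z := by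
  rcases hst.eq_or_lt with rfl | hlt
  · refine ⟨_, _, exists_absorb_all (L s) H L s rfl (by rw [hH s le_rfl le_rfl]),
      ⟨s, le_rfl, le_rfl, by simp [hH s le_rfl le_rfl], fun z h1 h2 h3 => absurd (by omega) h3⟩,
      fun z h1 h2 => ?_, fun z hz => ?_⟩
    · obtain rfl : z = s := by omega
      simp
    · have : z ≠ s := by omega
      simp [Function.update_of_ne this]
  -- An end with leaves needs a strictly heavier neighbour in order to drain, while a bare end only
  -- needs one of equal weight. So the tent can keep one more position away from a bare end.
  obtain ⟨p, hp⟩ : ∃ p, p = skipBare L s + 1 := ⟨_, rfl⟩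
  obtain ⟨q, hq⟩ : ∃ q, q = t - if L t = 0 then 1 else 0 := ⟨_, rfl⟩
  have hp' : p = s + 1 ∧ L s ≠ 0 ∨ p = s + 2 ∧ L s = 0 := by
    unfold skipBare at hp
    split_ifs at hp with h <;> omega
  have hq' : q = t ∧ L t ≠ 0 ∨ q + 1 = t ∧ L t = 0 := by
    split_ifs at hq with h <;> omega
  obtain ⟨L1, hL1, hL1', hr1⟩ := exists_raise L H p q (fun z h1 h2 => hH z (by omega) (by omega))
    (fun b h1 h2 => by
      rw [hp]
      exact hw b (by omega) (by split_ifs with h <;> omega))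
  obtain ⟨H1, hH1⟩ : ∃ H1 : ℕ → ℕ, H1 = fun z =>
    if p ≤ z ∧ z < q then max 1 (min (z + 2 - p) (q + 1 - z)) else H z := ⟨_, rfl⟩
  rw [← hH1] at hr1
  have v1 : ∀ z, s ≤ z → z ≤ t → H1 z = max 1 (min (z + 2 - p) (q + 1 - z)) := by
    intro z h1 h2
    rw [hH1]
    simp only
    split_ifs with hz
    · rfl
    · rw [hH z h1 h2]
      omega
  have v1' : ∀ z, ¬ (s ≤ z ∧ z ≤ t) → H1 z = H z := by
    intro z hz
    rw [hH1]
    simp only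
    rw [if_neg (by omega)]
  -- A tent of even width has two highest positions, and this is the left one. The left side is
  -- collapsed first, so that the root is strictly heavier than its right neighbour when the right
  -- side follows.
  obtain ⟨r, hr⟩ : ∃ r, r = (p + q - 1) / 2 := ⟨_, rfl⟩
  have hsr : s ≤ r ∧ r ≤ t := by omega
  have hdec : ∀ z, r < z → z + 2 ≤ t → max 1 (min (z + 1 + 2 - p) (q + 1 - (z + 1))) <
      max 1 (min (z + 2 - p) (q + 1 - z)) := by
    intro z h1 h2
    have h3 : q + 1 - z ≤ z + 2 - p := by omega
    rw [min_eq_right h3, min_eq_right (by omega)]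
    omega
  have l1 := hL1' s (by omega)
  have l1t := hL1' t (by omega)
  -- the left part
  obtain ⟨H2, L2, r2, z2, g2, g2', e2, o2⟩ := exists_collapse (r - s) H1 L1 (fun k => s + k)
    (fun k _ => consec_add s k) (fun i _ j _ hij => by simpa using hij)
    (by rw [v1 _ (by omega) (by omega)]; omega)
    (fun h => by
      rw [v1 _ (by omega) (by omega), v1 _ (by omega) (by omega), add_zero, l1]
      constructor <;> omega)
    (fun k h1 h2 => by
      rw [v1 _ (by omega) (by omega), v1 _ (by omega) (by omega)]
      omega)
  rw [show s + (r - s) = r by omega] at g2 g2' e2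
  have z2' : ∀ z, s ≤ z → z < r → H2 z = 0 ∧ L2 z = 0 := fun z h1 h2 => by
    have := z2 (z - s) (by omega)
    rwa [show s + (z - s) = z by omega] at this
  have o2' : ∀ z, ¬ (s ≤ z ∧ z ≤ r) → H2 z = H1 z ∧ L2 z = L1 z := fun z h => o2 z fun k hk => by omega
  have v1r := v1 r hsr.1 hsr.2
  have hpos2 : 1 ≤ H2 r := by omega
  -- the leaves at the root
  have r3 := exists_absorb_all (L2 r) H2 L2 r rfl hpos2
  obtain ⟨H3, hH3⟩ : ∃ H3, H3 = Function.update H2 r (H2 r + L2 r) := ⟨_, rfl⟩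
  obtain ⟨L3, hL3⟩ : ∃ L3, L3 = Function.update L2 r 0 := ⟨_, rfl⟩
  rw [← hH3, ← hL3] at r3
  have a3 : H3 r = H2 r + L2 r := by rw [hH3, Function.update_self]
  have a3' : L3 r = 0 := by rw [hL3, Function.update_self]
  have o3 : ∀ z, z ≠ r → H3 z = H2 z ∧ L3 z = L2 z := fun z hz => by
    rw [hH3, hL3, Function.update_of_ne hz, Function.update_of_ne hz]
    exact ⟨rfl, rfl⟩
  have v3 : ∀ z, r < z → z ≤ t → H3 z = max 1 (min (z + 2 - p) (q + 1 - z)) ∧ L3 z = L1 z := by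
    intro z h1 h2
    rw [(o3 z (by omega)).1, (o3 z (by omega)).2, (o2' z (by omega)).1, (o2' z (by omega)).2,
      v1 z (by omega) h2]
    exact ⟨rfl, rfl⟩
  -- The root has gained weight from the left side or from its own leaves. The exception is a pair
  -- ending in a bare vertex, for which equal weights suffice.
  have hroot : H1 r < H3 r ∨ (r = s ∧ t = s + 1 ∧ L t = 0) := by
    rcases hsr.1.eq_or_lt with h | h
    · by_cases hls : L s = 0
      · right
        omega
      · left
        rw [← h] at e2
        rw [← h] at a3 g2' ⊢
        omega
    · have := g2 (by omega)
      omega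
  -- the right part
  obtain ⟨H4, L4, r4, z4, g4, g4', e4, o4⟩ := exists_collapse (t - r) H3 L3 (fun k => t - k)
    (fun k _ => consec_sub (by omega)) (fun i _ j _ hij => by have h5 : t - i = t - j := hij; omega)
    (by
      simp only [Nat.sub_zero]
      rcases hsr.2.eq_or_lt with h | h
      · rw [← h]; omega
      · rw [(v3 t h le_rfl).1]; omega)
    (fun h => by
      simp only [Nat.sub_zero]
      rw [(v3 t (by omega) le_rfl).1, (v3 t (by omega) le_rfl).2, l1t]
      by_cases h5 : t - 1 = r
      · rw [h5]
        constructor <;> omega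
      · rw [(v3 (t - 1) (by omega) (by omega)).1]
        constructor <;> omega)
    (fun k h1 h2 => by
      rw [(v3 (t - k) (by omega) (by omega)).1]
      by_cases h5 : t - (k + 1) = r
      · rw [h5]
        omega
      · rw [(v3 (t - (k + 1)) (by omega) (by omega)).1, show t - k = t - (k + 1) + 1 by omega]
        exact hdec _ (by omega) (by omega))
  rw [show t - (t - r) = r by omega] at g4 g4' e4
  have z4' : ∀ z, r < z → z ≤ t → H4 z = 0 ∧ L4 z = 0 := fun z h1 h2 => by
    have := z4 (t - z) (by omega)
    rwa [show t - (t - z) = z by omega] at this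
  have o4' : ∀ z, ¬ (r ≤ z ∧ z ≤ t) → H4 z = H3 z ∧ L4 z = L3 z := fun z h => o4 z fun k hk => by omega
  have hpos4 : 0 < H4 r := (show 0 < H3 r by rw [a3]; exact Nat.lt_add_right _ hpos2).trans_le g4'
  clear v1r hroot g4' g2' e2 l1 l1t a3
  refine ⟨H4, L4, ((hr1.trans r2).trans r3).trans r4, ⟨r, hsr.1, hsr.2, hpos4, fun z h1 h2 h3 => ?_⟩,
    fun z h1 h2 => ?_, fun z hz => ?_⟩
  · rcases lt_or_gt_of_ne h3 with h | h
    · rw [(o4' z (by omega)).1, (o3 z h3).1, (z2' z h1 h).1]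
    · exact (z4' z h h2).1
  · rcases lt_trichotomy z r with h | h | h
    · rw [(o4' z (by omega)).2, (o3 z (by omega)).2, (z2' z h1 h).2]
    · rw [h, e4, a3']
    · exact (z4' z h h2).2
  · rw [(o4' z (by omega)).1, (o4' z (by omega)).2, (o3 z (by omega)).1, (o3 z (by omega)).2,
      (o2' z (by omega)).1, (o2' z (by omega)).2, v1' z hz, hL1' z (by omega)]
    exact ⟨rfl, rfl⟩

/-- The greedy number of survivors can be attained. -/
theorem Greedy.exists_reach {l : ℕ → ℕ} {N s k : ℕ} (hk : Greedy l N s k) (hs : s < N)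
    (hlast : 0 < l (N - 1)) : ∀ (H L : ℕ → ℕ),
    (∀ z, s ≤ z → z < N → H z = 1) → (∀ z, s ≤ z → z < N → L z = l z) →
    ∃ H' L', ReflTransGen SpineMove (H, L) (H', L') ∧
      ∑ z ∈ Finset.Ico s N, ((if 0 < H' z then 1 else 0) + L' z) = k ∧
      ∀ z, ¬ (s ≤ z ∧ z < N) → H' z = H z ∧ L' z = L z := by
  have single : ∀ (H' L' : ℕ → ℕ) (s t : ℕ),
      (∃ r, s ≤ r ∧ r ≤ t ∧ 0 < H' r ∧ ∀ z, s ≤ z → z ≤ t → z ≠ r → H' z = 0) →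
      (∀ z, s ≤ z → z ≤ t → L' z = 0) →
      ∑ z ∈ Finset.Ico s (t + 1), ((if 0 < H' z then 1 else 0) + L' z) = 1 := by
    rintro H' L' s t ⟨r, h1, h2, h3, h4⟩ h5
    rw [Finset.sum_eq_single r]
    · rw [if_pos h3, h5 r h1 h2]
    · intro z hz hzr
      rw [Finset.mem_Ico] at hz
      rw [h4 z hz.1 (by omega) hzr, h5 z hz.1 (by omega)]
      simp
    · intro h
      rw [Finset.mem_Ico] at h
      omega
  have windows : ∀ (L : ℕ → ℕ) (s b lo : ℕ), s ≤ lo → b < N → (∀ z, s ≤ z → z < N → L z = l z) →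
      WindowsOK l lo b → WindowsOK L lo b := by
    intro L s b lo hlo hb hL hw a h1 h2
    rw [Finset.sum_congr rfl (g := l) fun z hz => ?_]
    · exact hw a h1 h2
    · rw [Finset.mem_Icc] at hz
      exact hL z (by omega) (by omega)
  have hskip : ∀ x, x ≤ skipBare l x := fun x => Nat.le_add_right _ _
  induction hk with
  | last s _ h =>
    intro H L hH hL
    have hls := hL s le_rfl hs
    have hlt := hL (N - 1) (by omega) (by omega)
    have hsk : skipBare L s = skipBare l s := by simp only [skipBare, hls]
    obtain ⟨H', L', r1, r2, r3, r4⟩ := exists_collapse_segment H L s (N - 1) (by omega)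
      (fun z h1 h2 => hH z h1 (by omega)) (fun b h1 h2 => by
        rw [hsk] at h1 ⊢
        have := hskip s
        rw [if_neg (by omega)] at h2
        exact windows L s b _ (by omega) (by omega) hL (h b h1 (by omega)))
    refine ⟨H', L', r1, ?_, fun z hz => r4 z (by omega)⟩
    have := single H' L' s (N - 1) r2 r3
    rwa [show N - 1 + 1 = N by omega] at this
  | step s b k hb hbN hfirst _ _ ih =>
    intro H L hH hL
    have hls := hL s le_rfl hs
    have hsk : skipBare L s = skipBare l s := by simp only [skipBare, hls]
    have hlb := hskip s
    -- The part ends at `b`, or at `b + 1` if that position is bare. In both cases the windows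
    -- needed for collapsing end before `b`, so the short window does no harm.
    obtain ⟨t, ht⟩ : ∃ t, t + 1 = skipBare l (b + 1) := ⟨b + if l (b + 1) = 0 then 1 else 0, by
      unfold skipBare; omega⟩
    have ht' : t = b ∧ l (b + 1) ≠ 0 ∨ t = b + 1 ∧ l t = 0 ∧ b + 2 < N := by
      unfold skipBare at ht
      split_ifs at ht with h0
      · right
        refine ⟨by omega, by rwa [show t = b + 1 by omega], ?_⟩
        by_contra hcon
        rw [show N - 1 = b + 1 by omega] at hlast
        omega
      · left; omega
    have hlt := hL t (by omega) (by omega)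
    obtain ⟨H', L', r1, r2, r3, r4⟩ := exists_collapse_segment H L s t (by omega)
      (fun z h1 h2 => hH z h1 (by omega)) (fun b' h1 h2 => by
        rw [hsk] at h1 ⊢
        refine windows L s b' _ (by omega) (by split_ifs at h2 <;> omega) hL (hfirst b' h1 ?_)
        split_ifs at h2 <;> omega)
    rw [← ht] at ih
    obtain ⟨H2, L2, q1, q2, q3⟩ := ih (by omega) H' L'
      (fun z h1 h2 => by rw [(r4 z (by omega)).1, hH z (by omega) h2])
      (fun z h1 h2 => by rw [(r4 z (by omega)).2, hL z (by omega) h2])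
    refine ⟨H2, L2, r1.trans q1, ?_, fun z hz => ?_⟩
    · rw [← Finset.sum_Ico_consecutive _ (show s ≤ t + 1 by omega) (show t + 1 ≤ N by omega), q2,
        add_comm, Nat.add_left_cancel_iff]
      refine (Finset.sum_congr rfl fun z hz => ?_).trans (single H' L' s t r2 r3)
      rw [Finset.mem_Ico] at hz
      rw [(q3 z (by omega)).1, (q3 z (by omega)).2]
    · rw [(q3 z (by omega)).1, (q3 z (by omega)).2]
      exact r4 z (by omega)

end UnitAcquisition

namespace UnitAcquisition

/-! ### Caterpillars: the spine -/

open Relation (ReflTransGen)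

section

variable {V : Type*}

/-- `v 0, …, v (N - 1)` are, in the order of a path, the vertices with at least two neighbours, and
every other vertex is a leaf attached to one of them. -/
structure IsSpine (G : SimpleGraph V) (N : ℕ) (v : ℕ → V) : Prop where
  pos : 0 < N
  inj : ∀ i < N, ∀ j < N, v i = v j → i = j
  adj : ∀ i < N, ∀ j < N, (G.Adj (v i) (v j) ↔ Consec i j)
  leaf : ∀ x, (∀ i < N, v i ≠ x) → ∃ i < N, ∀ y, G.Adj x y ↔ y = v i
  nonleaf : ∀ i < N, ∃ y z, G.Adj (v i) y ∧ G.Adj (v i) z ∧ y ≠ z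

/-- The segment of the path and the edge are two paths with the same ends, so they coincide and the
segment has length one. -/
theorem adj_getVert_iff {G : SimpleGraph V} (hG : G.IsAcyclic) {a b : V} {p : G.Walk a b}
    (hp : p.IsPath) {i j : ℕ} (hij : i < j) (hj : j ≤ p.length)
    (h : G.Adj (p.getVert i) (p.getVert j)) : j = i + 1 := by
  have hq := (hp.drop i).take (j - i)
  have e : (p.drop i).getVert (j - i) = p.getVert j := by
    rw [SimpleGraph.Walk.drop_getVert]
    congr 1
    omega
  have h1 : (((p.drop i).take (j - i)).copy rfl e).IsPath := by simpa using hq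
  have h2 := (hG.subsingleton_path _ _).elim ⟨_, h1⟩ (SimpleGraph.Path.singleton h)
  have h3 := congrArg (fun q => q.1.length) h2
  simp [SimpleGraph.Walk.take_length, SimpleGraph.Walk.drop_length] at h3
  omega

/-- Two adjacent leaves have no further neighbours, so no walk leaves the pair. This rules out
leaves attached to leaves, and also settles the graph with a single edge. -/
theorem IsLeaf.eq_or_eq {G : SimpleGraph V} (hG : G.Connected) {x u : V} (hx : IsLeaf G x)
    (hu : IsLeaf G u) (h : G.Adj x u) (y : V) : y = x ∨ y = u := by
  obtain ⟨p⟩ := hG.preconnected x y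
  suffices ∀ (a b : V) (p : G.Walk a b), (a = x ∨ a = u) → b = x ∨ b = u from this x y p (Or.inl rfl)
  intro a b p
  induction p with
  | nil => exact id
  | cons hadj _ ih =>
    rintro (rfl | rfl)
    · exact ih (Or.inr (hx.unique hadj h))
    · exact ih (Or.inl (hu.unique hadj h.symm))

theorem IsCaterpillar.exists_isSpine {G : SimpleGraph V} (hG : IsCaterpillar G)
    {c x y : V} (hx : G.Adj c x) (hy : G.Adj c y) (hxy : x ≠ y) :
    ∃ N v, IsSpine G N v := by
  obtain ⟨hT, a, b, p, hp, hsup⟩ := hG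
  have hcl : ¬ IsLeaf G c := fun h => hxy (h.unique hx hy)
  have hnb : ∀ z, ∃ y, G.Adj z y := by
    intro z
    obtain ⟨q⟩ := hT.connected.preconnected z x
    cases q with
    | nil => exact ⟨c, hx.symm⟩
    | cons h _ => exact ⟨_, h⟩
  have hnl : ∀ z, ¬ IsLeaf G z → ∃ y w, G.Adj z y ∧ G.Adj z w ∧ y ≠ w := by
    intro z hz
    obtain ⟨y, hy⟩ := hnb z
    by_contra hcon
    push Not at hcon
    exact hz ⟨y, hy, fun w hw => hcon w y hw hy⟩
  have hinner : ∀ i, 0 < i → i < p.length → ¬ IsLeaf G (p.getVert i) := by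
    intro i h0 hi hl
    have h1 := p.adj_getVert_succ hi
    have h2 := p.adj_getVert_succ (i := i - 1) (by omega)
    rw [show i - 1 + 1 = i by omega] at h2
    have h3 := hl.unique h1 h2.symm
    have := hp.getVert_injOn (show i + 1 ≤ p.length by omega) (show i - 1 ≤ p.length by omega) h3
    omega
  classical
  -- Inner vertices of a path have two neighbours, so only its ends can be leaves. Cutting these off
  -- leaves precisely the non-leaves, at positions `α, …, β - 1`.
  obtain ⟨α, hα⟩ : ∃ α, α = if IsLeaf G (p.getVert 0) then 1 else 0 := ⟨_, rfl⟩
  obtain ⟨β, hβ⟩ : ∃ β, β = p.length + if IsLeaf G (p.getVert p.length) then 0 else 1 := ⟨_, rfl⟩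
  have hβle : β ≤ p.length + 1 := by split_ifs at hβ <;> omega
  have hmem : ∀ i, i ≤ p.length → (¬ IsLeaf G (p.getVert i) ↔ α ≤ i ∧ i < β) := by
    intro i hi
    by_cases h0 : i = 0
    · subst h0
      by_cases hl : IsLeaf G (p.getVert 0)
      · rw [if_pos hl] at hα
        constructor
        · intro h; exact absurd hl h
        · intro h; omega
      · rw [if_neg hl] at hα
        refine ⟨fun _ => ⟨by omega, ?_⟩, fun _ => hl⟩
        rcases hi.eq_or_lt with h | h
        · rw [← h, if_neg hl] at hβ; omega
        · omega
    · have hα1 : α ≤ 1 := by split_ifs at hα <;> omega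
      rcases hi.eq_or_lt with h | h
      · rw [h]
        split_ifs at hβ with hl
        · constructor
          · intro h; exact absurd hl h
          · intro h; omega
        · exact ⟨fun _ => ⟨by omega, by omega⟩, fun _ => hl⟩
      · exact ⟨fun _ => ⟨by omega, by omega⟩, fun _ => hinner i (by omega) h⟩
  have hspine : ∀ z, ¬ IsLeaf G z → ∃ i, i < β - α ∧ p.getVert (α + i) = z := by
    intro z hz
    obtain ⟨i, rfl, hi⟩ := SimpleGraph.Walk.mem_support_iff_exists_getVert.mp (hsup z hz)
    have := (hmem i hi).mp hz
    exact ⟨i - α, by omega, by congr 1; omega⟩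
  refine ⟨β - α, fun i => p.getVert (α + i), ⟨?_, ?_, ?_, ?_, ?_⟩⟩
  · obtain ⟨i, hi, -⟩ := hspine c hcl
    omega
  · intro i hi j hj h
    have := hp.getVert_injOn (show α + i ≤ p.length by omega) (show α + j ≤ p.length by omega) h
    omega
  · intro i hi j hj
    constructor
    · intro h
      rcases lt_trichotomy i j with h1 | rfl | h1
      · have := adj_getVert_iff hT.isAcyclic hp (show α + i < α + j by omega) (by omega) h
        exact Or.inl (by omega)
      · exact absurd h (SimpleGraph.irrefl G)
      · have := adj_getVert_iff hT.isAcyclic hp (show α + j < α + i by omega) (by omega) h.symm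
        exact Or.inr (by omega)
    · rintro (rfl | rfl)
      · exact p.adj_getVert_succ (show α + i < p.length by omega)
      · exact (p.adj_getVert_succ (show α + j < p.length by omega)).symm
  · intro z hz
    have hzl : IsLeaf G z := by
      by_contra hcon
      obtain ⟨i, hi, h⟩ := hspine z hcon
      exact hz i hi h
    obtain ⟨u, hu⟩ := hnb z
    have hul : ¬ IsLeaf G u := by
      intro hul
      rcases hzl.eq_or_eq hT.connected hul hu c with rfl | rfl
      · exact hcl hzl
      · exact hcl hul
    obtain ⟨i, hi, rfl⟩ := hspine u hul
    exact ⟨i, hi, fun y => ⟨fun h => hzl.unique h hu, fun h => h ▸ hu⟩⟩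
  · intro i hi
    exact hnl _ ((hmem (α + i) (by omega)).mpr ⟨by omega, by omega⟩)

end

/-! ### Weight distributions of a caterpillar as states of its spine. -/

section

variable {V : Type*} [Fintype V] {G : SimpleGraph V} {N : ℕ} {v : ℕ → V}

open Classical in
/-- The leaves at the spine vertex `v i` that have positive weight. -/
noncomputable def liveLeaves (G : SimpleGraph V) (N : ℕ) (v : ℕ → V) (w : V → ℕ) (i : ℕ) : Finset V :=
  Finset.univ.filter fun x => i < N ∧ (∀ j < N, v j ≠ x) ∧ G.Adj x (v i) ∧ 0 < w x

/-- The state of the spine that belongs to a weight distribution. -/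
noncomputable def spineState (G : SimpleGraph V) (N : ℕ) (v : ℕ → V) (w : V → ℕ) :
    (ℕ → ℕ) × (ℕ → ℕ) :=
  (fun i => if i < N then w (v i) else 0, fun i => (liveLeaves G N v w i).card)

/-- The number of leaves at the spine vertex `v i`. -/
noncomputable def leafCount (G : SimpleGraph V) (N : ℕ) (v : ℕ → V) (i : ℕ) : ℕ :=
  (liveLeaves G N v (fun _ => 1) i).card

theorem mem_liveLeaves {w : V → ℕ} {i : ℕ} {x : V} :
    x ∈ liveLeaves G N v w i ↔ i < N ∧ (∀ j < N, v j ≠ x) ∧ G.Adj x (v i) ∧ 0 < w x := by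
  classical
  simp [liveLeaves]

theorem liveLeaves_congr {w w' : V → ℕ} (h : ∀ x, (∀ j < N, v j ≠ x) → (0 < w x ↔ 0 < w' x)) (i : ℕ) :
    liveLeaves G N v w i = liveLeaves G N v w' i := by
  ext x
  simp only [mem_liveLeaves]
  constructor
  · rintro ⟨h1, h2, h3, h4⟩
    exact ⟨h1, h2, h3, (h x h2).mp h4⟩
  · rintro ⟨h1, h2, h3, h4⟩
    exact ⟨h1, h2, h3, (h x h2).mpr h4⟩

/-- A spine vertex has two neighbours, and at most one of them is on the spine. This is used for the
last spine vertex. -/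
theorem IsSpine.leafCount_pos (hS : IsSpine G N v) {i : ℕ} (hi : i < N)
    (h : ∀ j j', j < N → j' < N → Consec i j → Consec i j' → j = j') : 0 < leafCount G N v i := by
  rw [leafCount, Finset.card_pos]
  by_contra hcon
  rw [Finset.not_nonempty_iff_eq_empty] at hcon
  have hsp : ∀ y, G.Adj (v i) y → ∃ j < N, v j = y := by
    intro y hy
    by_contra hno
    push Not at hno
    have : y ∈ liveLeaves G N v (fun _ => 1) i := mem_liveLeaves.mpr ⟨hi, hno, hy.symm, one_pos⟩
    rw [hcon] at this
    simp at this
  obtain ⟨y, z, hy, hz, hyz⟩ := hS.nonleaf i hi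
  obtain ⟨j, hj, rfl⟩ := hsp y hy
  obtain ⟨j', hj', rfl⟩ := hsp z hz
  exact hyz (congrArg v (h j j' hj hj' ((hS.adj i hi j hj).mp hy) ((hS.adj i hi j' hj').mp hz)))

open Classical in
theorem IsSpine.card_positive (hS : IsSpine G N v) (w : V → ℕ) :
    (Finset.univ.filter fun x => 0 < w x).card = survivors N (spineState G N v w) := by
  have hsplit : (Finset.univ.filter fun x => 0 < w x) =
      ((Finset.range N).filter fun i => 0 < w (v i)).image v ∪
        (Finset.range N).biUnion (liveLeaves G N v w) := by
    ext x
    simp only [Finset.mem_filter, Finset.mem_univ, true_and, Finset.mem_union, Finset.mem_image,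
      Finset.mem_range, Finset.mem_biUnion, mem_liveLeaves]
    constructor
    · intro hx
      by_cases hsp : ∃ i < N, v i = x
      · obtain ⟨i, hi, rfl⟩ := hsp
        exact Or.inl ⟨i, ⟨hi, hx⟩, rfl⟩
      · push Not at hsp
        obtain ⟨i, hi, h⟩ := hS.leaf x hsp
        exact Or.inr ⟨i, hi, hi, hsp, (h _).mpr rfl, hx⟩
    · rintro (⟨i, ⟨_, hx⟩, rfl⟩ | ⟨i, _, _, _, _, hx⟩) <;> exact hx
  rw [hsplit, Finset.card_union_of_disjoint, Finset.card_image_of_injOn, Finset.card_biUnion,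
    survivors, Finset.sum_add_distrib, Finset.card_filter]
  · congr 1
    refine Finset.sum_congr rfl fun i hi => ?_
    rw [Finset.mem_range] at hi
    simp [spineState, hi]
  · intro i hi j hj hij
    refine Finset.disjoint_left.mpr ?_
    intro x hx hx'
    rw [mem_liveLeaves] at hx hx'
    obtain ⟨k, hk, h⟩ := hS.leaf x hx.2.1
    exact hij (hS.inj i hx.1 j hx'.1 (((h _).mp hx.2.2.1).trans ((h _).mp hx'.2.2.1).symm))
  · intro i hi j hj h
    simp only [Finset.coe_filter, Finset.mem_range, Set.mem_ofPred_eq] at hi hj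
    exact hS.inj i hi.1 j hj.1 h
  · rw [Finset.disjoint_left]
    intro x hx hx'
    rw [Finset.mem_image] at hx
    obtain ⟨i, hi, rfl⟩ := hx
    rw [Finset.mem_filter, Finset.mem_range] at hi
    rw [Finset.mem_biUnion] at hx'
    obtain ⟨j, _, hj⟩ := hx'
    exact (mem_liveLeaves.mp hj).2.1 i hi.1 rfl

theorem spineState_one : spineState G N v (fun _ => 1) =
    (fun z => if z < N then 1 else 0, leafCount G N v) := rfl

theorem leafCount_eq_zero {z : ℕ} (hz : N ≤ z) : leafCount G N v z = 0 := by
  rw [leafCount, Finset.card_eq_zero, Finset.eq_empty_iff_forall_notMem]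
  intro x hx
  have := (mem_liveLeaves.mp hx).1
  omega

variable [DecidableEq V]

/-- The effect of a unit moved between two spine vertices. -/
theorem IsSpine.spineState_shift (hS : IsSpine G N v) {w : V → ℕ} {i j : ℕ} (hi : i < N) (hj : j < N) :
    spineState G N v (Function.update (Function.update w (v i) (w (v i) - 1)) (v j) (w (v j) + 1)) =
      (Function.update (Function.update (spineState G N v w).1 i ((spineState G N v w).1 i - 1)) j
        ((spineState G N v w).1 j + 1), (spineState G N v w).2) := by
  refine Prod.ext ?_ ?_
  · funext z
    simp only [spineState, hi, hj, if_true]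
    by_cases hzj : z = j
    · subst hzj; simp [hj]
    · rw [Function.update_of_ne hzj]
      by_cases hzi : z = i
      · subst hzi
        rw [if_pos hi, Function.update_self,
          Function.update_of_ne (fun h => hzj (hS.inj _ hi _ hj h)), Function.update_self]
      · rw [Function.update_of_ne hzi]
        by_cases hzN : z < N
        · rw [if_pos hzN, if_pos hzN, Function.update_of_ne (fun h => hzj (hS.inj _ hzN _ hj h)),
            Function.update_of_ne (fun h => hzi (hS.inj _ hzN _ hi h))]
        · rw [if_neg hzN, if_neg hzN]
  · funext z
    simp only [spineState]
    rw [liveLeaves_congr fun x hx => ?_]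
    rw [Function.update_of_ne (hx j hj).symm, Function.update_of_ne (hx i hi).symm]

/-- The effect of a leaf giving its unit to its neighbour. -/
theorem IsSpine.spineState_absorb (hS : IsSpine G N v) {w : V → ℕ} {i : ℕ} {x : V} (hi : i < N)
    (hx : ∀ j < N, v j ≠ x) (hadj : G.Adj x (v i)) (hw : w x = 1) :
    spineState G N v (Function.update (Function.update w x (w x - 1)) (v i) (w (v i) + 1)) =
      (Function.update (spineState G N v w).1 i ((spineState G N v w).1 i + 1),
        Function.update (spineState G N v w).2 i ((spineState G N v w).2 i - 1)) := by
  obtain ⟨k, hk, hk'⟩ := hS.leaf x hx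
  obtain rfl : i = k := hS.inj _ hi _ hk ((hk' _).mp hadj)
  refine Prod.ext ?_ ?_
  · funext z
    simp only [spineState, hi, if_true]
    by_cases hzi : z = i
    · subst hzi; simp [hi]
    · rw [Function.update_of_ne hzi]
      by_cases hzN : z < N
      · rw [if_pos hzN, if_pos hzN, Function.update_of_ne (fun h => hzi (hS.inj _ hzN _ hi h)),
          Function.update_of_ne (hx z hzN)]
      · rw [if_neg hzN, if_neg hzN]
  · funext z
    simp only [spineState]
    by_cases hzi : z = i
    · subst hzi
      rw [Function.update_self, ← Finset.card_erase_of_mem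
        (mem_liveLeaves.mpr ⟨hi, hx, hadj, by omega⟩ : x ∈ liveLeaves G N v w z)]
      congr 1
      ext y
      rw [Finset.mem_erase, mem_liveLeaves, mem_liveLeaves]
      by_cases hyx : y = x
      · subst hyx
        simp [Function.update_of_ne (hx z hi).symm, hw]
      · constructor
        · rintro ⟨h1, h2, h3, h4⟩
          rw [Function.update_of_ne (h2 z hi).symm, Function.update_of_ne hyx] at h4
          exact ⟨hyx, h1, h2, h3, h4⟩
        · rintro ⟨-, h1, h2, h3, h4⟩
          refine ⟨h1, h2, h3, ?_⟩
          rwa [Function.update_of_ne (h2 z hi).symm, Function.update_of_ne hyx]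
    · rw [Function.update_of_ne hzi]
      congr 1
      ext y
      rw [mem_liveLeaves, mem_liveLeaves]
      refine and_congr_right fun h1 => and_congr_right fun h2 => and_congr_right fun h3 => ?_
      have hyx : y ≠ x := by
        rintro rfl
        exact hzi (hS.inj _ h1 _ hi ((hk' _).mp h3))
      rw [Function.update_of_ne (h2 i hi).symm, Function.update_of_ne hyx]

/-- In all reachable distributions a leaf has weight at most one, unless its neighbour has lost
all its weight; and every move is a step of the spine. -/
theorem IsSpine.step (hS : IsSpine G N v) {w w' : V → ℕ} (hm : UnitMove G w w')
    (hinv : ∀ x i, i < N → (∀ j < N, v j ≠ x) → G.Adj x (v i) → w x ≤ 1 ∨ w (v i) = 0) :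
    SpineStep (spineState G N v w) (spineState G N v w') ∧
      ∀ x i, i < N → (∀ j < N, v j ≠ x) → G.Adj x (v i) → w' x ≤ 1 ∨ w' (v i) = 0 := by
  obtain ⟨u, t, hut, hu, hle, rfl⟩ := hm
  by_cases hus : ∃ i < N, v i = u
  · obtain ⟨i, hi, rfl⟩ := hus
    by_cases hts : ∃ j < N, v j = t
    · obtain ⟨j, hj, rfl⟩ := hts
      refine ⟨?_, fun x k hk hx hadj => ?_⟩
      · rw [hS.spineState_shift hi hj]
        refine SpineStep.move (SpineMove.shift _ _ i j ((hS.adj i hi j hj).mp hut) ?_ ?_) <;>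
          simp [hi, hj, hu, hle]
      · rw [Function.update_of_ne (hx j hj).symm, Function.update_of_ne (hx i hi).symm]
        rcases hinv x k hk hx hadj with h | h
        · exact Or.inl h
        · right
          -- A vertex of weight zero cannot receive anything, so a dead spine vertex stays dead.
          have hkj : v k ≠ v j := fun e => by rw [e] at h; omega
          have hki : v k ≠ v i := fun e => by rw [e] at h; omega
          rw [Function.update_of_ne hkj, Function.update_of_ne hki, h]
    · push Not at hts
      obtain ⟨k, hk, hk'⟩ := hS.leaf t hts
      obtain rfl : i = k := hS.inj _ hi _ hk ((hk' _).mp hut.symm)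
      have hne : v i ≠ t := hts i hi
      -- The giving spine vertex is alive, so the leaf weighs at most one, and then both weigh
      -- exactly one: this is a `kill`. The leaf of weight two that results still counts as one live
      -- leaf.
      rcases hinv t i hi hts hut.symm with h | h
      · have hwi : w (v i) = 1 := by omega
        have hwt : w t = 1 := by omega
        refine ⟨?_, fun x k hk hx hadj => ?_⟩
        · have e : spineState G N v
              (Function.update (Function.update w (v i) (w (v i) - 1)) t (w t + 1)) =
              (Function.update (spineState G N v w).1 i 0, (spineState G N v w).2) := by
            refine Prod.ext ?_ ?_
            · funext z
              simp only [spineState]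
              by_cases hzi : z = i
              · subst hzi
                rw [if_pos hi, Function.update_self, Function.update_of_ne hne, Function.update_self,
                  hwi]
              · rw [Function.update_of_ne hzi]
                by_cases hzN : z < N
                · rw [if_pos hzN, if_pos hzN, Function.update_of_ne (hts z hzN),
                    Function.update_of_ne (fun h => hzi (hS.inj _ hzN _ hi h))]
                · rw [if_neg hzN, if_neg hzN]
            · funext z
              simp only [spineState]
              rw [liveLeaves_congr fun x hx => ?_]
              by_cases hxt : x = t
              · subst hxt; simp [hwt]
              · rw [Function.update_of_ne hxt, Function.update_of_ne (hx i hi).symm]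
          rw [e]
          refine SpineStep.kill _ _ i (by simp [hi, hwi]) ?_
          exact Finset.card_pos.mpr ⟨t, mem_liveLeaves.mpr ⟨hi, hts, hut.symm, by omega⟩⟩
        · by_cases hxt : x = t
          · subst hxt
            right
            rw [(hk' _).mp hadj, Function.update_of_ne hne, Function.update_self]
            omega
          · rw [Function.update_of_ne hxt, Function.update_of_ne (hx i hi).symm,
              Function.update_of_ne (hts k hk)]
            rcases hinv x k hk hx hadj with h' | h'
            · exact Or.inl h'
            · right
              have hki : v k ≠ v i := fun e => by rw [e] at h'; omega
              rw [Function.update_of_ne hki, h']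
      · omega
  · push Not at hus
    obtain ⟨i, hi, hi'⟩ := hS.leaf u hus
    obtain rfl := (hi' _).mp hut
    have hwu : w u = 1 := by
      rcases hinv u i hi hus hut with h | h <;> omega
    refine ⟨?_, fun x k hk hx hadj => ?_⟩
    · rw [hS.spineState_absorb hi hus hut hwu]
      refine SpineStep.move (SpineMove.absorb _ _ i (by simp [hi]; omega) ?_)
      exact Finset.card_pos.mpr ⟨u, mem_liveLeaves.mpr ⟨hi, hus, hut, by omega⟩⟩
    · rw [Function.update_of_ne (hx i hi).symm]
      by_cases hxu : x = u
      · subst hxu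
        left
        rw [Function.update_self]
        omega
      · rw [Function.update_of_ne hxu]
        rcases hinv x k hk hx hadj with h | h
        · exact Or.inl h
        · right
          have hki : v k ≠ v i := fun e => by rw [e] at h; omega
          rw [Function.update_of_ne hki, Function.update_of_ne (hus k hk), h]

theorem IsSpine.reachable (hS : IsSpine G N v) {w : V → ℕ} (hw : Reachable G w) :
    ReflTransGen SpineStep (fun z => if z < N then 1 else 0, leafCount G N v) (spineState G N v w) := by
  suffices ReflTransGen SpineStep (fun z => if z < N then 1 else 0, leafCount G N v)
      (spineState G N v w) ∧
      ∀ x i, i < N → (∀ j < N, v j ≠ x) → G.Adj x (v i) → w x ≤ 1 ∨ w (v i) = 0 from this.1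
  unfold Reachable at hw
  induction hw with
  | refl => exact ⟨ReflTransGen.refl, fun _ _ _ _ _ => Or.inl le_rfl⟩
  | tail _ hm ih =>
    obtain ⟨h1, h2⟩ := hS.step hm ih.2
    exact ⟨ih.1.tail h1, h2⟩

/-- A `SpineMove` never fills a leaf, so leaf weights stay at most one and a live leaf can give up
its whole weight at once. -/
theorem IsSpine.exists_move (hS : IsSpine G N v) {w : V → ℕ}
    (hinv : ∀ x, (∀ j < N, v j ≠ x) → w x ≤ 1) {s : (ℕ → ℕ) × (ℕ → ℕ)}
    (hs : SpineMove (spineState G N v w) s) :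
    ∃ w', UnitMove G w w' ∧ spineState G N v w' = s ∧ ∀ x, (∀ j < N, v j ≠ x) → w' x ≤ 1 := by
  generalize hst : spineState G N v w = st at hs
  have e1 : (spineState G N v w).1 = st.1 := by rw [hst]
  have e2 : (spineState G N v w).2 = st.2 := by rw [hst]
  have hval : ∀ i, 0 < st.1 i → i < N ∧ w (v i) = st.1 i := by
    intro i hi
    rw [← e1] at hi ⊢
    simp only [spineState] at hi ⊢
    by_cases h : i < N
    · exact ⟨h, by rw [if_pos h]⟩
    · rw [if_neg h] at hi
      omega
  cases hs with
  | absorb h L i hi hL =>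
    obtain ⟨hiN, hwi⟩ := hval i hi
    have hLi : 0 < (liveLeaves G N v w i).card := by
      have : (spineState G N v w).2 i = L i := by rw [e2]
      simp only [spineState] at this
      omega
    obtain ⟨x, hx⟩ := Finset.card_pos.mp hLi
    obtain ⟨-, hx1, hx2, hx3⟩ := mem_liveLeaves.mp hx
    have hwx : w x = 1 := by have := hinv x hx1; omega
    refine ⟨_, ⟨x, v i, hx2, hx3, by simp only at hwi hi; omega, rfl⟩, ?_, fun y hy => ?_⟩
    · rw [hS.spineState_absorb hiN hx1 hx2 hwx, hst]
    · rw [Function.update_of_ne (hy i hiN).symm]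
      by_cases hyx : y = x
      · subst hyx
        rw [Function.update_self]
        omega
      · rw [Function.update_of_ne hyx]
        exact hinv y hy
  | shift h L i j hij hi hle =>
    obtain ⟨hiN, hwi⟩ := hval i hi
    obtain ⟨hjN, hwj⟩ := hval j (lt_of_lt_of_le hi hle)
    refine ⟨_, ⟨v i, v j, (hS.adj i hiN j hjN).mpr hij, by rw [hwi]; exact hi,
      by rw [hwi, hwj]; exact hle, rfl⟩, ?_, fun y hy => ?_⟩
    · rw [hS.spineState_shift hiN hjN, hst]
    · rw [Function.update_of_ne (hy j hjN).symm, Function.update_of_ne (hy i hiN).symm]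
      exact hinv y hy

theorem IsSpine.exists_reachable (hS : IsSpine G N v) {s : (ℕ → ℕ) × (ℕ → ℕ)}
    (hs : ReflTransGen SpineMove (fun z => if z < N then 1 else 0, leafCount G N v) s) :
    ∃ w, Reachable G w ∧ spineState G N v w = s := by
  suffices ∃ w, Reachable G w ∧ spineState G N v w = s ∧ ∀ x, (∀ j < N, v j ≠ x) → w x ≤ 1 by
    obtain ⟨w, h1, h2, -⟩ := this
    exact ⟨w, h1, h2⟩
  induction hs with
  | refl => exact ⟨fun _ => 1, ReflTransGen.refl, spineState_one, fun _ _ => le_rfl⟩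
  | tail _ hm ih =>
    obtain ⟨w, h1, h2, h3⟩ := ih
    rw [← h2] at hm
    obtain ⟨w', q1, q2, q3⟩ := hS.exists_move h3 hm
    exact ⟨w', h1.tail q1, q2, q3⟩

/-- The unit acquisition number of a caterpillar is the size of the greedy partition. -/
theorem IsSpine.unitAcquisitionNumber_eq (hS : IsSpine G N v) {k : ℕ}
    (hk : Greedy (leafCount G N v) N 0 k) : unitAcquisitionNumber G = k := by
  have hN := hS.pos
  have hlast : 0 < leafCount G N v (N - 1) := hS.leafCount_pos (by omega) (by
    rintro j j' hj hj' (h | h) (h' | h') <;> omega)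
  have hcard : ∀ w : V → ℕ, (Finset.univ.filter fun x => 0 < w x).card =
      survivors N (spineState G N v w) := by
    intro w
    rw [← hS.card_positive w]
  refine le_antisymm (Nat.sInf_le ?_) (le_csInf ⟨_, fun _ => 1, ReflTransGen.refl, rfl⟩ ?_)
  · obtain ⟨H', L', r1, r2, -⟩ := hk.exists_reach hN hlast (fun z => if z < N then 1 else 0)
      (leafCount G N v) (fun z _ hz => if_pos hz) (fun _ _ _ => rfl)
    obtain ⟨w, h1, h2⟩ := hS.exists_reachable r1
    refine ⟨w, h1, ?_⟩
    rw [hcard, h2, ← r2, survivors, Finset.range_eq_Ico]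
  · rintro m ⟨w, hw, rfl⟩
    rw [hcard]
    exact hk.le_survivors (fun z hz => leafCount_eq_zero hz) hN hlast (hS.reachable hw)

end

end UnitAcquisition

namespace RAM

/-! ### Structured programs -/

/-- Registers and memory. -/
structure State where
  reg : ℕ → ℕ
  mem : ℕ → ℕ

/-- Structured programs. -/
inductive Cmd where
  /-- a single instruction, not a jump -/
  | op (i : Instr) : Cmd
  | seq (c d : Cmd) : Cmd
  /-- if `reg a ≤ reg b` then `c` else `d` -/
  | ite (a b : ℕ) (c d : Cmd) : Cmd
  /-- while `reg a < reg b` do `c` -/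
  | loop (a b : ℕ) (c : Cmd) : Cmd

/-- Commands one after the other. -/
def Cmd.all : List Cmd → Cmd
  | [] => op (.const 0 0)
  | [c] => c
  | c :: d :: cs => seq c (all (d :: cs))

/-- The number of instructions of the compiled program. -/
def Cmd.size : Cmd → ℕ
  | op _ => 1
  | seq c d => c.size + d.size
  | ite _ _ c d => d.size + c.size + 2
  | loop _ _ c => c.size + 2

/-- Compilation to a program that starts at position `p`. -/
def Cmd.compile : Cmd → ℕ → Program
  | op i, _ => [i]
  | seq c d, p => c.compile p ++ d.compile (p + c.size)
  | ite a b c d, p => .jumpLE a b (p + d.size + 2) :: (d.compile (p + 1) ++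
      (.jumpLE 0 0 (p + d.size + c.size + 2) :: c.compile (p + d.size + 2)))
  | loop a b c, p => .jumpLE b a (p + c.size + 2) :: (c.compile (p + 1) ++ [.jumpLE 0 0 p])

theorem Cmd.length_compile (c : Cmd) : ∀ p, (c.compile p).length = c.size := by
  induction c with
  | op i => intro p; rfl
  | seq c d hc hd => intro p; simp [compile, size, hc, hd]
  | ite a b c d hc hd => intro p; simp [compile, size, hc, hd]; omega
  | loop a b c hc => intro p; simp [compile, size, hc]

/-- The state after an instruction. -/
def Instr.effect (s : State) : Instr → State
  | .const r k => ⟨Function.update s.reg r k, s.mem⟩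
  | .add r a b => ⟨Function.update s.reg r (s.reg a + s.reg b), s.mem⟩
  | .sub r a b => ⟨Function.update s.reg r (s.reg a - s.reg b), s.mem⟩
  | .load r a => ⟨Function.update s.reg r (s.mem (s.reg a)), s.mem⟩
  | .store a r => ⟨s.reg, Function.update s.mem (s.reg a) (s.reg r)⟩
  | .jumpLE _ _ _ => s

/-- The value written by an instruction. -/
def Instr.written (s : State) : Instr → ℕ
  | .const _ k => k
  | .add _ a b => s.reg a + s.reg b
  | .sub _ a b => s.reg a - s.reg b
  | .load _ a => s.mem (s.reg a)
  | .store _ r => s.reg r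
  | .jumpLE _ _ _ => 0

/-- The instruction is not a jump. -/
def Instr.IsOp : Instr → Prop
  | .jumpLE _ _ _ => False
  | _ => True

/-- `Exec W c s t s'`: the command `c` leads from `s` to `s'` in `t` steps and does not write any
number exceeding `W`. -/
inductive Exec (W : ℕ) : Cmd → State → ℕ → State → Prop
  | op (i : Instr) (s : State) (hi : i.IsOp) (hw : i.written s ≤ W) :
      Exec W (.op i) s 1 (i.effect s)
  | seq {c d : Cmd} {s s' s'' : State} {t t' : ℕ} (hc : Exec W c s t s') (hd : Exec W d s' t' s'') :
      Exec W (.seq c d) s (t + t') s''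
  | ite_le {a b : ℕ} {c d : Cmd} {s s' : State} {t : ℕ} (h : s.reg a ≤ s.reg b)
      (hc : Exec W c s t s') : Exec W (.ite a b c d) s (1 + t) s'
  | ite_gt {a b : ℕ} {c d : Cmd} {s s' : State} {t : ℕ} (h : ¬ s.reg a ≤ s.reg b)
      (hd : Exec W d s t s') : Exec W (.ite a b c d) s (1 + t + 1) s'
  | loop_done {a b : ℕ} {c : Cmd} {s : State} (h : ¬ s.reg a < s.reg b) :
      Exec W (.loop a b c) s 1 s
  | loop_go {a b : ℕ} {c : Cmd} {s s' s'' : State} {t t' : ℕ} (h : s.reg a < s.reg b)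
      (hc : Exec W c s t s') (hl : Exec W (.loop a b c) s' t' s'') :
      Exec W (.loop a b c) s (1 + t + 1 + t') s''

/-- The configuration with program counter `p` and state `s`. -/
def State.at (s : State) (p : ℕ) : Config := ⟨p, s.reg, s.mem⟩

/-- All numbers in registers and memory are at most `W`. -/
def Config.BoundedBy (W : ℕ) (c : Config) : Prop := (∀ i, c.reg i ≤ W) ∧ ∀ i, c.mem i ≤ W

/-- `P` leads from `x` to `y` in `t` steps, with all numbers at most `W`. -/
def Steps (P : Program) (W : ℕ) (x : Config) (t : ℕ) (y : Config) : Prop :=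
  (step P)^[t] x = y ∧ ∀ t' ≤ t, ((step P)^[t'] x).BoundedBy W

theorem Steps.bounded {P : Program} {W t : ℕ} {x y : Config} (h : Steps P W x t y) : y.BoundedBy W :=
  h.1 ▸ h.2 t le_rfl

theorem Steps.trans {P : Program} {W t t' : ℕ} {x y z : Config} (h : Steps P W x t y)
    (h' : Steps P W y t' z) : Steps P W x (t + t') z := by
  have key : ∀ k, (step P)^[t + k] x = (step P)^[k] y := fun k => by
    rw [add_comm, Function.iterate_add_apply, h.1]
  refine ⟨by rw [key, h'.1], fun k hk => ?_⟩
  rcases le_total k t with hkt | hkt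
  · exact h.2 k hkt
  · rw [← Nat.add_sub_cancel' hkt, key]
    exact h'.2 _ (by omega)

theorem Steps.one {P : Program} {W : ℕ} {x : Config} {i : Instr} (hx : x.BoundedBy W)
    (hP : P[x.pc]? = some i) (hy : (i.exec x).BoundedBy W) : Steps P W x 1 (i.exec x) := by
  have e : step P x = i.exec x := by simp [step, hP]
  refine ⟨e, fun k hk => ?_⟩
  interval_cases k
  · exact hx
  · simpa [e] using hy

/-- The program `P` contains `Q` at position `p`. -/
def Program.HasAt (P : Program) (p : ℕ) (Q : Program) : Prop := ∀ k < Q.length, P[p + k]? = Q[k]?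

theorem Program.HasAt.append {P Q R : Program} {p : ℕ} (h : Program.HasAt P p (Q ++ R)) :
    Program.HasAt P p Q ∧ Program.HasAt P (p + Q.length) R := by
  refine ⟨fun k hk => ?_, fun k hk => ?_⟩
  · rw [h k (by simp; omega), List.getElem?_append_left hk]
  · rw [add_assoc, h _ (by simp; omega), List.getElem?_append_right (by omega),
      Nat.add_sub_cancel_left]

theorem Program.HasAt.cons {P R : Program} {p : ℕ} {i : Instr} (h : Program.HasAt P p (i :: R)) :
    P[p]? = some i ∧ Program.HasAt P (p + 1) R := by
  refine ⟨by simpa using h 0 (by simp), fun k hk => ?_⟩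
  rw [add_assoc, add_comm 1, h _ (by simp; omega), List.getElem?_cons_succ]

theorem Instr.exec_eq {i : Instr} (hi : i.IsOp) (s : State) (p : ℕ) :
    i.exec (s.at p) = (i.effect s).at (p + 1) := by
  cases i <;> first | rfl | exact hi.elim

theorem Instr.effect_bounded {i : Instr} {s : State} {W p p' : ℕ} (hs : (s.at p).BoundedBy W)
    (hw : i.written s ≤ W) : ((i.effect s).at p').BoundedBy W := by
  have key : ∀ (f : ℕ → ℕ) (r x : ℕ), (∀ z, f z ≤ W) → x ≤ W → ∀ z, Function.update f r x z ≤ W := by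
    intro f r x hf hx z
    rw [Function.update_apply]
    split_ifs
    · exact hx
    · exact hf z
  cases i with
  | jumpLE a b l => exact hs
  | store a r => exact ⟨hs.1, key _ _ _ hs.2 hw⟩
  | _ => exact ⟨key _ _ _ hs.1 hw, hs.2⟩

theorem Steps.jump {P : Program} {W p a b l : ℕ} {s : State} (hs : (s.at p).BoundedBy W)
    (hP : P[p]? = some (.jumpLE a b l)) :
    Steps P W (s.at p) 1 (s.at (if s.reg a ≤ s.reg b then l else p + 1)) :=
  Steps.one hs hP hs

/-- The compiled program does what the command does. -/
theorem Exec.steps {W t : ℕ} {c : Cmd} {s s' : State} (h : Exec W c s t s') (P : Program) :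
    ∀ p, Program.HasAt P p (c.compile p) → (s.at p).BoundedBy W →
      Steps P W (s.at p) t (s'.at (p + c.size)) := by
  induction h with
  | op i s hi hw =>
    intro p hP hs
    have hP' := (Program.HasAt.cons hP).1
    rw [Cmd.size, ← Instr.exec_eq hi]
    refine Steps.one hs hP' ?_
    rw [Instr.exec_eq hi]
    exact Instr.effect_bounded hs hw
  | @seq c d _ _ _ _ _ _ _ ihc ihd =>
    intro p hP hs
    obtain ⟨h1, h2⟩ := Program.HasAt.append hP
    rw [Cmd.length_compile] at h2
    have hc := ihc p h1 hs
    have hd := ihd _ h2 hc.bounded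
    rw [Cmd.size, ← add_assoc]
    exact hc.trans hd
  | @ite_le a b c d s _ _ hab _ ihc =>
    intro p hP hs
    obtain ⟨h1, h2⟩ := Program.HasAt.cons hP
    obtain ⟨h3, h4⟩ := Program.HasAt.append h2
    obtain ⟨h5, h6⟩ := Program.HasAt.cons h4
    rw [Cmd.length_compile, show p + 1 + d.size + 1 = p + d.size + 2 by omega] at h6
    have hj := Steps.jump hs h1
    rw [if_pos hab] at hj
    have hc := ihc _ h6 hj.bounded
    rw [show p + d.size + 2 + c.size = p + (Cmd.ite a b c d).size by simp only [Cmd.size]; omega] at hc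
    exact hj.trans hc
  | @ite_gt a b c d s s' _ hab _ ihd =>
    intro p hP hs
    obtain ⟨h1, h2⟩ := Program.HasAt.cons hP
    obtain ⟨h3, h4⟩ := Program.HasAt.append h2
    obtain ⟨h5, h6⟩ := Program.HasAt.cons h4
    rw [Cmd.length_compile] at h5
    have hj := Steps.jump hs h1
    rw [if_neg hab] at hj
    have hd := ihd _ h3 hj.bounded
    have hj' := Steps.jump hd.bounded h5
    rw [if_pos le_rfl, show p + d.size + c.size + 2 = p + (Cmd.ite a b c d).size by
      simp only [Cmd.size]; omega] at hj'
    exact (hj.trans hd).trans hj'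
  | @loop_done a b c s hab =>
    intro p hP hs
    have hj := Steps.jump hs (Program.HasAt.cons hP).1
    rw [if_pos (by omega)] at hj
    exact hj
  | @loop_go a b c s s' s'' _ _ hab _ _ ihc ihl =>
    intro p hP hs
    obtain ⟨h1, h2⟩ := Program.HasAt.cons hP
    obtain ⟨h3, h4⟩ := Program.HasAt.append h2
    have h5 := (Program.HasAt.cons h4).1
    rw [Cmd.length_compile] at h5
    have hj := Steps.jump hs h1
    rw [if_neg (by omega)] at hj
    have hc := ihc _ h3 hj.bounded
    have hj' := Steps.jump hc.bounded h5
    rw [if_pos le_rfl] at hj'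
    exact ((hj.trans hc).trans hj').trans (ihl p hP hj'.bounded)

/-! ### Weakest preconditions -/

/-- `wp W c Q τ s`: with a budget of `τ` steps the command `c` runs from `s` to a state satisfying
`Q`, which is given the unused part of the budget; no number exceeding `W` is written. -/
def wp (W : ℕ) (c : Cmd) (Q : ℕ → State → Prop) (τ : ℕ) (s : State) : Prop :=
  ∃ t ≤ τ, ∃ s', Exec W c s t s' ∧ Q (τ - t) s'

/-- The initial values and all written values are at most `W`, so all configurations are bounded. -/
theorem wp.computesWithin {W τ o : ℕ} {c : Cmd} {input : List ℕ} (hin : ∀ x ∈ input, x ≤ W)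
    (h : wp W c (fun _ s => s.reg 0 = o) τ ⟨fun _ => 0, fun i => input.getD i 0⟩) :
    ComputesWithin (c.compile 0) input o τ W := by
  obtain ⟨t, ht, s', hex, hs'⟩ := h
  have hst := hex.steps (c.compile 0) 0 (fun k _ => by rw [zero_add]) ⟨fun _ => Nat.zero_le _, fun i => by
    simp only [State.at, List.getD_eq_getElem?_getD]
    cases hi : input[i]? with
    | none => exact Nat.zero_le _
    | some x => exact hin x (List.mem_of_getElem? hi)⟩
  have hrun : run (c.compile 0) input t = s'.at (0 + c.size) := hst.1
  refine ⟨t, ht, ?_, ?_, hst.2⟩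
  · rw [hrun, Halted, Cmd.length_compile]
    exact (zero_add _).ge
  · rw [hrun]
    exact hs'

theorem wp.mono {W τ τ' : ℕ} {c : Cmd} {s : State} {Q Q' : ℕ → State → Prop} (h : wp W c Q τ s)
    (hτ : τ ≤ τ') (hQ : ∀ σ s', Q σ s' → Q' (σ + (τ' - τ)) s') : wp W c Q' τ' s := by
  obtain ⟨t, ht, s', h1, h2⟩ := h
  refine ⟨t, by omega, s', h1, ?_⟩
  have := hQ _ _ h2
  rwa [show τ - t + (τ' - τ) = τ' - t by omega] at this

theorem wp_op {W τ : ℕ} {i : Instr} {s : State} {Q : ℕ → State → Prop} (hi : i.IsOp) :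
    wp W (.op i) Q τ s ↔ i.written s ≤ W ∧ 1 ≤ τ ∧ Q (τ - 1) (i.effect s) := by
  constructor
  · rintro ⟨t, ht, s', hex, hQ⟩
    cases hex with
    | op _ _ _ hw => exact ⟨hw, ht, hQ⟩
  · rintro ⟨hw, ht, hQ⟩
    exact ⟨1, ht, _, Exec.op i s hi hw, hQ⟩

theorem wp_const {W τ r k : ℕ} {s : State} {Q : ℕ → State → Prop} :
    wp W (.op (.const r k)) Q τ s ↔
      k ≤ W ∧ 1 ≤ τ ∧ Q (τ - 1) ⟨Function.update s.reg r k, s.mem⟩ :=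
  wp_op (i := .const r k) trivial

theorem wp_add {W τ r a b : ℕ} {s : State} {Q : ℕ → State → Prop} :
    wp W (.op (.add r a b)) Q τ s ↔
      s.reg a + s.reg b ≤ W ∧ 1 ≤ τ ∧ Q (τ - 1) ⟨Function.update s.reg r (s.reg a + s.reg b), s.mem⟩ :=
  wp_op (i := .add r a b) trivial

theorem wp_sub {W τ r a b : ℕ} {s : State} {Q : ℕ → State → Prop} :
    wp W (.op (.sub r a b)) Q τ s ↔
      s.reg a - s.reg b ≤ W ∧ 1 ≤ τ ∧ Q (τ - 1) ⟨Function.update s.reg r (s.reg a - s.reg b), s.mem⟩ :=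
  wp_op (i := .sub r a b) trivial

theorem wp_load {W τ r a : ℕ} {s : State} {Q : ℕ → State → Prop} :
    wp W (.op (.load r a)) Q τ s ↔
      s.mem (s.reg a) ≤ W ∧ 1 ≤ τ ∧ Q (τ - 1) ⟨Function.update s.reg r (s.mem (s.reg a)), s.mem⟩ :=
  wp_op (i := .load r a) trivial

theorem wp_store {W τ a r : ℕ} {s : State} {Q : ℕ → State → Prop} :
    wp W (.op (.store a r)) Q τ s ↔
      s.reg r ≤ W ∧ 1 ≤ τ ∧ Q (τ - 1) ⟨s.reg, Function.update s.mem (s.reg a) (s.reg r)⟩ :=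
  wp_op (i := .store a r) trivial

theorem wp_seq {W τ : ℕ} {c d : Cmd} {s : State} {Q : ℕ → State → Prop} :
    wp W (.seq c d) Q τ s ↔ wp W c (fun σ s' => wp W d Q σ s') τ s := by
  constructor
  · rintro ⟨t, ht, s', hex, hQ⟩
    cases hex with
    | @seq _ _ _ s1 _ t1 t2 hc hd =>
      exact ⟨t1, by omega, s1, hc, t2, by omega, s', hd, by rwa [Nat.sub_sub]⟩
  · rintro ⟨t, ht, s', h1, t', ht', s'', h2, h3⟩
    exact ⟨t + t', by omega, s'', h1.seq h2, by rwa [← Nat.sub_sub]⟩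

theorem wp_all_singleton {W τ : ℕ} {c : Cmd} {s : State} {Q : ℕ → State → Prop} :
    wp W (.all [c]) Q τ s ↔ wp W c Q τ s := Iff.rfl

theorem wp_all_cons {W τ : ℕ} {c d : Cmd} {cs : List Cmd} {s : State} {Q : ℕ → State → Prop} :
    wp W (.all (c :: d :: cs)) Q τ s ↔ wp W c (fun σ s' => wp W (.all (d :: cs)) Q σ s') τ s := wp_seq

theorem wp_ite {W τ a b : ℕ} {c d : Cmd} {s : State} {Q : ℕ → State → Prop} :
    wp W (.ite a b c d) Q τ s ↔
      if s.reg a ≤ s.reg b then 1 ≤ τ ∧ wp W c Q (τ - 1) s else 2 ≤ τ ∧ wp W d Q (τ - 2) s := by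
  split_ifs with h
  · constructor
    · rintro ⟨t, ht, s', hex, hQ⟩
      cases hex with
      | @ite_le _ _ _ _ _ _ t' _ hc =>
        exact ⟨by omega, t', by omega, s', hc, by rwa [Nat.sub_sub]⟩
      | ite_gt h' => exact absurd h h'
    · rintro ⟨h1, t, ht, s', q1, q2⟩
      exact ⟨1 + t, by omega, s', Exec.ite_le h q1, by rwa [← Nat.sub_sub]⟩
  · constructor
    · rintro ⟨t, ht, s', hex, hQ⟩
      cases hex with
      | ite_le h' => exact absurd h' h
      | @ite_gt _ _ _ _ _ _ t' _ hd =>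
        refine ⟨by omega, t', by omega, s', hd, ?_⟩
        rwa [show τ - 2 - t' = τ - (1 + t' + 1) by omega]
    · rintro ⟨h1, t, ht, s', q1, q2⟩
      refine ⟨1 + t + 1, by omega, s', Exec.ite_gt h q1, ?_⟩
      rwa [show τ - 2 - t = τ - (1 + t + 1) by omega] at q2

/-- The invariant may depend on the remaining budget, and the two jumps of each iteration lower it.
So the budget is also the termination measure. -/
theorem wp_loop {W a b : ℕ} {c : Cmd} {Q : ℕ → State → Prop} (I : ℕ → State → Prop)
    (hgo : ∀ τ s, I τ s → s.reg a < s.reg b → 2 ≤ τ ∧ wp W c I (τ - 2) s)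
    (hdone : ∀ τ s, I τ s → s.reg b ≤ s.reg a → 1 ≤ τ ∧ Q (τ - 1) s) :
    ∀ τ s, I τ s → wp W (.loop a b c) Q τ s := by
  intro τ
  induction τ using Nat.strong_induction_on with
  | _ τ ih =>
    intro s hI
    by_cases h : s.reg a < s.reg b
    · obtain ⟨h2, t, ht, s', q1, q2⟩ := hgo τ s hI h
      obtain ⟨t', ht', s'', q3, q4⟩ := ih _ (by omega) s' q2
      refine ⟨1 + t + 1 + t', by omega, s'', Exec.loop_go h q1 q3, ?_⟩
      rwa [show τ - 2 - t - t' = τ - (1 + t + 1 + t') by omega] at q4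
    · obtain ⟨h1, h2⟩ := hdone τ s hI (by omega)
      exact ⟨1, h1, s, Exec.loop_done h, h2⟩

/-- A loop over a counter, with a bound `k` for the time of each iteration. -/
theorem wp_for {W a b i hi k τ : ℕ} {c : Cmd} {s : State} {Q : ℕ → State → Prop}
    (I : ℕ → State → Prop) (hcnt : ∀ j s, I j s → s.reg a = j ∧ s.reg b = hi)
    (hgo : ∀ j s, I j s → i ≤ j → j < hi → wp W c (fun _ s' => I (j + 1) s') k s)
    (hs : I i s) (hle : i ≤ hi) (hτ : (hi - i) * (k + 2) + 1 ≤ τ)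
    (hQ : ∀ σ s', I hi s' → τ ≤ σ + ((hi - i) * (k + 2) + 1) → Q σ s') :
    wp W (.loop a b c) Q τ s := by
  -- The two inequalities say that the budget suffices for the remaining iterations and that the
  -- finished ones have not used more than their share.
  refine wp_loop (fun σ s' => ∃ j, I j s' ∧ i ≤ j ∧ j ≤ hi ∧
    (hi - j) * (k + 2) + 1 ≤ σ ∧ τ + ((hi - j) * (k + 2) + 1) ≤ σ + ((hi - i) * (k + 2) + 1)) ?_ ?_ τ s
    ⟨i, hs, le_rfl, hle, hτ, le_rfl⟩
  · rintro σ s' ⟨j, hj, hij, hjh, h1, h2⟩ hlt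
    obtain ⟨e1, e2⟩ := hcnt j s' hj
    obtain ⟨m, hm⟩ : ∃ m, hi - j = m + 1 := ⟨hi - j - 1, by omega⟩
    rw [hm, add_mul] at h1 h2
    refine ⟨by omega, (hgo j s' hj hij (by omega)).mono (by omega) fun ρ s'' hs'' =>
      ⟨j + 1, hs'', by omega, by omega, ?_, ?_⟩⟩
    all_goals
      rw [show hi - (j + 1) = m by omega]
      omega
  · rintro σ s' ⟨j, hj, hij, hjh, h1, h2⟩ hle'
    obtain ⟨e1, e2⟩ := hcnt j s' hj
    obtain rfl : j = hi := by omega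
    rw [Nat.sub_self, Nat.zero_mul] at h1 h2
    exact ⟨by omega, hQ _ _ hj (by omega)⟩

end RAM

namespace UnitAcquisition

/-! ### Sums over neighbours, computed from an edge list -/

/-- The sum of `f` over the neighbours of `x`, as read off a list of edges. -/
def tally (f : ℕ → ℕ) (es : List (ℕ × ℕ)) (x : ℕ) : ℕ :=
  (es.map fun e => (if e.1 = x then f e.2 else 0) + if e.2 = x then f e.1 else 0).sum

theorem tally_append (f : ℕ → ℕ) (es es' : List (ℕ × ℕ)) (x : ℕ) :
    tally f (es ++ es') x = tally f es x + tally f es' x := by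
  simp [tally]

theorem tally_take_le (f : ℕ → ℕ) (es : List (ℕ × ℕ)) (k x : ℕ) :
    tally f (es.take k) x ≤ tally f es x := by
  conv_rhs => rw [← List.take_append_drop k es, tally_append]
  exact Nat.le_add_right _ _

theorem tally_take_succ (f : ℕ → ℕ) {es : List (ℕ × ℕ)} {k a b : ℕ} (h : es[k]? = some (a, b)) (x : ℕ) :
    tally f (es.take (k + 1)) x =
      tally f (es.take k) x + (if a = x then f b else 0) + if b = x then f a else 0 := by
  rw [List.take_add_one, h, tally_append]
  simp [tally, add_assoc]

/-- The nested updates have the shape of the successive stores in the loop bodies. -/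
theorem tally_take_succ_eq_update (f : ℕ → ℕ) {es : List (ℕ × ℕ)} {k a b : ℕ} (h : es[k]? = some (a, b)) :
    tally f (es.take (k + 1)) =
      Function.update (Function.update (tally f (es.take k)) a (tally f (es.take k) a + f b)) b
        (Function.update (tally f (es.take k)) a (tally f (es.take k) a + f b) b + f a) := by
  funext x
  rw [tally_take_succ f h]
  by_cases hb : x = b
  · subst hb
    by_cases ha : x = a
    · subst ha; simp
    · simp [Function.update_of_ne ha, Ne.symm ha]
  · rw [Function.update_of_ne hb]
    by_cases ha : x = a
    · subst ha; simp [Ne.symm hb]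
    · simp [Function.update_of_ne ha, Ne.symm ha, Ne.symm hb]

/-- An edge list with numbers as vertices. -/
def natEdges {n : ℕ} (es : List (Fin n × Fin n)) : List (ℕ × ℕ) :=
  es.map fun e => ((e.1 : ℕ), (e.2 : ℕ))

open Classical in
-- The contribution of an edge is symmetric in its ends and thus a function on `Sym2`. Without
-- repetitions in the list, the sum runs over the edges at `x`, and these correspond to the
-- neighbours of `x`.
theorem IsEdgeList.tally_eq {n : ℕ} {G : SimpleGraph (Fin n)} {es : List (Fin n × Fin n)}
    (h : IsEdgeList G es) (f : ℕ → ℕ) (x : Fin n) :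
    tally f (natEdges es) x = ∑ y ∈ Finset.univ.filter (fun y => G.Adj x y), f y := by
  obtain ⟨hnd, hmem⟩ := h
  obtain ⟨Φ, hΦ⟩ : ∃ Φ : Sym2 (Fin n) → ℕ, ∀ a b : Fin n,
      Φ s(a, b) = (if a = x then f b else 0) + if b = x then f a else 0 :=
    ⟨Sym2.lift ⟨fun a b => (if a = x then f b else 0) + if b = x then f a else 0,
      fun a b => add_comm _ _⟩, fun a b => rfl⟩
  have h1 : tally f (natEdges es) x = ((es.map fun e => s(e.1, e.2)).map Φ).sum := by
    simp [tally, natEdges, hΦ, Function.comp_def, Fin.ext_iff]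
  have h2 : ((es.map fun e => s(e.1, e.2)).map Φ).sum =
      ∑ e ∈ (es.map fun e => s(e.1, e.2)).toFinset, Φ e :=
    (List.sum_toFinset Φ hnd).symm
  rw [h1, h2]
  symm
  calc ∑ y ∈ Finset.univ.filter (fun y => G.Adj x y), f y
      = ∑ y ∈ Finset.univ.filter (fun y => G.Adj x y), Φ s(x, y) := by
        refine Finset.sum_congr rfl fun y hy => ?_
        have hy' : y ≠ x := (Finset.mem_filter.mp hy).2.ne'
        simp [hΦ, hy']
    _ = ∑ e ∈ (Finset.univ.filter (fun y => G.Adj x y)).image (fun y => s(x, y)), Φ e := by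
        rw [Finset.sum_image]
        intro y _ z _ hyz
        rcases Sym2.eq_iff.mp hyz with ⟨-, h⟩ | ⟨h, h'⟩
        · exact h
        · exact h'.trans h
    _ = _ := by
        refine Finset.sum_subset (fun e he => ?_) fun e he hne => ?_
        · obtain ⟨y, hy, rfl⟩ := Finset.mem_image.mp he
          rw [List.mem_toFinset, hmem]
          exact (Finset.mem_filter.mp hy).2
        · rw [List.mem_toFinset, hmem] at he
          induction e with
          | _ a b =>
            rw [SimpleGraph.mem_edgeSet] at he
            have ha : a ≠ x := by
              rintro rfl
              exact hne (Finset.mem_image.mpr ⟨b, by simpa using he, rfl⟩)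
            have hb : b ≠ x := by
              rintro rfl
              exact hne (Finset.mem_image.mpr ⟨a, by simpa using he.symm, Sym2.eq_swap⟩)
            rw [hΦ, if_neg ha, if_neg hb, add_zero]

theorem IsEdgeList.length_add_one {n : ℕ} {G : SimpleGraph (Fin n)} {es : List (Fin n × Fin n)}
    (h : IsEdgeList G es) (hG : G.IsTree) : es.length + 1 = n := by
  classical
  have h1 := hG.card_edgeFinset
  rw [Fintype.card_fin] at h1
  refine Eq.trans ?_ h1
  rw [← List.length_map (f := fun e : Fin n × Fin n => s(e.1, e.2)),
    ← List.toFinset_card_of_nodup h.1]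
  congr 2
  ext e
  rw [List.mem_toFinset, h.2, SimpleGraph.mem_edgeFinset]

/-! ### Quantities that the algorithm computes -/

/-- The degree. -/
def degree (es : List (ℕ × ℕ)) : ℕ → ℕ := tally (fun _ => 1) es

/-- The number of neighbours that are leaves. -/
def leafDegree (es : List (ℕ × ℕ)) : ℕ → ℕ := tally (fun y => if degree es y ≤ 1 then 1 else 0) es

/-- The sum of the neighbours that are not leaves. -/
def spineSum (es : List (ℕ × ℕ)) : ℕ → ℕ := tally (fun y => if degree es y ≤ 1 then 0 else y) es

section

variable {n N : ℕ} {G : SimpleGraph (Fin n)} {v : ℕ → Fin n}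

/-- The program may find either end of the spine first. The reversed row is a spine as well, so its
greedy partition yields the same number. -/
theorem IsSpine.reverse (hS : IsSpine G N v) : IsSpine G N fun i => v (N - 1 - i) := by
  have hN := hS.pos
  refine ⟨hN, fun i hi j hj h => ?_, fun i hi j hj => ?_, fun x hx => ?_, fun i hi => ?_⟩
  · have := hS.inj _ (by omega) _ (by omega) h
    omega
  · rw [hS.adj _ (by omega) _ (by omega)]
    unfold Consec
    omega
  · obtain ⟨i, hi, h⟩ := hS.leaf x fun i hi => by
      have := hx (N - 1 - i) (by omega)
      rwa [show N - 1 - (N - 1 - i) = i by omega] at this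
    refine ⟨N - 1 - i, by omega, ?_⟩
    rwa [show N - 1 - (N - 1 - i) = i by omega]
  · exact hS.nonleaf _ (by omega)

theorem sum_range_consec (g : ℕ → ℕ) {i N : ℕ} (hi : i < N) :
    (∑ j ∈ Finset.range N, if j = i + 1 ∨ i = j + 1 then g j else 0) =
      (if 0 < i then g (i - 1) else 0) + if i + 1 < N then g (i + 1) else 0 := by
  have h1 : ∀ j, (if j = i + 1 ∨ i = j + 1 then g j else 0) =
      (if j = i - 1 then (if 0 < i then g j else 0) else 0) + if j = i + 1 then g j else 0 := by
    intro j
    split_ifs <;> omega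
  rw [Finset.sum_congr rfl fun j _ => h1 j, Finset.sum_add_distrib, Finset.sum_ite_eq',
    Finset.sum_ite_eq', if_pos (Finset.mem_range.mpr (by omega))]
  simp only [Finset.mem_range]

open Classical in
theorem IsSpine.sum_neighbors (hS : IsSpine G N v) (f : ℕ → ℕ) {i : ℕ} (hi : i < N) :
    ∑ y ∈ Finset.univ.filter (fun y => G.Adj (v i) y), f y =
      ∑ y ∈ liveLeaves G N v (fun _ => 1) i, f y +
        ((if 0 < i then f (v (i - 1)) else 0) + if i + 1 < N then f (v (i + 1)) else 0) := by
  have hsplit : Finset.univ.filter (fun y => G.Adj (v i) y) = liveLeaves G N v (fun _ => 1) i ∪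
      ((Finset.range N).filter fun j => j = i + 1 ∨ i = j + 1).image v := by
    ext y
    simp only [Finset.mem_filter, Finset.mem_univ, true_and, Finset.mem_union, Finset.mem_image,
      Finset.mem_range, mem_liveLeaves]
    constructor
    · intro hy
      by_cases hsp : ∃ j < N, v j = y
      · obtain ⟨j, hj, rfl⟩ := hsp
        exact Or.inr ⟨j, ⟨hj, (hS.adj i hi j hj).mp hy⟩, rfl⟩
      · push Not at hsp
        exact Or.inl ⟨hi, hsp, hy.symm, one_pos⟩
    · rintro (⟨_, _, h, _⟩ | ⟨j, ⟨hj, h⟩, rfl⟩)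
      · exact h.symm
      · exact (hS.adj i hi j hj).mpr h
  rw [hsplit, Finset.sum_union, Finset.sum_image, Finset.sum_filter,
    sum_range_consec (fun j => f (v j)) hi]
  · intro j hj k hk h
    simp only [Finset.coe_filter, Finset.mem_range, Set.mem_ofPred_eq] at hj hk
    exact hS.inj j hj.1 k hk.1 h
  · rw [Finset.disjoint_left]
    intro x hx hx'
    obtain ⟨j, hj, rfl⟩ := Finset.mem_image.mp hx'
    exact (mem_liveLeaves.mp hx).2.1 j (Finset.mem_range.mp (Finset.mem_filter.mp hj).1) rfl

theorem IsSpine.card_add_sum_leafCount (hS : IsSpine G N v) :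
    N + ∑ i ∈ Finset.range N, leafCount G N v i = n := by
  classical
  have := hS.card_positive fun _ => 1
  rw [survivors, spineState_one, Finset.sum_add_distrib] at this
  simp only [zero_lt_one, Finset.filter_true, Finset.card_univ, Fintype.card_fin] at this
  refine Eq.trans ?_ this.symm
  congr 1
  rw [Finset.sum_congr rfl (g := fun _ => 1) fun i hi => by simp [Finset.mem_range.mp hi]]
  simp

variable {es : List (Fin n × Fin n)}

theorem IsSpine.degree_leaf (hS : IsSpine G N v) (hes : IsEdgeList G es) {x : Fin n}
    (hx : ∀ i < N, v i ≠ x) : ∃ i < N, ∀ f, tally f (natEdges es) x = f (v i) := by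
  classical
  obtain ⟨i, hi, h⟩ := hS.leaf x hx
  refine ⟨i, hi, fun f => ?_⟩
  rw [hes.tally_eq, Finset.sum_congr (s₂ := {v i}) (by ext y; simp [h]) fun _ _ => rfl,
    Finset.sum_singleton]

theorem IsSpine.two_le_degree_iff (hS : IsSpine G N v) (hes : IsEdgeList G es) (x : Fin n) :
    2 ≤ degree (natEdges es) x ↔ ∃ i < N, v i = x := by
  classical
  constructor
  · intro h
    by_contra hcon
    push Not at hcon
    obtain ⟨i, _, hf⟩ := hS.degree_leaf hes hcon
    rw [degree, hf] at h
    omega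
  · rintro ⟨i, hi, rfl⟩
    obtain ⟨y, z, hy, hz, hyz⟩ := hS.nonleaf i hi
    rw [degree, hes.tally_eq, ← Finset.card_eq_sum_ones]
    exact Finset.one_lt_card.mpr ⟨y, by simpa using hy, z, by simpa using hz, hyz⟩

/-- With `f` for leaves and `g` for spine neighbours, suitable constants and the identity give the
degree, the leaf degree and the sum of the spine neighbours. -/
theorem IsSpine.tally_spine (hS : IsSpine G N v) (hes : IsEdgeList G es) (f g : ℕ → ℕ) {i : ℕ}
    (hi : i < N) : tally (fun y => if degree (natEdges es) y ≤ 1 then f y else g y) (natEdges es) (v i) =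
      ∑ y ∈ liveLeaves G N v (fun _ => 1) i, f y +
        ((if 0 < i then g (v (i - 1)) else 0) + if i + 1 < N then g (v (i + 1)) else 0) := by
  classical
  have hsp : ∀ j < N, ¬ degree (natEdges es) (v j) ≤ 1 := fun j hj h => by
    have := (hS.two_le_degree_iff hes (v j)).mpr ⟨j, hj, rfl⟩
    omega
  rw [hes.tally_eq, hS.sum_neighbors (fun y => if degree (natEdges es) y ≤ 1 then f y else g y) hi]
  congr 1
  · refine Finset.sum_congr rfl fun y hy => if_pos ?_
    by_contra hcon
    obtain ⟨j, hj, h⟩ := (hS.two_le_degree_iff hes y).mp (by omega)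
    exact (mem_liveLeaves.mp hy).2.1 j hj h
  · congr 1
    · split_ifs with h0 h1
      · exact absurd h1 (hsp _ (by omega))
      · rfl
      · rfl
    · split_ifs with h0 h1
      · exact absurd h1 (hsp _ (by omega))
      · rfl
      · rfl

end

/-- What the algorithm uses about the edge list `es` of a caterpillar on `n` vertices with spine
`v 0, …, v (N - 1)` and with `l i` leaves at `v i`. -/
structure SpineData (n : ℕ) (es : List (ℕ × ℕ)) (N : ℕ) (v l : ℕ → ℕ) : Prop where
  pos : 0 < N
  lt : ∀ i < N, v i < n
  inj : ∀ i < N, ∀ j < N, v i = v j → i = j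
  degree : ∀ x < n, (2 ≤ degree es x ↔ ∃ i < N, v i = x)
  leafDegree : ∀ i < N, leafDegree es (v i) = l i
  spineSum : ∀ i < N, spineSum es (v i) =
    (if 0 < i then v (i - 1) else 0) + if i + 1 < N then v (i + 1) else 0
  end_iff : ∀ i < N, (UnitAcquisition.degree es (v i) ≤ l i + 1 ↔ i = 0 ∨ i + 1 = N)
  spineSum_le : ∀ x < n, UnitAcquisition.spineSum es x ≤ 2 * n
  leaf_eq_zero : ∀ i, N ≤ i → l i = 0
  leaf_last : 0 < l (N - 1)
  sum_leaf : N + ∑ i ∈ Finset.range N, l i = n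

theorem IsSpine.spineData {n N : ℕ} {G : SimpleGraph (Fin n)} {v : ℕ → Fin n}
    {es : List (Fin n × Fin n)} (hS : IsSpine G N v) (hes : IsEdgeList G es) :
    SpineData n (natEdges es) N (fun i => v i) (leafCount G N v) := by
  have hN := hS.pos
  have hsum : ∀ i < N, spineSum (natEdges es) (v i) =
      (if 0 < i then (v (i - 1) : ℕ) else 0) + if i + 1 < N then (v (i + 1) : ℕ) else 0 := by
    intro i hi
    rw [spineSum, hS.tally_spine hes (fun _ => 0) (fun y => y) hi]
    simp
  refine ⟨hN, fun i _ => (v i).2, fun i hi j hj h => hS.inj i hi j hj (Fin.ext h), fun x hx => ?_,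
    fun i hi => ?_, hsum, fun i hi => ?_, fun x hx => ?_, fun i hi => leafCount_eq_zero hi, ?_,
    hS.card_add_sum_leafCount⟩
  · rw [hS.two_le_degree_iff hes ⟨x, hx⟩]
    simp [Fin.ext_iff]
  · rw [leafDegree, hS.tally_spine hes (fun _ => 1) (fun _ => 0) hi]
    simp [leafCount]
  -- The degree is the number of leaves plus the number of spine neighbours, and the latter is at
  -- most one exactly at the ends.
  · have := hS.tally_spine hes (fun _ => 1) (fun _ => 1) hi
    simp only [ite_self] at this
    simp only [degree, this, leafCount, Finset.sum_const, smul_eq_mul, mul_one]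
    split_ifs <;> omega
  · by_cases hsp : ∃ i < N, v i = ⟨x, hx⟩
    · obtain ⟨i, hi, h⟩ := hsp
      have e : x = v i := by rw [h]
      rw [e, hsum i hi]
      have h1 := (v (i - 1)).2
      have h2 := (v (i + 1)).2
      split_ifs <;> omega
    · push Not at hsp
      obtain ⟨i, _, hf⟩ := hS.degree_leaf hes hsp
      have h1 := (v i).2
      have := hf fun y => if degree (natEdges es) y ≤ 1 then 0 else y
      simp only at this
      rw [spineSum, this]
      split_ifs <;> omega
  · refine hS.leafCount_pos (by omega) ?_
    rintro j j' hj hj' (h | h) (h' | h') <;> omega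

theorem tally_le (f : ℕ → ℕ) (hf : ∀ y, f y ≤ 1) (es : List (ℕ × ℕ)) (x : ℕ) :
    tally f es x ≤ 2 * es.length := by
  induction es with
  | nil => simp [tally]
  | cons e es ih =>
    have h1 := hf e.1
    have h2 := hf e.2
    simp only [tally, List.map_cons, List.sum_cons, List.length_cons] at ih ⊢
    split_ifs <;> omega

end UnitAcquisition

namespace UnitAcquisition

open RAM RAM.Instr RAM.Cmd

/-! ### The program: memory layout -/

/-- The memory during the computation: the input, followed by four arrays. -/
def layout (n : ℕ) (inp D F S L : ℕ → ℕ) (a : ℕ) : ℕ :=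
  if a < 2 * n then inp a else if a < 3 * n then D (a - 2 * n) else
    if a < 4 * n then F (a - 3 * n) else if a < 5 * n then S (a - 4 * n) else L (a - 5 * n)

section layout

variable {n x y : ℕ} {inp D F S L : ℕ → ℕ}

theorem layout_input (hx : x < 2 * n) : layout n inp D F S L x = inp x := if_pos hx

theorem layout_degree (hx : x < n) : layout n inp D F S L (2 * n + x) = D x := by
  unfold layout
  rw [if_neg (by omega), if_pos (by omega), Nat.add_sub_cancel_left]

theorem layout_leafDegree (hx : x < n) : layout n inp D F S L (3 * n + x) = F x := by
  unfold layout
  rw [if_neg (by omega), if_neg (by omega), if_pos (by omega), Nat.add_sub_cancel_left]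

theorem layout_spineSum (hx : x < n) : layout n inp D F S L (4 * n + x) = S x := by
  unfold layout
  rw [if_neg (by omega), if_neg (by omega), if_neg (by omega), if_pos (by omega),
    Nat.add_sub_cancel_left]

theorem layout_leaves : layout n inp D F S L (5 * n + x) = L x := by
  unfold layout
  rw [if_neg (by omega), if_neg (by omega), if_neg (by omega), if_neg (by omega),
    Nat.add_sub_cancel_left]

theorem update_layout_degree (hx : x < n) : Function.update (layout n inp D F S L) (2 * n + x) y =
    layout n inp (Function.update D x y) F S L := by
  funext a
  simp only [Function.update_apply, layout]
  split_ifs <;> first | rfl | omega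

theorem update_layout_leafDegree (hx : x < n) :
    Function.update (layout n inp D F S L) (3 * n + x) y =
      layout n inp D (Function.update F x y) S L := by
  funext a
  simp only [Function.update_apply, layout]
  split_ifs <;> first | rfl | omega

theorem update_layout_spineSum (hx : x < n) :
    Function.update (layout n inp D F S L) (4 * n + x) y =
      layout n inp D F (Function.update S x y) L := by
  funext a
  simp only [Function.update_apply, layout]
  split_ifs <;> first | rfl | omega

theorem update_layout_leaves : Function.update (layout n inp D F S L) (5 * n + x) y =
      layout n inp D F S (Function.update L x y) := by
  funext a
  simp only [Function.update_apply, layout]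
  split_ifs <;> first | rfl | omega

end layout

/-- The registers that hold the constants `0`, `1`, the number of vertices, and the addresses
of the four arrays. -/
def Constants (n : ℕ) (r : ℕ → ℕ) : Prop :=
  r 1 = 1 ∧ r 2 = n ∧ r 3 = 2 * n ∧ r 4 = 3 * n ∧ r 5 = 4 * n ∧ r 6 = 5 * n ∧ r 30 = 0

/-- The input is the graph with `n` vertices and the edge list `es`. -/
structure IsInput (n : ℕ) (es : List (ℕ × ℕ)) (inp : ℕ → ℕ) : Prop where
  zero : inp 0 = n
  one : inp 1 = es.length
  fst : ∀ j a b : ℕ, es[j]? = some (a, b) → inp (2 * j + 2) = a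
  snd : ∀ j a b : ℕ, es[j]? = some (a, b) → inp (2 * j + 3) = b
  lt : ∀ j a b : ℕ, es[j]? = some (a, b) → a < n ∧ b < n
  length : es.length + 1 = n

/-! ### The program: degrees -/

/-- Computes the degrees. -/
def degreePass : Cmd := .all
  [.op (const 7 0), .op (const 16 2),
    .loop 7 8 (.all
      [.op (load 9 16), .op (add 16 16 1), .op (load 10 16), .op (add 16 16 1),
        .op (add 11 3 9), .op (load 12 11), .op (add 12 12 1), .op (store 11 12),
        .op (add 11 3 10), .op (load 12 11), .op (add 12 12 1), .op (store 11 12),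
        .op (add 7 7 1)])]

theorem wp_degreePass {n W τ : ℕ} {es : List (ℕ × ℕ)} {inp : ℕ → ℕ} (hin : IsInput n es inp)
    (hW : 20 * n ≤ W) {Q : ℕ → State → Prop} {r : ℕ → ℕ} (hr : Constants n r) (h8 : r 8 = es.length)
    (hτ : n * 20 ≤ τ)
    (hQ : ∀ σ r', τ ≤ σ + n * 20 → Constants n r' → r' 8 = es.length →
      Q σ ⟨r', layout n inp (degree es) 0 0 0⟩) :
    wp W degreePass Q τ ⟨r, layout n inp 0 0 0 0⟩ := by
  have hlen := hin.length
  have hm : ∀ k x, tally (fun _ => 1) (es.take k) x ≤ 2 * n := fun k x => by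
    have h1 := tally_le (fun _ => 1) (fun _ => le_rfl) es x
    have h2 := tally_take_le (fun _ => 1) es k x
    omega
  obtain ⟨c1, c2, c3, c4, c5, c6, c30⟩ := hr
  simp only [degreePass, wp_all_cons, wp_all_singleton, wp_const]
  refine ⟨by omega, by omega, by omega, by omega, ?_⟩
  refine wp_for (i := 0) (hi := es.length) (k := 13) (fun j s => Constants n s.reg ∧ s.reg 7 = j ∧
    s.reg 8 = es.length ∧ s.reg 16 = 2 * j + 2 ∧
    s.mem = layout n inp (tally (fun _ => 1) (es.take j)) 0 0 0)
    (fun j s hI => ⟨hI.2.1, hI.2.2.1⟩) ?_ ?_ (Nat.zero_le _) (by omega) ?_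
  · rintro j ⟨r, m⟩ ⟨⟨c1, c2, c3, c4, c5, c6, c30⟩, h7, h8, h16, hmem⟩ - hj
    simp only at *
    subst hmem
    obtain ⟨a, b, hab⟩ : ∃ a b, es[j]? = some (a, b) := ⟨_, _, List.getElem?_eq_getElem hj⟩
    obtain ⟨ha, hb⟩ := hin.lt j a b hab
    have e1 : ∀ D, layout n inp D 0 0 0 (2 * j + 2) = a := fun D => by
      rw [layout_input (by omega), hin.fst j a b hab]
    have e2 : ∀ D, layout n inp D 0 0 0 (2 * j + 3) = b := fun D => by
      rw [layout_input (by omega), hin.snd j a b hab]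
    have m1 := hm (j + 1)
    rw [tally_take_succ_eq_update _ hab] at m1 ⊢
    have ma := m1 a
    have mb := m1 b
    have mc := hm j a
    simp [wp_all_cons, wp_all_singleton, wp_add, wp_load, wp_store, Constants,
      layout_degree ha, layout_degree hb, update_layout_degree ha, update_layout_degree hb,
      c1, c2, c3, c4, c5, c6, c30, h7, h8, h16, e1, e2] at ma mb mc ⊢
    omega
  · simp [Constants, c1, c2, c3, c4, c5, c6, c30, h8]
    rfl
  · rintro σ ⟨r', m⟩ ⟨hc, -, h8', -, hmem⟩ hσ
    simp only at *
    subst hmem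
    rw [List.take_length]
    exact hQ σ r' (by omega) hc h8'

end UnitAcquisition

namespace UnitAcquisition

open RAM RAM.Instr RAM.Cmd

/-! ### The program: leaf degrees and sums over spine neighbours -/

/-- Takes into account that the content of register `y` is a neighbour of the content of
register `x`. -/
def addNeighbor (x y : ℕ) : Cmd := .all
  [.op (add 11 3 y), .op (load 12 11),
    .ite 12 1
      (.all [.op (add 11 4 x), .op (load 12 11), .op (add 12 12 1), .op (store 11 12)])
      (.all [.op (add 11 5 x), .op (load 12 11), .op (add 12 12 y), .op (store 11 12)])]

/-- One of the increments `f` and `g` is zero, so a single store realises both updates. -/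
theorem wp_addNeighbor {n W τ x y a b f g : ℕ} {inp D F S : ℕ → ℕ} {r : ℕ → ℕ} (hr : Constants n r)
    (hW : 20 * n ≤ W) {Q : ℕ → State → Prop} (hx : x ≠ 11 ∧ x ≠ 12) (hy : y ≠ 11 ∧ y ≠ 12)
    (hxa : r x = a) (hyb : r y = b) (ha : a < n) (hb : b < n) (hf : f = if D b ≤ 1 then 1 else 0)
    (hg : g = if D b ≤ 1 then 0 else b) (hD : D b ≤ 2 * n) (hF : F a ≤ 2 * n) (hS : S a + g ≤ 2 * n)
    (hτ : 8 ≤ τ)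
    (hQ : ∀ σ r', τ ≤ σ + 8 → (∀ k, k ≠ 11 → k ≠ 12 → r' k = r k) →
      Q σ ⟨r', layout n inp D (Function.update F a (F a + f)) (Function.update S a (S a + g)) 0⟩) :
    wp W (addNeighbor x y) Q τ ⟨r, layout n inp D F S 0⟩ := by
  obtain ⟨c1, c2, c3, c4, c5, c6, c30⟩ := hr
  by_cases h : D b ≤ 1
  · rw [if_pos h] at hf hg
    subst hf hg
    simp only [add_zero, Function.update_eq_self] at hQ
    simp [addNeighbor, wp_all_cons, wp_all_singleton, wp_ite, wp_add, wp_load, wp_store,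
      layout_degree hb, layout_leafDegree ha, update_layout_leafDegree ha, c1, c3, c4, h, hx, hy, hxa, hyb]
    refine ⟨by omega, by omega, by omega, by omega, by omega, by omega, by omega, by omega, by omega,
      by omega, by omega, by omega, by omega, hQ _ _ (by omega) ?_⟩
    intro k h1 h2
    simp [h1, h2]
  · rw [if_neg h] at hf hg
    subst hf hg
    simp only [add_zero, Function.update_eq_self] at hQ
    simp [addNeighbor, wp_all_cons, wp_all_singleton, wp_ite, wp_add, wp_load, wp_store,
      layout_degree hb, layout_spineSum ha, update_layout_spineSum ha, c1, c3, c5, h, hx, hy, hxa, hyb]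
    refine ⟨by omega, by omega, by omega, by omega, by omega, by omega, by omega, by omega, by omega,
      by omega, by omega, by omega, by omega, hQ _ _ (by omega) ?_⟩
    intro k h1 h2
    simp [h1, h2]

theorem Constants.congr {n : ℕ} {r r' : ℕ → ℕ} (h : Constants n r)
    (hr : ∀ k, 1 ≤ k ∧ k ≤ 6 ∨ k = 30 → r' k = r k) : Constants n r' := by
  unfold Constants at *
  rw [hr 1 (by omega), hr 2 (by omega), hr 3 (by omega), hr 4 (by omega), hr 5 (by omega),
    hr 6 (by omega), hr 30 (by omega)]
  exact h

/-- Computes the leaf degrees and the sums over spine neighbours. -/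
def neighborPass : Cmd := .all
  [.op (const 7 0), .op (const 16 2),
    .loop 7 8 (.all
      [.op (load 9 16), .op (add 16 16 1), .op (load 10 16), .op (add 16 16 1),
        addNeighbor 9 10, addNeighbor 10 9, .op (add 7 7 1)])]

theorem wp_neighborPass {n W τ : ℕ} {es : List (ℕ × ℕ)} {inp : ℕ → ℕ} (hin : IsInput n es inp)
    (hW : 20 * n ≤ W) (hS : ∀ x < n, spineSum es x ≤ 2 * n) {Q : ℕ → State → Prop} {r : ℕ → ℕ}
    (hr : Constants n r) (h8 : r 8 = es.length) (hτ : n * 30 ≤ τ)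
    (hQ : ∀ σ r', τ ≤ σ + n * 30 → Constants n r' →
      Q σ ⟨r', layout n inp (degree es) (leafDegree es) (spineSum es) 0⟩) :
    wp W neighborPass Q τ ⟨r, layout n inp (degree es) 0 0 0⟩ := by
  have hlen := hin.length
  have hD : ∀ x, degree es x ≤ 2 * n := fun x => by
    have h1 := tally_le (fun _ => 1) (fun _ => le_rfl) es x
    unfold degree
    omega
  obtain ⟨f, hf⟩ : ∃ f : ℕ → ℕ, f = fun y => if degree es y ≤ 1 then 1 else 0 := ⟨_, rfl⟩
  obtain ⟨g, hg⟩ : ∃ g : ℕ → ℕ, g = fun y => if degree es y ≤ 1 then 0 else y := ⟨_, rfl⟩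
  have hfm : ∀ k x, tally f (es.take k) x ≤ 2 * n := fun k x => by
    have h1 := tally_le f (fun y => by rw [hf]; simp only; split_ifs <;> omega) es x
    have h2 := tally_take_le f es k x
    omega
  have hgm : ∀ k, ∀ x < n, tally g (es.take k) x ≤ 2 * n := fun k x hx => by
    have h1 := hS x hx
    have h2 := tally_take_le g es k x
    rw [spineSum, ← hg] at h1
    omega
  have hC := hr
  obtain ⟨c1, c2, c3, c4, c5, c6, c30⟩ := hr
  simp only [neighborPass, wp_all_cons, wp_all_singleton, wp_const]
  refine ⟨by omega, by omega, by omega, by omega, ?_⟩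
  refine wp_for (i := 0) (hi := es.length) (k := 21) (fun j s => Constants n s.reg ∧ s.reg 7 = j ∧
    s.reg 8 = es.length ∧ s.reg 16 = 2 * j + 2 ∧
    s.mem = layout n inp (degree es) (tally f (es.take j)) (tally g (es.take j)) 0)
    (fun j s hI => ⟨hI.2.1, hI.2.2.1⟩) ?_ ?_ (Nat.zero_le _) (by omega) ?_
  · rintro j ⟨r, m⟩ ⟨hC, h7, h8, h16, hmem⟩ - hj
    simp only at hC h7 h8 h16 hmem
    subst hmem
    obtain ⟨a, b, hab⟩ : ∃ a b, es[j]? = some (a, b) := ⟨_, _, List.getElem?_eq_getElem hj⟩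
    obtain ⟨ha, hb⟩ := hin.lt j a b hab
    have e1 : ∀ D F S, layout n inp D F S 0 (2 * j + 2) = a := fun D F S => by
      rw [layout_input (by omega), hin.fst j a b hab]
    have e2 : ∀ D F S, layout n inp D F S 0 (2 * j + 3) = b := fun D F S => by
      rw [layout_input (by omega), hin.snd j a b hab]
    have F2 := hfm (j + 1) b
    have S1 := hgm (j + 1) a ha
    have S2 := hgm (j + 1) b hb
    rw [tally_take_succ g hab] at S1
    rw [tally_take_succ_eq_update f hab, Function.update_self] at F2
    rw [tally_take_succ_eq_update g hab, Function.update_self] at S2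
    rw [tally_take_succ_eq_update f hab, tally_take_succ_eq_update g hab]
    have c1 := hC.1
    simp [wp_all_cons, wp_all_singleton, wp_add, wp_load, c1, h16, e1, e2]
    refine ⟨by omega, by omega, by omega, by omega, ?_⟩
    generalize hr0 : Function.update (Function.update (Function.update (Function.update r 9 a) 16
      (2 * j + 2 + 1)) 10 b) 16 (2 * j + 2 + 1 + 1) = r0
    have hr0' : ∀ k, k ≠ 9 → k ≠ 10 → k ≠ 16 → r0 k = r k := fun k h1 h2 h3 => by
      rw [← hr0]
      simp [h1, h2, h3]
    have hC0 : Constants n r0 := hC.congr fun k hk => hr0' k (by omega) (by omega) (by omega)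
    have r9 : r0 9 = a := by rw [← hr0]; simp
    have r10 : r0 10 = b := by rw [← hr0]; simp
    have r16 : r0 16 = 2 * j + 2 + 1 + 1 := by rw [← hr0]; simp
    refine wp_addNeighbor hC0 hW (by simp) (by simp) r9 r10 ha hb (congrFun hf b) (congrFun hg b) (hD b)
      (hfm j a) (by rw [if_pos rfl] at S1; omega) (by omega) fun σ r1 hσ hr1 => ?_
    have hC1 : Constants n r1 := hC0.congr fun k hk => hr1 k (by omega) (by omega)
    refine wp_addNeighbor hC1 hW (by simp) (by simp) ((hr1 10 (by simp) (by simp)).trans r10)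
      ((hr1 9 (by simp) (by simp)).trans r9) hb ha (congrFun hf a) (congrFun hg a) (hD a)
      (by omega) (by omega) (by omega) fun σ' r2 hσ' hr2 => ?_
    have e : ∀ k, k ≠ 9 → k ≠ 10 → k ≠ 16 → k ≠ 11 → k ≠ 12 → r2 k = r k := fun k h1 h2 h3 h4 h5 => by
      rw [hr2 k h4 h5, hr1 k h4 h5, hr0' k h1 h2 h3]
    have e7 := e 7 (by simp) (by simp) (by simp) (by simp) (by simp)
    have e1' := e 1 (by simp) (by simp) (by simp) (by simp) (by simp)

    simp only [e7, e1', h7, c1]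
    refine ⟨by omega, by omega, hC.congr fun k hk => ?_, by simp, ?_, ?_, trivial⟩
    · rw [Function.update_of_ne (by omega), e k (by omega) (by omega) (by omega) (by omega) (by omega)]
    · rw [e 8 (by omega) (by omega) (by omega) (by omega) (by omega), h8]
    · rw [hr2 16 (by omega) (by omega), hr1 16 (by omega) (by omega), r16]
      omega
  · simp [Constants, c1, c2, c3, c4, c5, c6, c30, h8]
    rfl
  · rintro σ ⟨r', m⟩ ⟨hc, -, h8', -, hmem⟩ hσ
    simp only at hc h8' hmem
    subst hmem
    rw [List.take_length, hf, hg]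
    exact hQ σ r' (by omega) hc

end UnitAcquisition

namespace UnitAcquisition

open RAM RAM.Instr RAM.Cmd

/-! ### The program: finding and walking along the spine -/

/-- Counts the spine vertices and finds one at an end of the spine. -/
def scanPass : Cmd := .all
  [.op (const 7 0), .op (const 13 0), .op (const 14 0),
    .loop 7 2 (.all
      [.op (add 11 3 7), .op (load 12 11),
        .ite 12 1 (.op (const 31 0)) (.all
          [.op (add 13 13 1), .op (add 11 4 7), .op (load 11 11), .op (add 11 11 1),
            .ite 12 11 (.op (add 14 7 30)) (.op (const 31 0))]),
        .op (add 7 7 1)])]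

set_option maxHeartbeats 1000000 in
-- An end of the spine is recognised locally: at least two neighbours, at most one of them not a
-- leaf.
theorem wp_scanPass {n W τ : ℕ} {inp D F S : ℕ → ℕ} (hW : 20 * n ≤ W) (hn : 1 ≤ n)
    (hD : ∀ x < n, D x ≤ 2 * n) (hF : ∀ x < n, F x ≤ 2 * n) {Q : ℕ → State → Prop} {r : ℕ → ℕ}
    (hr : Constants n r) (hτ : n * 30 ≤ τ)
    (hQ : ∀ σ r', τ ≤ σ + n * 30 → Constants n r' →
      r' 13 = ((Finset.range n).filter fun x => 2 ≤ D x).card →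
      ((∃ x < n, 2 ≤ D x ∧ D x ≤ F x + 1) → r' 14 < n ∧ 2 ≤ D (r' 14) ∧ D (r' 14) ≤ F (r' 14) + 1) →
      Q σ ⟨r', layout n inp D F S 0⟩) :
    wp W scanPass Q τ ⟨r, layout n inp D F S 0⟩ := by
  simp only [scanPass, wp_all_cons, wp_all_singleton, wp_const]
  refine ⟨by omega, by omega, by omega, by omega, by omega, by omega, ?_⟩
  refine wp_for (i := 0) (hi := n) (k := 20) (fun j s => Constants n s.reg ∧ s.reg 7 = j ∧
    s.reg 13 = ((Finset.range j).filter fun x => 2 ≤ D x).card ∧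
    ((∃ x < j, 2 ≤ D x ∧ D x ≤ F x + 1) →
      s.reg 14 < n ∧ 2 ≤ D (s.reg 14) ∧ D (s.reg 14) ≤ F (s.reg 14) + 1) ∧
    s.mem = layout n inp D F S 0)
    (fun j s hI => ⟨hI.2.1, hI.1.2.1⟩) ?_ ?_ (Nat.zero_le _) (by omega) ?_
  · rintro j ⟨r, m⟩ ⟨⟨c1, c2, c3, c4, c5, c6, c30⟩, h7, h13, h14, hmem⟩ - hj
    simp only at *
    subst hmem
    have hcard := Finset.card_filter_le (Finset.range j) fun x => 2 ≤ D x
    rw [Finset.card_range] at hcard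
    have hDj := hD j hj
    have hFj := hF j hj
    rw [Finset.range_add_one, Finset.filter_insert]
    have hex : (∃ x < j + 1, 2 ≤ D x ∧ D x ≤ F x + 1) →
        (∃ x < j, 2 ≤ D x ∧ D x ≤ F x + 1) ∨ (2 ≤ D j ∧ D j ≤ F j + 1) := by
      rintro ⟨x, hx, hx'⟩
      rcases Nat.lt_succ_iff_lt_or_eq.mp hx with h | rfl
      · exact Or.inl ⟨x, h, hx'⟩
      · exact Or.inr hx'
    by_cases h1 : D j ≤ 1
    · have h2 : ¬ 2 ≤ D j := by omega
      simp [wp_all_cons, wp_all_singleton, wp_ite, wp_const, wp_add, wp_load, Constants,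
        layout_degree hj, c1, c2, c3, c4, c5, c6, c30, h7, h1, h2, h13]
      exact ⟨by omega, by omega, by omega, fun x hx hx1 hx2 =>
        h14 ((hex ⟨x, by omega, hx1, hx2⟩).resolve_right fun h => h2 h.1)⟩
    · have h2 : 2 ≤ D j := by omega
      by_cases h3 : D j ≤ F j + 1
      · simp [wp_all_cons, wp_all_singleton, wp_ite, wp_const, wp_add, wp_load, Constants,
          layout_degree hj, layout_leafDegree hj, c1, c2, c3, c4, c5, c6, c30, h7, h1, h2, h3, h13, hj]
        omega
      · simp [wp_all_cons, wp_all_singleton, wp_ite, wp_const, wp_add, wp_load, Constants,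
          layout_degree hj, layout_leafDegree hj, c1, c2, c3, c4, c5, c6, c30, h7, h1, h2, h3, h13]
        exact ⟨by omega, by omega, by omega, by omega, by omega, by omega, by omega,
          fun x hx hx1 hx2 => h14 ((hex ⟨x, by omega, hx1, hx2⟩).resolve_right fun h => h3 h.2)⟩
  · obtain ⟨c1, c2, c3, c4, c5, c6, c30⟩ := hr
    simp [Constants, c1, c2, c3, c4, c5, c6, c30]
  · rintro σ ⟨r', m⟩ ⟨hc, -, h13, h14, hmem⟩ hσ
    simp only at hc h13 h14 hmem
    subst hmem
    exact hQ σ r' (by omega) hc h13 h14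

/-- Walks along the spine and writes down the numbers of leaves. -/
def walkPass : Cmd := .all
  [.op (const 7 0), .op (const 15 0),
    .loop 7 13 (.all
      [.op (add 11 4 14), .op (load 12 11), .op (add 11 6 7), .op (store 11 12),
        .op (add 11 5 14), .op (load 12 11), .op (sub 12 12 15), .op (add 15 14 30),
        .op (add 14 12 30), .op (add 7 7 1)])]

/-- The sum of the two spine neighbours minus the previous vertex is the next vertex. A missing
neighbour contributes zero, so the walk starts with previous value zero; it is stopped by the count
`N`, so a spine vertex numbered zero causes no confusion. -/
theorem wp_walkPass {n N W τ : ℕ} {inp D F S v l : ℕ → ℕ} (hW : 20 * n ≤ W)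
    (hv : ∀ i < N, v i < n) (hF : ∀ i < N, F (v i) = l i)
    (hS : ∀ i < N, S (v i) = (if 0 < i then v (i - 1) else 0) + if i + 1 < N then v (i + 1) else 0)
    (hNn : N ≤ n) (hl : ∀ i, l i ≤ n) (hl0 : ∀ i, N ≤ i → l i = 0) (hN : 0 < N)
    {Q : ℕ → State → Prop} {r : ℕ → ℕ}
    (hr : Constants n r) (h13 : r 13 = N) (h14 : r 14 = v 0) (hτ : n * 30 ≤ τ)
    (hQ : ∀ σ r', τ ≤ σ + n * 30 → Constants n r' → r' 13 = N →
      Q σ ⟨r', layout n inp D F S l⟩) :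
    wp W walkPass Q τ ⟨r, layout n inp D F S 0⟩ := by
  simp only [walkPass, wp_all_cons, wp_all_singleton, wp_const]
  refine ⟨by omega, by omega, by omega, by omega, ?_⟩
  refine wp_for (i := 0) (hi := N) (k := 20) (fun j s => Constants n s.reg ∧ s.reg 7 = j ∧
    s.reg 13 = N ∧ s.reg 14 = (if j < N then v j else 0) ∧
    s.reg 15 = (if 0 < j then v (j - 1) else 0) ∧
    s.mem = layout n inp D F S fun i => if i < j then l i else 0)
    (fun j s hI => ⟨hI.2.1, hI.2.2.1⟩) ?_ ?_ (Nat.zero_le _) (by omega) ?_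
  · rintro j ⟨r, m⟩ ⟨⟨c1, c2, c3, c4, c5, c6, c30⟩, h7, h13, h14, h15, hmem⟩ - hj
    simp only at *
    subst hmem
    rw [if_pos hj] at h14
    have hvj := hv j hj
    have hFj := hF j hj
    have hSj := hS j hj
    have hlj := hl j
    obtain ⟨x, hx⟩ : ∃ x, x = if 0 < j then v (j - 1) else 0 := ⟨_, rfl⟩
    obtain ⟨y, hy⟩ : ∃ y, y = if j + 1 < N then v (j + 1) else 0 := ⟨_, rfl⟩
    rw [← hx, ← hy] at hSj
    rw [← hx] at h15
    have hxn : x ≤ n := by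
      have := hv (j - 1) (by omega)
      split_ifs at hx <;> omega
    have hyn : y ≤ n := by
      by_cases h : j + 1 < N
      · have := hv (j + 1) h
        rw [if_pos h] at hy
        omega
      · rw [if_neg h] at hy
        omega
    have hupd : Function.update (fun i => if i < j then l i else 0) j (l j) =
        fun i => if i < j + 1 then l i else 0 := by
      funext i
      by_cases h : i = j
      · subst h; simp
      · rw [Function.update_of_ne h]
        split_ifs <;> omega
    simp [wp_all_cons, wp_all_singleton, wp_add, wp_sub, wp_load, wp_store, Constants,
      layout_leafDegree hvj, layout_spineSum hvj, update_layout_leaves, c1, c2, c3, c4, c5, c6, c30,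
      h7, h13, h14, h15, hFj, hSj, hupd, ← hy]
    omega
  · obtain ⟨c1, c2, c3, c4, c5, c6, c30⟩ := hr
    simp [Constants, c1, c2, c3, c4, c5, c6, c30, h13, h14, hN]
    rfl
  · rintro σ ⟨r', m⟩ ⟨hc, -, h13', -, -, hmem⟩ hσ
    simp only at hc h13' hmem
    have e : (fun i => if i < N then l i else 0) = l := by
      funext i
      split_ifs with h
      · rfl
      · exact (hl0 i (by omega)).symm
    rw [e] at hmem
    subst hmem
    exact hQ σ r' (by omega) hc h13'

end UnitAcquisition

namespace UnitAcquisition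

open RAM RAM.Instr RAM.Cmd

/-! ### The program: the greedy partition of the spine -/

/-- This lets leaves pay for a number of window tests that is quadratic in the length of a part. -/
theorem sq_le_tentSum (k : ℕ) : k * k + 2 * k ≤ 4 * tentSum k := by
  induction k using tentSum.induct with
  | case1 => simp
  | case2 => simp [tentSum]
  | case3 L ih =>
    rw [tentSum]
    have : (L + 2) * (L + 2) = L * L + 4 * L + 4 := by ring
    have e : L.succ.succ = L + 2 := rfl
    rw [e]
    omega

theorem tentSum_mono : Monotone tentSum := by
  refine monotone_nat_of_le_succ fun k => ?_
  induction k using tentSum.induct with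
  | case1 => simp [tentSum]
  | case2 => simp [tentSum]
  | case3 L ih =>
    rw [tentSum, show L + 2 + 1 = L + 1 + 2 by rfl, tentSum]
    omega

/-- Starts a new part at the position in register `14`. -/
def startPart : Cmd := .all
  [.op (add 11 6 14), .op (load 12 11),
    .ite 1 12 (.op (add 16 14 1)) (.all [.op (add 16 14 1), .op (add 16 16 1)]),
    .op (add 17 16 30), .op (add 18 17 1)]

theorem wp_startPart {n s W τ : ℕ} {l m : ℕ → ℕ} (hm : ∀ i, m (5 * n + i) = l i) (hl : l s ≤ n)
    (hs : s < n) (hW : 20 * n ≤ W) {Q : ℕ → State → Prop} {r : ℕ → ℕ} (hr : Constants n r)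
    (h14 : r 14 = s) (hτ : 10 ≤ τ)
    (hQ : ∀ σ r', τ ≤ σ + 10 → (∀ k, k ≠ 11 → k ≠ 12 → k ≠ 16 → k ≠ 17 → k ≠ 18 → r' k = r k) →
      r' 16 = skipBare l s + 1 → r' 17 = skipBare l s + 1 → r' 18 = skipBare l s + 2 → Q σ ⟨r', m⟩) :
    wp W startPart Q τ ⟨r, m⟩ := by
  obtain ⟨c1, c2, c3, c4, c5, c6, c30⟩ := hr
  by_cases h : 1 ≤ l s
  · have h0 : l s ≠ 0 := by omega
    simp [startPart, wp_all_cons, wp_all_singleton, wp_ite, wp_add, wp_load, c1, c6, c30, h14, hm, h]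
    refine ⟨by omega, by omega, by omega, by omega, by omega, by omega, by omega, by omega, by omega,
      by omega, by omega, hQ _ _ (by omega) (fun k h1 h2 h3 h4 h5 => ?_) ?_ ?_ ?_⟩
    · simp [h1, h2, h3, h4, h5]
    all_goals simp [skipBare, h0]
  · have h0 : l s = 0 := by omega
    simp [startPart, wp_all_cons, wp_all_singleton, wp_ite, wp_add, wp_load, c1, c6, c30, h14, hm, h0]
    refine ⟨by omega, by omega, by omega, by omega, by omega, by omega, by omega, by omega, by omega,
      by omega, by omega, by omega, hQ _ _ (by omega) (fun k h1 h2 h3 h4 h5 => ?_) ?_ ?_ ?_⟩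
    · simp [h1, h2, h3, h4, h5]
    all_goals simp [skipBare, h0]

/-- Tests whether all windows that end at the position in register `17` and start at or after
the one in register `16` have enough leaves. -/
def checkWindows : Cmd := .all
  [.op (sub 8 18 16), .op (const 7 0), .op (const 9 0), .op (const 10 0), .op (const 19 1),
    .op (const 20 0), .op (add 21 6 17),
    .loop 7 8 (.all
      [.op (load 12 21), .op (add 9 9 12), .op (sub 21 21 1),
        .ite 19 9 (.op (const 31 0)) (.op (const 20 1)),
        .op (add 12 10 7), .op (add 10 19 30), .op (add 19 12 1), .op (add 19 19 1),
        .op (add 7 7 1)])]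

theorem windowsOK_iff {l : ℕ → ℕ} {lo b : ℕ} (hlo : lo ≤ b) : WindowsOK l lo b ↔
    ∀ i, 1 ≤ i → i ≤ b + 1 - lo → tentSum i ≤ ∑ z ∈ Finset.Ico (b + 1 - i) (b + 1), l z := by
  constructor
  · intro h i h1 h2
    have := h (b + 1 - i) (by omega) (by omega)
    rwa [show b + 1 - (b + 1 - i) = i by omega, ← Finset.Ico_add_one_right_eq_Icc] at this
  · intro h a h1 h2
    have := h (b + 1 - a) (by omega) (by omega)
    rwa [show b + 1 - (b + 1 - a) = a by omega, Finset.Ico_add_one_right_eq_Icc] at this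

theorem wp_checkWindows {n N lo b W τ : ℕ} {l m : ℕ → ℕ} (hm : ∀ i, m (5 * n + i) = l i)
    (hsum : ∑ i ∈ Finset.range N, l i ≤ n) (hNn : N ≤ n) (hlo : lo ≤ b) (hlo1 : 1 ≤ lo) (hb : b < N)
    (htent : tentSum (b + 2 - lo) ≤ 4 * n) (hW : 20 * n ≤ W) {Q : ℕ → State → Prop} {r : ℕ → ℕ}
    (hr : Constants n r) (h16 : r 16 = lo) (h17 : r 17 = b) (h18 : r 18 = b + 1)
    (hτ : 20 * (b + 1 - lo) + 20 ≤ τ)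
    (hQ : ∀ σ r', τ ≤ σ + (20 * (b + 1 - lo) + 20) →
      (∀ k, k = 0 ∨ k = 13 ∨ k = 14 ∨ k = 16 ∨ k = 17 ∨ k = 18 → r' k = r k) → Constants n r' →
      (r' 20 = 0 ↔ WindowsOK l lo b) → Q σ ⟨r', m⟩) :
    wp W checkWindows Q τ ⟨r, m⟩ := by
  obtain ⟨K, hK⟩ : ∃ K, K = b + 1 - lo := ⟨_, rfl⟩
  rw [← hK] at hτ hQ
  have hsum' : ∀ j, j ≤ b + 1 → ∑ z ∈ Finset.Ico (b + 1 - j) (b + 1), l z ≤ n := by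
    intro j hj
    refine le_trans (Finset.sum_le_sum_of_subset fun z hz => ?_) hsum
    rw [Finset.mem_Ico] at hz
    rw [Finset.mem_range]
    omega
  have hC := hr
  obtain ⟨c1, c2, c3, c4, c5, c6, c30⟩ := hr
  simp only [checkWindows, wp_all_cons, wp_all_singleton, wp_const, wp_sub, wp_add]
  simp [h16, h17, h18, c6, ← hK]
  refine ⟨by omega, by omega, by omega, by omega, by omega, by omega, by omega, by omega, by omega, by omega, ?_⟩
  -- The windows are extended to the left from `b`. Besides the leaf sum, two consecutive values of
  -- `tentSum` are kept, enough for its two-step recursion, and register `20` remains zero as long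
  -- as no short window has been met.
  refine wp_for (i := 0) (hi := K) (k := 18) (fun j s => s.reg 7 = j ∧ s.reg 8 = K ∧
    s.reg 9 = ∑ z ∈ Finset.Ico (b + 1 - j) (b + 1), l z ∧ s.reg 10 = tentSum j ∧
    s.reg 19 = tentSum (j + 1) ∧
    (s.reg 20 = 0 ↔ ∀ i, 1 ≤ i → i ≤ j → tentSum i ≤ ∑ z ∈ Finset.Ico (b + 1 - i) (b + 1), l z) ∧
    s.reg 21 = 5 * n + b - j ∧
    (∀ k, k = 0 ∨ k = 13 ∨ k = 14 ∨ k = 16 ∨ k = 17 ∨ k = 18 → s.reg k = r k) ∧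
    Constants n s.reg ∧ s.mem = m)
    (fun j s hI => ⟨hI.1, hI.2.1⟩) ?_ ?_ (Nat.zero_le _) ?_ ?_
  · rintro j ⟨r1, m'⟩ ⟨h7, h8, h9, h10, h19, h20, h21, hfr, hC1, hmem⟩ - hj
    simp only at h7 h8 h9 h10 h19 h20 h21 hfr hC1 hmem
    subst hmem
    have h30 := hC1.2.2.2.2.2.2
    have h1 := hC1.1
    have t1 := tentSum_mono (show j + 2 ≤ b + 2 - lo by omega)
    have t2 := tentSum_mono (show j + 1 ≤ j + 2 by omega)
    have t3 := tentSum_mono (show j ≤ j + 2 by omega)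
    have t4 : tentSum (j + 2) = tentSum j + j + 2 := rfl
    have hmj : m' (5 * n + b - j) = l (b - j) := by rw [← hm]; congr 1; omega
    have s1 := hsum' (j + 1) (by omega)
    have s2 : ∑ z ∈ Finset.Ico (b + 1 - (j + 1)) (b + 1), l z =
        ∑ z ∈ Finset.Ico (b + 1 - j) (b + 1), l z + l (b - j) := by
      rw [show b + 1 - (j + 1) = b - j by omega, Finset.sum_eq_sum_Ico_succ_bot (by omega),
        show b - j + 1 = b + 1 - j by omega, add_comm]
    have hsucc : (∀ i, 1 ≤ i → i ≤ j + 1 →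
          tentSum i ≤ ∑ z ∈ Finset.Ico (b + 1 - i) (b + 1), l z) ↔
        (∀ i, 1 ≤ i → i ≤ j → tentSum i ≤ ∑ z ∈ Finset.Ico (b + 1 - i) (b + 1), l z) ∧
          tentSum (j + 1) ≤ ∑ z ∈ Finset.Ico (b + 1 - j) (b + 1), l z + l (b - j) := by
      rw [← s2]
      constructor
      · intro h
        exact ⟨fun i h1 h2 => h i h1 (by omega), h (j + 1) (by omega) le_rfl⟩
      · rintro ⟨h, h'⟩ i h1 h2
        rcases Nat.lt_succ_iff_lt_or_eq.mp (Nat.lt_succ_of_le h2) with h3 | rfl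
        · exact h i h1 (by omega)
        · exact h'
    rw [hsucc, s2, ← h20, show j + 1 + 1 = j + 2 by rfl, t4]
    rw [s2] at s1
    clear hsucc hsum' h20 hQ hm hsum
    generalize ∑ z ∈ Finset.Ico (b + 1 - j) (b + 1), l z = A at *
    generalize l (b - j) = B at *
    generalize tentSum (j + 1) = T1 at *
    generalize tentSum j = T0 at *
    by_cases hcmp : T1 ≤ A + B
    · simp [wp_all_cons, wp_all_singleton, wp_ite, wp_const, wp_add, wp_sub, wp_load,
        h7, h8, h9, h10, h19, h21, h30, h1, hmj, hcmp]
      refine ⟨by omega, by omega, by omega, by omega, by omega, by omega, by omega, by omega, by omega,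
        by simp [hfr], hC1.congr fun k hk => ?_⟩
      simp (disch := omega) only [Function.update_of_ne]
    · simp [wp_all_cons, wp_all_singleton, wp_ite, wp_const, wp_add, wp_sub, wp_load,
        h7, h8, h9, h10, h19, h21, h30, h1, hmj, hcmp]
      refine ⟨by omega, by omega, by omega, by omega, by omega, by omega, by omega, by omega, by omega,
        by omega, by simp [hfr], hC1.congr fun k hk => ?_⟩
      simp (disch := omega) only [Function.update_of_ne]
  · simp
    refine ⟨rfl, rfl, fun i h1 h2 => by omega, hC.congr fun k hk => ?_⟩
    simp (disch := omega) only [Function.update_of_ne]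
  · omega
  · rintro σ ⟨r1, m'⟩ ⟨-, -, -, -, -, h20, -, hfr, hC1, hmem⟩ hσ
    simp only at h20 hfr hC1 hmem
    subst hmem
    refine hQ σ r1 (by omega) hfr hC1 ?_
    rw [h20, windowsOK_iff hlo, hK]

end UnitAcquisition

namespace UnitAcquisition

open RAM RAM.Instr RAM.Cmd

/-! ### The greedy loop and its amortised running time. -/

/-- Counts the parts of the greedy partition. -/
def greedyPass : Cmd := .all
  [.op (const 0 1), .op (const 14 0), startPart,
    .loop 18 13 (.all
      [checkWindows,
        .ite 20 30 (.all [.op (add 17 17 1), .op (add 18 18 1)])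
          (.all [.op (add 0 0 1), .op (add 11 6 18), .op (load 12 11),
            .ite 1 12 (.op (add 14 18 30)) (.op (add 14 18 1)), startPart])])]

/-- The time used for the first `k` windows of a part. -/
def partTime (k : ℕ) : ℕ := 10 * (k * k) + 70 * k

/-- The state of the greedy algorithm: in the part that starts at `s`, all windows ending before `b`
are in order, `c` parts are finished, and the time left is at least `τ`. -/
structure GreedyState (l : ℕ → ℕ) (N s b c τ : ℕ) : Prop where
  lt : s < N
  le : skipBare l s + 1 ≤ b
  ok : ∀ b', skipBare l s + 1 ≤ b' → b' < b → WindowsOK l (skipBare l s + 1) b'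
  inside : b = skipBare l s + 1 ∨ b < N
  count : c ≤ s
  greedy : ∀ k, Greedy l N s k → Greedy l N 0 (c + k)
  time : 100 * (∑ z ∈ Finset.Ico (skipBare l s + 1) N, l z + (N - (skipBare l s + 1)) + 1) ≤
    τ + partTime (b - (skipBare l s + 1))

section

variable {l : ℕ → ℕ} {N s b c τ : ℕ}

/-- The windows that have been checked contain enough leaves to pay for the checks. -/
theorem GreedyState.tentSum_le (h : GreedyState l N s b c τ) :
    tentSum (b - (skipBare l s + 1)) ≤ ∑ z ∈ Finset.Ico (skipBare l s + 1) b, l z := by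
  rcases h.le.eq_or_lt with hb | hb
  · rw [← hb, Nat.sub_self]
    exact Nat.zero_le _
  · have := h.ok (b - 1) (by omega) (by omega) _ le_rfl (by omega)
    rwa [show b - 1 + 1 = b by omega, ← Finset.Ico_add_one_right_eq_Icc,
      show b - 1 + 1 = b by omega] at this

/-- The quadratic term is charged to leaves, the rest to spine positions. -/
theorem partTime_le (k : ℕ) : partTime k ≤ 40 * tentSum k + 50 * k := by
  have := sq_le_tentSum k
  unfold partTime
  omega

/-- The increment is `20 * (k + 1) + 60`, the allowance for one round of the loop that tests windows
of lengths up to `k + 1`. -/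
theorem partTime_succ (k : ℕ) : partTime (k + 1) = partTime k + 20 * k + 80 := by
  unfold partTime
  ring

/-- Of the 100 units reserved per leaf and per position, the current part has used at most 40 per
leaf and 50 per position. The remainder covers the next round. -/
theorem GreedyState.le_time (h : GreedyState l N s b c τ) :
    100 + 50 * (N - (skipBare l s + 1)) ≤ τ := by
  have h2 := h.time
  rcases h.inside with hb | hb
  · rw [hb, Nat.sub_self] at h2
    have h6 : partTime 0 = 0 := rfl
    omega
  · have h1 := h.tentSum_le
    have h3 := partTime_le (b - (skipBare l s + 1))
    have h4 := h.le
    have h5 : ∑ z ∈ Finset.Ico (skipBare l s + 1) b, l z ≤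
        ∑ z ∈ Finset.Ico (skipBare l s + 1) N, l z :=
      Finset.sum_le_sum_of_subset (Finset.Ico_subset_Ico le_rfl hb.le)
    omega

theorem GreedyState.advance (h : GreedyState l N s b c τ) (hb : b + 1 < N)
    (hok : WindowsOK l (skipBare l s + 1) b) {σ : ℕ}
    (hσ : τ ≤ σ + (20 * (b + 1 - (skipBare l s + 1)) + 60)) : GreedyState l N s (b + 1) c σ := by
  have hle := h.le
  refine ⟨h.lt, by omega, fun b' h1 h2 => ?_, Or.inr hb, h.count, h.greedy, ?_⟩
  · rcases Nat.lt_succ_iff_lt_or_eq.mp h2 with h3 | rfl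
    · exact h.ok b' h1 h3
    · exact hok
  · have h2 := h.time
    rw [show b + 1 - (skipBare l s + 1) = b - (skipBare l s + 1) + 1 by omega] at hσ ⊢
    rw [partTime_succ]
    omega

/-- Write k for the number of positions already passed in this part. Closing it releases 100 units
for each of at least `tentSum k` leaves and k + 2 positions, which pays for the whole part including
the failed test. -/
theorem GreedyState.next (h : GreedyState l N s b c τ) (hb : b + 1 < N)
    (hfail : ¬ WindowsOK l (skipBare l s + 1) b) (hlast : 0 < l (N - 1)) {σ : ℕ}
    (hσ : τ ≤ σ + (20 * (b + 1 - (skipBare l s + 1)) + 60)) :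
    GreedyState l N (skipBare l (b + 1)) (skipBare l (skipBare l (b + 1)) + 1) (c + 1) σ := by
  have hle := h.le
  have hlt : skipBare l (b + 1) < N := by
    unfold skipBare
    split_ifs with h0
    · by_contra hcon
      rw [show N - 1 = b + 1 by omega] at hlast
      omega
    · omega
  have hs1 : b + 1 ≤ skipBare l (b + 1) := Nat.le_add_right _ _
  have hs2 : skipBare l (b + 1) ≤ skipBare l (skipBare l (b + 1)) := Nat.le_add_right _ _
  have hs3 : skipBare l (skipBare l (b + 1)) ≤ skipBare l (b + 1) + 1 := by
    rw [skipBare.eq_def l (skipBare l (b + 1))]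
    split_ifs <;> omega
  have hs4 : s ≤ skipBare l s := Nat.le_add_right _ _
  refine ⟨hlt, le_rfl, fun b' h1 h2 => by omega, Or.inl rfl, ?_, fun k hk => ?_, ?_⟩
  · have := h.count
    omega
  · have := h.greedy (k + 1) (Greedy.step s b k hle hb (fun b' h1 h2 => h.ok b' h1 h2) hfail hk)
    rwa [show c + 1 + k = c + (k + 1) by omega]
  · have h1 := h.tentSum_le
    have h2 := h.time
    have h3 := partTime_le (b - (skipBare l s + 1))
    have h4 := Finset.sum_Ico_consecutive l hle (show b ≤ N by omega)
    have h5 : ∑ z ∈ Finset.Ico (skipBare l (skipBare l (b + 1)) + 1) N, l z ≤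
        ∑ z ∈ Finset.Ico b N, l z :=
      Finset.sum_le_sum_of_subset (Finset.Ico_subset_Ico (by omega) le_rfl)
    rw [Nat.sub_self]
    have h6 : partTime 0 = 0 := rfl
    omega

theorem GreedyState.greedy_zero (h : GreedyState l N s b c τ) (hb : N ≤ b + 1) :
    Greedy l N 0 (c + 1) :=
  h.greedy 1 (Greedy.last s h.lt fun b' h1 h2 => h.ok b' h1 (by omega))

end

/-- The invariant of the loop of the greedy algorithm. -/
def GreedyInvariant (n : ℕ) (l m : ℕ → ℕ) (N ρ : ℕ) (s' : State) : Prop :=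
  ∃ s b c, GreedyState l N s b c ρ ∧ Constants n s'.reg ∧
    s'.reg 0 = c + 1 ∧ s'.reg 13 = N ∧ s'.reg 16 = skipBare l s + 1 ∧ s'.reg 17 = b ∧
    s'.reg 18 = b + 1 ∧ s'.mem = m

theorem wp_greedyPass {n N W τ : ℕ} {l m : ℕ → ℕ} (hm : ∀ i, m (5 * n + i) = l i)
    (hsum : N + ∑ i ∈ Finset.range N, l i ≤ n) (hl0 : ∀ i, N ≤ i → l i = 0) (hN : 0 < N)
    (hlast : 0 < l (N - 1)) (hW : 20 * n ≤ W) {Q : ℕ → State → Prop} {r : ℕ → ℕ}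
    (hr : Constants n r) (h13 : r 13 = N) (hτ : 300 * n ≤ τ)
    (hQ : ∀ σ r', Greedy l N 0 (r' 0) → Q σ ⟨r', m⟩) :
    wp W greedyPass Q τ ⟨r, m⟩ := by
  have hl : ∀ i, l i ≤ n := fun i => by
    by_cases hi : i < N
    · have := Finset.single_le_sum (f := l) (fun j _ => Nat.zero_le _) (Finset.mem_range.mpr hi)
      omega
    · rw [hl0 i (by omega)]
      exact Nat.zero_le _
  have hsub : ∀ a b, b ≤ N → ∑ z ∈ Finset.Ico a b, l z ≤ ∑ i ∈ Finset.range N, l i := fun a b hb =>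
    Finset.sum_le_sum_of_subset fun z hz => by
      rw [Finset.mem_Ico] at hz
      rw [Finset.mem_range]
      omega
  have hC := hr
  obtain ⟨c1, c2, c3, c4, c5, c6, c30⟩ := hr
  simp only [greedyPass, wp_all_cons, wp_all_singleton, wp_const]
  refine ⟨by omega, by omega, by omega, by omega, ?_⟩
  refine wp_startPart (s := 0) hm (hl 0) (by omega) hW (hC.congr fun k hk => ?_) (by simp) (by omega)
    fun σ r1 hσ hfr h16 h17 h18 => ?_
  · simp (disch := omega) only [Function.update_of_ne]
  have hC1 : Constants n r1 := hC.congr fun k hk => by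
    rw [hfr k (by omega) (by omega) (by omega) (by omega) (by omega)]
    simp (disch := omega) only [Function.update_of_ne]
  have h0 : r1 0 = 1 := by rw [hfr 0 (by simp) (by simp) (by simp) (by simp) (by simp)]; simp
  have h13' : r1 13 = N := by
    rw [hfr 13 (by simp) (by simp) (by simp) (by simp) (by simp)]; simp [h13]
  refine wp_loop (GreedyInvariant n l m N) ?_ ?_ _ _ ⟨0, skipBare l 0 + 1, 0, ⟨hN, le_rfl, fun b' h1 h2 => by omega,
      Or.inl rfl, le_rfl, fun k hk => by rwa [zero_add], ?_⟩, hC1, h0, h13', h16, h17, h18, rfl⟩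
  · rintro ρ ⟨r, m'⟩ ⟨s, b, c, hG, hC, h0, h13, h16, h17, h18, hmem⟩ hlt
    simp only at hC h0 h13 h16 h17 h18 hmem hlt
    subst hmem
    have ht := hG.le_time
    have hle := hG.le
    have hcs := hG.count
    have hsN := hG.lt
    have hb : b + 1 < N := by omega
    have h1 := hG.tentSum_le
    have h2 := hsub (skipBare l s + 1) b (by omega)
    refine ⟨by omega, ?_⟩
    simp only [wp_all_cons, wp_all_singleton]
    refine wp_checkWindows hm (N := N) (by omega) (by omega) hle (Nat.le_add_left _ _) (by omega) ?_ hW hC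
      h16 h17 h18 (by omega) fun σ r2 hσ hfr hC2 h20 => ?_
    -- `tentSum` grows quadratically, but it stays linear in `n` here: the tested windows bound it
    -- by the number of leaves, and two more positions add only a linear term.
    · rw [show b + 2 - (skipBare l s + 1) = b - (skipBare l s + 1) + 2 by omega, tentSum]
      omega
    have f0 := (hfr 0 (by simp)).trans h0
    have f13 := (hfr 13 (by simp)).trans h13
    have f16 := (hfr 16 (by simp)).trans h16
    have f17 := (hfr 17 (by simp)).trans h17
    have f18 := (hfr 18 (by simp)).trans h18
    have f1 := hC2.1
    have f6 := hC2.2.2.2.2.2.1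
    have f30 := hC2.2.2.2.2.2.2
    have h20' : r2 20 ≤ r2 30 ↔ WindowsOK l (skipBare l s + 1) b := by rw [f30, Nat.le_zero, h20]
    simp only [wp_ite (a := 20)]
    by_cases hok : WindowsOK l (skipBare l s + 1) b
    · rw [if_pos (h20'.mpr hok)]
      simp only [wp_all_cons, wp_all_singleton, wp_add, f17, f1]
      refine ⟨by omega, by omega, by omega, ?_⟩
      simp [f18]
      refine ⟨by omega, by omega, s, b + 1, c, hG.advance hb hok (by omega), hC2.congr fun k hk => ?_,
        f0, f13, f16, rfl, by simp [f1], rfl⟩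
      simp (disch := omega) only [Function.update_of_ne]
    · rw [if_neg (mt h20'.mp hok)]
      have hl1 := hl (b + 1)
      have hfin : ∀ σ' r3, ρ ≤ σ' + (20 * (b + 1 - (skipBare l s + 1)) + 35) →
          (∀ k, k ≠ 0 → k ≠ 11 → k ≠ 12 → k ≠ 14 → r3 k = r2 k) → r3 0 = c + 2 →
          r3 14 = skipBare l (b + 1) → wp W startPart (GreedyInvariant n l m' N) σ' ⟨r3, m'⟩ := by
        intro σ' r3 hσ' hfr3 h30 h314
        have hC3 : Constants n r3 :=
          hC2.congr fun k hk => hfr3 k (by omega) (by omega) (by omega) (by omega)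
        have hnext := fun σ hσ => hG.next hb hok hlast (σ := σ) hσ
        have hlt' := (hnext ρ (by omega)).lt
        refine wp_startPart hm (hl _) (by omega) hW hC3 h314 (by omega)
          fun σ4 r4 hσ4 hfr4 g16 g17 g18 => ⟨_, _, c + 1, hnext σ4 (by omega), hC3.congr fun k hk =>
            hfr4 k (by omega) (by omega) (by omega) (by omega) (by omega), ?_, ?_, g16, g17, g18, rfl⟩
        · simp only
          rw [hfr4 0 (by simp) (by simp) (by simp) (by simp) (by simp), h30]
        · simp only
          rw [hfr4 13 (by simp) (by simp) (by simp) (by simp) (by simp),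
            hfr3 13 (by simp) (by simp) (by simp) (by simp), f13]
      simp only [wp_all_cons, wp_add, f0, f1]
      refine ⟨by omega, by omega, by omega, ?_⟩
      simp [wp_load, wp_ite, f1, f6, f18, hm]
      refine ⟨by omega, by omega, by omega, by omega, ?_⟩
      by_cases hl2 : 1 ≤ l (b + 1)
      · rw [if_pos hl2, wp_add]
        simp [f18, f30]
        rw [wp_all_singleton]
        refine ⟨by omega, by omega, by omega, hfin _ _ (by omega) (fun k k0 k11 k12 k14 => ?_) ?_ ?_⟩
        · simp [k0, k11, k12, k14]
        · simp
        · simp [skipBare, show l (b + 1) ≠ 0 by omega]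
      · rw [if_neg hl2, wp_add]
        simp [f18, f1]
        rw [wp_all_singleton]
        refine ⟨by omega, by omega, by omega, hfin _ _ (by omega) (fun k k0 k11 k12 k14 => ?_) ?_ ?_⟩
        · simp [k0, k11, k12, k14]
        · simp
        · simp [skipBare, show l (b + 1) = 0 by omega]
  · rintro ρ ⟨r, m'⟩ ⟨s, b, c, hG, hC, h0, h13, h16, h17, h18, hmem⟩ hge
    simp only at h0 h13 h18 hmem hge
    subst hmem
    have ht := hG.le_time
    refine ⟨by omega, hQ _ _ ?_⟩
    rw [h0]
    exact hG.greedy_zero (by omega)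
  -- Leaves and spine positions together number at most `n`, so the reserve needed at the start is
  -- at most `100 * (n + 1)`.
  · have := hsub (skipBare l 0 + 1) N le_rfl
    rw [Nat.sub_self]
    omega

end UnitAcquisition

namespace UnitAcquisition

open RAM RAM.Instr RAM.Cmd

/-! ### The whole algorithm -/

theorem Reachable.exists_pos {V : Type*} [DecidableEq V] [Nonempty V] {G : SimpleGraph V} {w : V → ℕ}
    (h : Reachable G w) : ∃ x, 0 < w x := by
  unfold Reachable at h
  induction h with
  | refl => exact ⟨Classical.arbitrary V, one_pos⟩
  | tail _ hm _ =>
    obtain ⟨u, v, _, _, _, rfl⟩ := hm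
    exact ⟨v, by simp⟩

/-- If no vertex of a connected graph has two neighbours, all the weight can be moved to one vertex. -/
theorem unitAcquisitionNumber_eq_one {V : Type*} [Fintype V] [DecidableEq V] {G : SimpleGraph V}
    (hG : G.Connected) (h : ∀ x y z, G.Adj x y → G.Adj x z → y = z) : unitAcquisitionNumber G = 1 := by
  have := hG.nonempty
  refine le_antisymm (Nat.sInf_le ?_) (le_csInf ⟨_, fun _ => 1, Relation.ReflTransGen.refl, rfl⟩ ?_)
  · obtain ⟨x⟩ := this
    by_cases hx : ∃ u, G.Adj x u
    · obtain ⟨u, hu⟩ := hx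
      have hall := IsLeaf.eq_or_eq hG (x := x) (u := u) ⟨u, hu, fun y hy => h _ _ _ hy hu⟩
        ⟨x, hu.symm, fun y hy => h _ _ _ hy hu.symm⟩ hu
      refine ⟨_, Relation.ReflTransGen.single ⟨x, u, hu, one_pos, le_rfl, rfl⟩,
        Finset.card_eq_one.mpr ⟨u, ?_⟩⟩
      ext y
      rcases hall y with rfl | rfl
      · simp [hu.ne]
      · simp
    · refine ⟨_, Relation.ReflTransGen.refl, Finset.card_eq_one.mpr ⟨x, ?_⟩⟩
      ext y
      obtain ⟨p⟩ := hG.preconnected x y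
      cases p with
      | nil => simp
      | cons hadj _ => exact absurd ⟨_, hadj⟩ hx
  · rintro k ⟨w, hw, rfl⟩
    obtain ⟨x, hx⟩ := hw.exists_pos
    exact Finset.card_pos.mpr ⟨x, by simpa using hx⟩

theorem SpineData.card_filter {n N : ℕ} {es : List (ℕ × ℕ)} {v l : ℕ → ℕ} (h : SpineData n es N v l) :
    ((Finset.range n).filter fun x => 2 ≤ UnitAcquisition.degree es x).card = N := by
  have : (Finset.range n).filter (fun x => 2 ≤ UnitAcquisition.degree es x) =
      (Finset.range N).image v := by
    ext x
    simp only [Finset.mem_filter, Finset.mem_range, Finset.mem_image]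
    constructor
    · rintro ⟨h1, h2⟩
      exact (h.degree x h1).mp h2
    · rintro ⟨i, hi, rfl⟩
      exact ⟨h.lt i hi, (h.degree _ (h.lt i hi)).mpr ⟨i, hi, rfl⟩⟩
  rw [this, Finset.card_image_of_injOn, Finset.card_range]
  intro i hi j hj hij
  exact h.inj i (Finset.mem_range.mp hi) j (Finset.mem_range.mp hj) hij

theorem getElem?_flatMap_pair {α : Type*} (f g : α → ℕ) (es : List α) (j : ℕ) :
    (es.flatMap fun e => [f e, g e])[2 * j]? = (es[j]?).map f ∧
      (es.flatMap fun e => [f e, g e])[2 * j + 1]? = (es[j]?).map g := by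
  induction es generalizing j with
  | nil => simp
  | cons e es ih =>
    cases j with
    | zero => simp
    | succ j => simpa [Nat.mul_succ] using ih j

theorem length_encodeGraph {n : ℕ} (es : List (Fin n × Fin n)) :
    (encodeGraph es).length = 2 * es.length + 2 := by
  simp [encodeGraph, List.length_flatMap]
  omega

theorem isInput_encodeGraph {n : ℕ} {es : List (Fin n × Fin n)} (h : es.length + 1 = n) :
    IsInput n (natEdges es) fun i => (encodeGraph es).getD i 0 := by
  have key : ∀ j a b : ℕ, (natEdges es)[j]? = some (a, b) →
      (encodeGraph es).getD (2 * j + 2) 0 = a ∧ (encodeGraph es).getD (2 * j + 3) 0 = b ∧ a < n ∧ b < n := by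
    intro j a b hab
    rw [natEdges, List.getElem?_map, Option.map_eq_some_iff] at hab
    obtain ⟨e, he, hab⟩ := hab
    rw [Prod.mk.injEq] at hab
    obtain ⟨rfl, rfl⟩ := hab
    have := getElem?_flatMap_pair (fun e : Fin n × Fin n => (e.1 : ℕ)) (fun e => (e.2 : ℕ)) es j
    rw [he] at this
    refine ⟨?_, ?_, e.1.2, e.2.2⟩
    · simp [encodeGraph, List.getD_eq_getElem?_getD, this.1]
    · simp [encodeGraph, List.getD_eq_getElem?_getD, this.2]
  refine ⟨rfl, ?_, fun j a b hab => (key j a b hab).1, fun j a b hab => (key j a b hab).2.1,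
    fun j a b hab => (key j a b hab).2.2, ?_⟩
  · simp [encodeGraph, natEdges]
  · simpa [natEdges] using h

/-- The algorithm for caterpillars. -/
def caterpillarProgram : Cmd := .all
  [.op (const 1 1), .op (const 30 0), .op (load 2 30), .op (add 3 2 2), .op (add 4 3 2),
    .op (add 5 4 2), .op (add 6 5 2), .op (load 8 1), degreePass, neighborPass, scanPass,
    .ite 13 30 (.op (const 0 1)) (.all [walkPass, greedyPass])]

theorem wp_caterpillarProgram {n : ℕ} {T : SimpleGraph (Fin n)} (hT : IsCaterpillar T)
    {es : List (Fin n × Fin n)} (hes : IsEdgeList T es) :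
    wp (500 * n) caterpillarProgram (fun _ s => s.reg 0 = unitAcquisitionNumber T) (500 * n)
      ⟨fun _ => 0, fun i => (encodeGraph es).getD i 0⟩ := by
  have hlen := hes.length_add_one hT.1
  have hin := isInput_encodeGraph hlen
  have hn : 1 ≤ n := by omega
  have hlen' : (natEdges es).length = es.length := List.length_map ..
  have hD : ∀ x, degree (natEdges es) x ≤ 2 * n := fun x => by
    have h1 := tally_le (fun _ => 1) (fun _ => le_rfl) (natEdges es) x
    unfold degree
    omega
  have hF : ∀ x, leafDegree (natEdges es) x ≤ 2 * n := fun x => by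
    have h1 := tally_le (fun y => if degree (natEdges es) y ≤ 1 then 1 else 0)
      (fun y => by split_ifs <;> omega) (natEdges es) x
    unfold leafDegree
    omega
  have hdeg : ∀ x y z : Fin n, T.Adj x y → T.Adj x z → y ≠ z → 2 ≤ degree (natEdges es) x := by
    classical
    intro x y z hy hz hyz
    rw [degree, hes.tally_eq, ← Finset.card_eq_sum_ones]
    exact Finset.one_lt_card.mpr ⟨y, by simpa using hy, z, by simpa using hz, hyz⟩
  have hS : ∀ x < n, spineSum (natEdges es) x ≤ 2 * n := by
    by_cases hsp : ∃ x y z : Fin n, T.Adj x y ∧ T.Adj x z ∧ y ≠ z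
    · obtain ⟨x, y, z, hy, hz, hyz⟩ := hsp
      obtain ⟨N, v, hv⟩ := hT.exists_isSpine hy hz hyz
      exact (hv.spineData hes).spineSum_le
    -- Without a vertex that has two neighbours, no neighbour counts as a spine vertex and all the
    -- sums vanish.
    · push Not at hsp
      intro x hx
      have h0 : spineSum (natEdges es) x = 0 := by
        classical
        rw [spineSum, hes.tally_eq _ ⟨x, hx⟩]
        refine Finset.sum_eq_zero fun y _ => if_pos ?_
        rw [degree, hes.tally_eq, ← Finset.card_eq_sum_ones]
        refine Finset.card_le_one.mpr fun a ha b hb => hsp y a b ?_ ?_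
        · simpa using ha
        · simpa using hb
      omega
  -- A tree has `n - 1` edges, so the input fills exactly the cells below `2 * n`, and the four
  -- arrays start out as zero.
  have hmem : (fun i => (encodeGraph es).getD i 0) =
      layout n (fun i => (encodeGraph es).getD i 0) 0 0 0 0 := by
    funext i
    unfold layout
    split_ifs with h
    · rfl
    all_goals
      rw [List.getD_eq_default _ _ (by rw [length_encodeGraph]; omega)]
      rfl
  generalize (fun i => (encodeGraph es).getD i 0) = m at hin hmem ⊢
  have h0 : m 0 = n := hin.zero
  have h1 : m 1 = (natEdges es).length := hin.one
  simp only [caterpillarProgram, wp_all_cons, wp_all_singleton]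
  simp [wp_const, wp_add, wp_load, h0, h1]
  refine ⟨by omega, by omega, by omega, by omega, by omega, by omega, by omega, by omega, by omega,
    by omega, by omega, by omega, by omega, by omega, ?_⟩
  rw [hmem]
  refine wp_degreePass hin (by omega) ?_ (by simp) (by omega) fun σ1 r1 hσ1 hC1 h8 => ?_
  · simp [Constants]
    omega
  refine wp_neighborPass hin (by omega) hS hC1 h8 (by omega) fun σ2 r2 hσ2 hC2 => ?_
  refine wp_scanPass (by omega) hn (fun x _ => hD x) (fun x _ => hF x) hC2 (by omega)
    fun σ3 r3 hσ3 hC3 h13 h14 => ?_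
  rw [wp_ite]
  have h30 : r3 30 = 0 := hC3.2.2.2.2.2.2
  simp only [h30, Nat.le_zero]
  by_cases hsp : ∃ x y z : Fin n, T.Adj x y ∧ T.Adj x z ∧ y ≠ z
  · obtain ⟨x, y, z, hy, hz, hyz⟩ := hsp
    obtain ⟨N, v, hv⟩ := hT.exists_isSpine hy hz hyz
    have hd := hv.spineData hes
    have hN := hd.pos
    rw [hd.card_filter] at h13
    obtain ⟨hst, hst2, hste⟩ := h14 ⟨v 0, (v 0).2, (hd.degree _ (v 0).2).mpr ⟨0, hN, rfl⟩, by
      rw [hd.leafDegree 0 hN]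
      exact (hd.end_iff 0 hN).mpr (Or.inl rfl)⟩
    obtain ⟨i, hi, hvi⟩ := (hd.degree _ hst).mp hst2
    -- The scan may have stored either end; the spine is oriented to start at the stored one.
    obtain ⟨v', hv', hstart⟩ : ∃ v', IsSpine T N v' ∧ r3 14 = v' 0 := by
      rw [← hvi, hd.leafDegree i hi] at hste
      rcases (hd.end_iff i hi).mp hste with rfl | hi'
      · exact ⟨v, hv, hvi.symm⟩
      · exact ⟨_, hv.reverse, by rw [← hvi]; congr 2; omega⟩
    have hd' := hv'.spineData hes
    have hsum := hd'.sum_leaf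
    have hl : ∀ j, leafCount T N v' j ≤ n := fun j => by
      by_cases hj : j < N
      · have := Finset.single_le_sum (f := leafCount T N v') (fun j _ => Nat.zero_le _)
          (Finset.mem_range.mpr hj)
        omega
      · rw [hd'.leaf_eq_zero j (by omega)]
        exact Nat.zero_le _
    rw [if_neg (by omega)]
    refine ⟨by omega, ?_⟩
    simp only [wp_all_cons, wp_all_singleton]
    refine wp_walkPass (by omega) hd'.lt hd'.leafDegree hd'.spineSum (by omega) hl hd'.leaf_eq_zero hN
      hC3 h13 hstart (by omega) fun σ4 r4 hσ4 hC4 h13' => ?_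
    exact wp_greedyPass (fun i => layout_leaves) hsum.le hd'.leaf_eq_zero hN hd'.leaf_last (by omega)
      hC4 h13' (by omega) fun σ5 r5 hg => (hv'.unitAcquisitionNumber_eq hg).symm
  · push Not at hsp
    have hzero : r3 13 = 0 := by
      classical
      rw [h13, Finset.card_eq_zero, Finset.filter_eq_empty_iff]
      intro x hx h2
      rw [degree, hes.tally_eq _ ⟨x, Finset.mem_range.mp hx⟩, ← Finset.card_eq_sum_ones] at h2
      obtain ⟨a, ha, b, hb, hab⟩ := Finset.one_lt_card.mp h2
      exact hab (hsp _ a b (by simpa using ha) (by simpa using hb))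
    rw [if_pos hzero, wp_const, unitAcquisitionNumber_eq_one hT.1.connected hsp]
    exact ⟨by omega, by omega, by omega, by simp⟩

end UnitAcquisition

theorem mainTheorem7 :
    ∃ (P : RAM.Program) (C : ℕ),
      ∀ (n : ℕ) (T : SimpleGraph (Fin n)), UnitAcquisition.IsCaterpillar T →
        ∀ es : List (Fin n × Fin n), UnitAcquisition.IsEdgeList T es →
          RAM.ComputesWithin P (UnitAcquisition.encodeGraph es)
            (UnitAcquisition.unitAcquisitionNumber T) (C * n) (C * n) := by
  -- The passes are allotted `20 n`, `30 n`, `30 n`, `30 n` and `300 n` steps; since `1 ≤ n`, the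
  -- rest covers the remaining instructions. Words of size `20 n` would already do for the passes.
  refine ⟨UnitAcquisition.caterpillarProgram.compile 0, 500, fun n T hT es hes => ?_⟩
  refine RAM.wp.computesWithin (fun x hx => ?_) (UnitAcquisition.wp_caterpillarProgram hT hes)
  have hlen := hes.length_add_one hT.1
  rw [UnitAcquisition.encodeGraph, List.mem_cons, List.mem_cons, List.mem_flatMap] at hx
  rcases hx with rfl | rfl | ⟨e, _, he⟩
  · omega
  · omega
  · have h1 := e.1.2
    have h2 := e.2.2
    simp only [List.mem_cons, List.not_mem_nil, or_false] at he
    omega
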